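/- Let $n\ge 1$ and let $\alpha_1,\dots,\alpha_n$ be simple roots of type $B_n$, with $\alpha_n$ short, realised in $\mathbb{R}^n$ and normalised so that short roots have norm $(\alpha,\alpha)=2$ and long roots have norm $4$. Put $\ell=2p=4$ and $$\Lambda^\oplus=\sqrt2\,\Lambda_R^\vee=\sum_i\mathbb{Z}\,\sqrt2\,\alpha_i^\vee,\qquad \Lambda^\ominus=\tfrac1{\sqrt2}\Lambda_R,\qquad \alpha_{i\ldots n}^{\ominus}=-\tfrac1{\sqrt2}(\alpha_i+\cdots+\alpha_n)\quad(1\le i\le n).$$ Let $\kappa:\Lambda^\ominus\times\Lambda^\ominus\to\mathbb{C}^\times$ be any normalised $2$-cocycle with $\kappa(\alpha,\beta)=(-1)^{(\alpha,\beta)+(\alpha,\alpha)(\beta,\beta)}\kappa(\beta,\alpha)$. Let $\mathcal{V}_{\Lambda^\ominus}$ be the lattice vertex superalgebra of $\Lambda^\ominus$ twisted by $\kappa$: it is spanned by the elements $u\,e^{\phi_\lambda}$ with $\lambda\in\Lambda^\ominus$ and $u$ a differential polynomial in $\partial\phi$, with $e^{\phi_\beta}e^{\phi_\alpha}=\kappa(\beta,\alpha)e^{\phi_{\alpha+\beta}}$.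 Let $\mathcal{V}_{\Lambda^\oplus}\subset\mathcal{V}_{\Lambda^\ominus}$ be the span of the $u\,e^{\phi_\lambda}$ with $\lambda\in\Lambda^\oplus$, and let $\zeta_\alpha=\operatorname{Res}_z Y(e^{\phi_\alpha},z)$ be the screening operator of $\alpha\in\Lambda^\ominus$. Then: 1. The vectors $\alpha_{1\ldots n}^\ominus,\dots,\alpha_{n\ldots n}^\ominus$ are orthonormal, and $\Lambda^\oplus$ is the $D_n$ ("chessboard") lattice $\{\sum_i x_i\,\alpha_{i\ldots n}^\ominus : x_i\in\mathbb{Z},\ \sum_i x_i \text{ even}\}$. 2. The $n$ fermionic (odd) short screenings $\zeta_{\alpha_{i\ldots n}^\ominus}$ on $\mathcal{V}_{\Lambda^\ominus}$ commute in the super sense: $\zeta_{\alpha_{i\ldots n}^\ominus}\zeta_{\alpha_{j\ldots n}^\ominus}=-\zeta_{\alpha_{j\ldots n}^\ominus}\zeta_{\alpha_{i\ldots n}^\ominus}$ for all $i,j$; in particular each of them squares to zero. 3. $\mathcal{V}_{\Lambda^\oplus}$ is a vertex algebra, and the joint kernel $$\mathcal{W}_{B_n,\ell=4}:=\bigcap_{i=1}^n\ker\bigl(\zeta_{\alpha_{i\ldots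 n}^\ominus}|_{\mathcal{V}_{\Lambda^\oplus}}\bigr)$$ is a vertex subalgebra of it. Let $\mathcal{V}_{\mathcal{SF}_n}$ be the vertex superalgebra of $n$ pairs of symplectic fermions, that is, the exterior algebra on the negative modes of odd fields $\psi^i,\psi^{*i}$ ($1\le i\le n$) whose only non-zero anticommutators are $[\psi^i_m,\psi^{*j}_k]_+=m\,\delta_{ij}\,\delta_{m+k,0}$, where the modes of index $\ge0$ annihilate the vacuum. Its even part $\mathcal{V}_{\mathcal{SF}_n^{even}}$ is a vertex algebra, and it is isomorphic as a vertex algebra to $\mathcal{W}_{B_n,\ell=4}$. -/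

import Mathlib

open scoped InnerProductSpace

noncomputable section

/-! ## Vertex algebras -/

/-- A (purely even) vertex algebra over `ℂ`, given by its vacuum and its `m`-th products
`mode m a b = a_(m) b`, where `Y(a, z) b = ∑ₘ a_(m) b z^(-m-1)`. The translation operator is
`T a = a_(-2) 𝟙`, and locality is the coefficientwise form of `(z - w)^N [Y(a, z), Y(b, w)] = 0`. -/
structure VertexAlgebra (V : Type*) [AddCommGroup V] [Module ℂ V] where
  vac : V
  mode : ℤ → V →ₗ[ℂ] V →ₗ[ℂ] V
  truncation : ∀ a b : V, ∃ N : ℤ, ∀ m : ℤ, N ≤ m → mode m a b = 0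
  vac_mode : ∀ (m : ℤ) (b : V), mode m vac b = if m = -1 then b else 0
  mode_vac : ∀ a : V, mode (-1) a vac = a
  mode_vac_of_nonneg : ∀ (m : ℤ) (a : V), 0 ≤ m → mode m a vac = 0
  translation : ∀ (m : ℤ) (a b : V),
    mode (-2) (mode m a b) vac - mode m a (mode (-2) b vac) = (-(m : ℂ)) • mode (m - 1) a b
  locality : ∀ a b : V, ∃ N : ℕ, ∀ (m k : ℤ) (c : V),
    ∑ j ∈ Finset.range (N + 1), ((-1 : ℂ) ^ j * (N.choose j : ℂ)) •
      (mode (m + N - j) a (mode (k + j) b c) - mode (k + j) b (mode (m + N - j) a c)) = 0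

/-- Isomorphisms of vertex algebras. -/
structure VertexAlgebra.Iso {V W : Type*} [AddCommGroup V] [Module ℂ V] [AddCommGroup W]
    [Module ℂ W] (A : VertexAlgebra V) (B : VertexAlgebra W) where
  toEquiv : V ≃ₗ[ℂ] W
  map_vac : toEquiv A.vac = B.vac
  map_mode : ∀ (m : ℤ) (a b : V), toEquiv (A.mode m a b) = B.mode m (toEquiv a) (toEquiv b)

/-- The vertex algebra structure `A` on the subspace `U` of `V` is the restriction to `U` of the
vacuum `vac` and of the products `Y a m b = a_(m) b` on `V`; in particular `U` contains `vac` and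
is closed under these products. -/
def VertexAlgebra.IsRestrictionOf {V : Type*} [AddCommGroup V] [Module ℂ V] {U : Submodule ℂ V}
    (A : VertexAlgebra U) (vac : V) (Y : V → ℤ → V → V) : Prop :=
  (A.vac : V) = vac ∧ ∀ (m : ℤ) (a b : U), (A.mode m a b : V) = Y a m b

/-- Modes of a normally ordered product. If `a m`, `B m` are the modes of the fields
`a(z) = ∑ₘ a_m z^(-m-1)` and `B(z) = ∑ₘ B_m z^(-m-1)`, and `ε` is the sign of exchanging them
(`-1` if both are odd, else `1`), these are the modes of `:(∂ᵏ a / k!)(z) B(z):`, that is,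
`(a_(-k-1) b)_(m) = ∑_{j ≥ 0} C(k+j, j) (a_(-k-1-j) b_(m+j) + (-1)^k ε b_(m-k-1-j) a_(j))`.
Applied to a vector, only finitely many terms are non-zero when `a` and `B` are fields. -/
def normalOrder {V : Type*} [AddCommGroup V] [Module ℂ V] (a : ℤ → V → V) (ε : ℂ) (k : ℕ)
    (B : ℤ → V → V) (m : ℤ) (v : V) : V :=
  ∑ᶠ j : ℕ, ((k + j).choose j : ℂ) •
    (a (-k - 1 - j) (B (m + j) v) + ((-1) ^ k * ε) • B (m - k - 1 - j) (a j v))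

/-! ## Lattice vertex algebras -/

/-- The Euclidean space `ℝⁿ`. -/
abbrev Euc (n : ℕ) : Type := EuclideanSpace ℝ (Fin n)

/-- Differential polynomials: `X (i, k)` is the symbol `∂^{1+k}φ_{e_i}`, with `e_i` the standard
basis of `ℝⁿ`. -/
abbrev DiffPoly (n : ℕ) : Type := MvPolynomial (Fin n × ℕ) ℂ

/-- The differential polynomial `∂φ_α`. -/
def dPhi {n : ℕ} (α : Euc n) : DiffPoly n :=
  ∑ i, MvPolynomial.C (α i : ℂ) * MvPolynomial.X (i, 0)

/-- The derivation `∂` on differential polynomials, `∂(∂^{1+k}φ) = ∂^{2+k}φ`. -/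
def diffPolyDeriv (n : ℕ) : Derivation ℂ (DiffPoly n) (DiffPoly n) :=
  MvPolynomial.mkDerivation ℂ fun s => MvPolynomial.X (s.1, s.2 + 1)

/-- The differential polynomial `P_j` with `(1/j!) ∂ʲ e^{φ_α} = P_j e^{φ_α}`, where
`∂ (u e^{φ_α}) = (∂u + u ∂φ_α) e^{φ_α}`. -/
def expCoeff {n : ℕ} (α : Euc n) : ℕ → DiffPoly n
  | 0 => 1
  | j + 1 => ((j + 1 : ℂ)⁻¹) • (diffPolyDeriv n (expCoeff α j) + dPhi α * expCoeff α j)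

/-- `expCoeff` extended by zero to negative indices. -/
def expCoeffInt {n : ℕ} (α : Euc n) : ℤ → DiffPoly n
  | Int.ofNat j => expCoeff α j
  | Int.negSucc _ => 0

/-- The algebra map `u ↦ ⟨e^{φ_α}, u⁽¹⁾⟩ u⁽²⁾` for the primitive coproduct and the pairing
`⟨e^{φ_α}, ∂^{1+k}φ_β⟩ = -k! (α, β) z^{-1-k}`; the polynomial variable is `z⁻¹`. -/
def expPairing {n : ℕ} (α : Euc n) : DiffPoly n →ₐ[ℂ] Polynomial (DiffPoly n) :=
  MvPolynomial.aeval fun s =>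
    Polynomial.C (MvPolynomial.X s) -
      Polynomial.C (MvPolynomial.C ((α s.1 : ℂ) * (s.2.factorial : ℂ))) *
        Polynomial.X ^ (s.2 + 1)

/-- The inner product as an integer: exact on integral lattices. -/
def intInner {n : ℕ} (x y : Euc n) : ℤ := ⌊⟪x, y⟫_ℝ⌋

/-- The space of the lattice (super) vertex algebra of `Λ ⊆ ℝⁿ` of full rank: finite sums of
`u e^{φ_λ}` (written `Finsupp.single λ u`) with `λ ∈ Λ` and `u` a differential polynomial. -/
abbrev LatticeSpace {n : ℕ} (Λ : AddSubgroup (Euc n)) : Type := Λ →₀ DiffPoly n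

section Lattice

variable {n : ℕ} {Λ : AddSubgroup (Euc n)} (κ : Λ → Λ → ℂˣ)

/-- The vacuum `e^{φ_0}`. -/
def latticeVac (Λ : AddSubgroup (Euc n)) : LatticeSpace Λ := Finsupp.single 0 1

/-- The `m`-th product with `e^{φ_α}`, i.e. the `z^{-m-1}`-coefficient of
`Y(e^{φ_α}) v e^{φ_β} = κ(β, α) z^{(α,β)} ∑_j ⟨e^{φ_α}, v⁽¹⁾⟩ v⁽²⁾ (z^j/j!) (∂ʲ e^{φ_α}) e^{φ_β}`,
where the group algebra is twisted by `e^{φ_β} e^{φ_α} = κ(β, α) e^{φ_{β+α}}`. -/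
def expMode (α : Λ) (m : ℤ) : LatticeSpace Λ →ₗ[ℂ] LatticeSpace Λ :=
  Finsupp.lsum ℂ fun β : Λ =>
    Finsupp.lsingle (β + α) ∘ₗ
      ((κ β α : ℂ) •
        (Polynomial.lsum fun l : ℕ => LinearMap.mulLeft ℂ
          (expCoeffInt (α : Euc n) (l - m - 1 - intInner (α : Euc n) (β : Euc n)))) ∘ₗ
        (expPairing (α : Euc n)).toLinearMap)

/-- The modes of the free boson field `Y(∂φ_{e_i})`: `∂^{1+k}φ_{e_i} / k!` acts by multiplication
as the mode `-k-1`, the mode `0` on `v e^{φ_λ}` is `(e_i, λ)`, and the positive modes are fixed by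
`[a_m, a_{-m}] = m`. -/
def bosonMode (Λ : AddSubgroup (Euc n)) (i : Fin n) : ℤ → LatticeSpace Λ → LatticeSpace Λ
  | Int.negSucc k, v => v.mapRange
      (fun u => ((k.factorial : ℂ)⁻¹) • (MvPolynomial.X (i, k) * u)) (by simp)
  | Int.ofNat 0, v => v.sum fun l u => Finsupp.single l (((l : Euc n) i : ℂ) • u)
  | Int.ofNat (k + 1), v => v.mapRange
      (fun u => ((k + 1).factorial : ℂ) • MvPolynomial.pderiv (i, k) u) (by simp)

/-- The modes of `Y((∏_s ∂^{1+k_s}φ_{e_{i_s}}) e^{φ_α}) = :∏_s ∂_z^{k_s} Y(∂φ_{e_{i_s}}) Y(e^{φ_α}):`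
for a list `s = (i_s, k_s)`; the order of the list is immaterial. -/
def latticeMonomialMode (α : Λ) (l : List (Fin n × ℕ)) : ℤ → LatticeSpace Λ → LatticeSpace Λ :=
  l.foldr (fun s B m v => (s.2.factorial : ℂ) • normalOrder (bosonMode Λ s.1) 1 s.2 B m v)
    (fun m v => expMode κ α m v)

/-- The product `a_(m) b` of the lattice (super) vertex algebra twisted by `κ`. -/
def latticeY (a : LatticeSpace Λ) (m : ℤ) (b : LatticeSpace Λ) : LatticeSpace Λ :=
  a.sum fun α u => ∑ d ∈ u.support,
    MvPolynomial.coeff d u • latticeMonomialMode κ α (Finsupp.toMultiset d).toList m b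

/-- Normalised `2`-cocycles on an integral lattice with the commutator that makes
`LatticeSpace Λ` a vertex superalgebra in which `e^{φ_α}` has the parity of `(α, α)`. On an even
sublattice this reads `κ(α, β) = (-1)^{(α, β)} κ(β, α)`. -/
structure IsLatticeCocycle : Prop where
  normalized : κ 0 0 = 1
  cocycle : ∀ α β γ : Λ, κ α β * κ (α + β) γ = κ β γ * κ α (β + γ)
  commutator : ∀ α β : Λ, κ α β =
    (-1) ^ (intInner (α : Euc n) β + intInner (α : Euc n) α * intInner (β : Euc n) β) * κ β α

/-- The screening charge operator `ζ_α = Res Y(e^{φ_α})`, the coefficient of `z⁻¹`. -/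
def screening (α : Λ) : LatticeSpace Λ →ₗ[ℂ] LatticeSpace Λ := expMode κ α 0

end Lattice

/-! ## The lattices attached to `B_n` at `ℓ = 2p = 4` -/

/-- The simple roots of `B_n`: `α_i = √2 (e_i - e_{i+1})` for `i < n` and `α_n = √2 e_n`, so that
short roots have norm `2` and long roots have norm `4`. -/
def simpleRoot (n : ℕ) (i : Fin n) : Euc n :=
  √2 • (EuclideanSpace.single i 1 -
    if h : (i : ℕ) + 1 < n then EuclideanSpace.single ⟨i + 1, h⟩ 1 else 0)

/-- The simple coroot `α_i^∨ = 2 α_i / (α_i, α_i)`. -/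
def simpleCoroot (n : ℕ) (i : Fin n) : Euc n :=
  (2 / ⟪simpleRoot n i, simpleRoot n i⟫_ℝ) • simpleRoot n i

/-- The long screening lattice `Λ^⊕ = √2 Λ_R^∨`. -/
def longLattice (n : ℕ) : AddSubgroup (Euc n) :=
  AddSubgroup.closure (Set.range fun i => √2 • simpleCoroot n i)

/-- The short screening lattice `Λ^⊖ = Λ_R / √2`, spanned by `α_i^⊖ = -α_i / √2`. -/
def shortLattice (n : ℕ) : AddSubgroup (Euc n) :=
  AddSubgroup.closure (Set.range fun i => -((√2)⁻¹ • simpleRoot n i))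

/-- The momentum `α_i^⊖ = -α_i / √2` of a simple root. -/
def simpleMomentum (n : ℕ) (i : Fin n) : shortLattice n :=
  ⟨-((√2)⁻¹ • simpleRoot n i), AddSubgroup.subset_closure ⟨i, rfl⟩⟩

/-- The momentum `α_{i…n}^⊖ = -(α_i + ⋯ + α_n) / √2` of a short positive root. -/
def shortMomentum (n : ℕ) (i : Fin n) : shortLattice n :=
  ∑ k ∈ Finset.Ici i, simpleMomentum n k

/-- The subspace `V_{Λ^⊕}` of `V_{Λ^⊖}`. -/
def longSpace (n : ℕ) : Submodule ℂ (LatticeSpace (shortLattice n)) :=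
  Finsupp.supported (DiffPoly n) ℂ {l : shortLattice n | (l : Euc n) ∈ longLattice n}

/-- The joint kernel `𝒲` on `V_{Λ^⊕}` of the short screenings with momenta `α_{i…n}^⊖`. -/
def screeningKernel (n : ℕ) (κ : shortLattice n → shortLattice n → ℂˣ) :
    Submodule ℂ (LatticeSpace (shortLattice n)) :=
  longSpace n ⊓ ⨅ i : Fin n, LinearMap.ker (screening κ (shortMomentum n i))

/-! ## Symplectic fermions -/

/-- Labels of the creation modes of `n` pairs of symplectic fermions: `(i, false, k)` stands for
`ψⁱ_{-k-1}` and `(i, true, k)` for `ψ*ⁱ_{-k-1}`. -/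
abbrev FermionIndex (n : ℕ) : Type := Fin n ×ₗ Bool ×ₗ ℕ

/-- The label `(i, s, k)`. -/
def fermionIndex {n : ℕ} (i : Fin n) (s : Bool) (k : ℕ) : FermionIndex n :=
  toLex (i, toLex (s, k))

/-- The Fock space of `n` pairs of symplectic fermions: the exterior algebra on the creation
modes. -/
abbrev FermionSpace (n : ℕ) : Type := ExteriorAlgebra ℂ (FermionIndex n →₀ ℂ)

/-- The modes `ψⁱ_m` (for `s = false`) and `ψ*ⁱ_m` (for `s = true`): negative modes multiply, zero
modes vanish, and positive modes contract, so that `[ψⁱ_m, ψ*ʲ_k]₊ = m δ_{ij} δ_{m+k,0}` and all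
other anticommutators vanish. -/
def fermionMode {n : ℕ} (i : Fin n) (s : Bool) : ℤ → FermionSpace n → FermionSpace n
  | Int.negSucc k, v => ExteriorAlgebra.ι ℂ (Finsupp.single (fermionIndex i s k) 1) * v
  | Int.ofNat 0, _ => 0
  | Int.ofNat (k + 1), v => CliffordAlgebra.contractLeft
      (((if s then -1 else 1) * (k + 1 : ℂ)) • Finsupp.lapply (fermionIndex i (!s) k)) v

/-- The modes of `Y(ψ^{s₁} ⋯ ψ^{s_r} 𝟙)`, a nested normally ordered product of divided derivatives
of the fields `ψⁱ(z)`, `ψ*ⁱ(z)`. -/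
def fermionMonomialMode {n : ℕ} : List (FermionIndex n) → ℤ → FermionSpace n → FermionSpace n
  | [], m, v => if m = -1 then v else 0
  | s :: l, m, v =>
      normalOrder (fermionMode (ofLex s).1 (ofLex (ofLex s).2).1) ((-1) ^ l.length)
        (ofLex (ofLex s).2).2 (fermionMonomialMode l) m v

/-- The product `a_(m) b` of the vertex superalgebra of `n` pairs of symplectic fermions, defined
on the basis of increasing monomials in the creation modes. -/
def fermionY {n : ℕ} (a : FermionSpace n) (m : ℤ) (b : FermionSpace n) : FermionSpace n :=
  ((Finsupp.basisSingleOne (R := ℂ) (ι := FermionIndex n)).ExteriorAlgebra.repr a).sum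
    fun S c => c • fermionMonomialMode (S.sort (· ≤ ·)) m b

/-- The even part: products of an even number of creation modes. -/
def fermionEven (n : ℕ) : Submodule ℂ (FermionSpace n) :=
  CliffordAlgebra.evenOdd (0 : QuadraticForm ℂ (FermionIndex n →₀ ℂ)) 0

end

/-! The theorem is the boson-fermion correspondence for ℤⁿ, cut down by zero modes. The short
momenta α_{i…n}^⊖ are the vectors -e_i, so Λ^⊖ = ℤⁿ. The fields b_i = Y(e^{φ_α}) with α = α_{i…n}^⊖,
and c_i, a normalisation of Y(e^{-φ_α}), are n pairs of charged fermions: the modes b^i_m and c^j_k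
anticommute to δ_{ij} δ_{m+k,-1}, and all other anticommutators vanish (`bField_bField`,
`cField_cField`, `bField_cField`). The screenings are the zero modes b^i_0, so their anticommutation
is a special case.

The fields ψ^i = b_i and ψ*^i = ∂c_i satisfy the relations of symplectic fermions. Applying creation
modes to the vacuum embeds the exterior algebra into the lattice space (`fermionEmb`). The embedding
is injective because its kernel is stable under all contractions and does not contain 1. Passing
from c_i to ∂c_i loses only the mode c^i_{-1}, the conjugate of b^i_0. The operator b^i_0 c^i_{-1}
projects onto the kernel of b^i_0; it kills every vector c^i_{-1} v and commutes with the other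
negative modes. These negative modes generate the whole space from the vacuum, so the joint kernel
of the screenings is exactly the image of the symplectic fermions (`mem_range_fermionEmb_iff`).
Finally Λ^⊕ consists of the vectors of even norm, so V_{Λ^⊕} is the even part of the superalgebra,
and it cuts out the even part of the symplectic fermions.

The vertex algebra structure rests on three general facts. Dong's lemma (`IsLocal.nop`) propagates
locality to normally ordered products. The uniqueness principle of Goddard
(`GeneratingFields.good_eq_zero`) says that a translation covariant field local to the generators is
determined by the state it creates. Exponential fields are local because their products are the two
expansions of one series containing the factor (z - w)^{(α,β)} (`diffOp_pow_superComm_expF`).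
Uniqueness reduces identities of fields to identities of states: it gives :b_i c_i: as a free boson
up to sign, hence generation by b and c, and it shows that the embedding preserves all products
(`fermionEmb_fermionY`). The structure on the even symplectic fermions is then pulled back from the
kernel. -/

noncomputable section

/-! ## Difference operators on formal distributions -/

section Difference

variable {G V : Type*} [AddCommGroup G] [AddCommGroup V] [Module ℂ V]

/-- Translation of the argument of a function by `g`. -/
def shiftOp (V : Type*) [AddCommGroup V] [Module ℂ V] (g : G) : Module.End ℂ (G → V) :=
  LinearMap.funLeft ℂ V (· + g)

@[simp] theorem shiftOp_apply (g : G) (f : G → V) (p : G) : shiftOp V g f p = f (p + g) := rfl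

theorem commute_shiftOp (g h : G) : Commute (shiftOp V g) (shiftOp V h) := by
  refine LinearMap.ext fun f => funext fun p => ?_
  simp [add_right_comm]

theorem shiftOp_pow_apply (g : G) (k : ℕ) (f : G → V) (p : G) :
    (shiftOp V g ^ k) f p = f (p + k • g) := by
  induction k generalizing p with
  | zero => simp
  | succ k ih => rw [pow_succ', Module.End.mul_apply, shiftOp_apply, ih, succ_nsmul', add_assoc]

/-- The difference of two translations; on `ℤ × ℤ` the operator `diffOp V (1, 0) (0, 1)` is
multiplication by `z - w`. -/
def diffOp (V : Type*) [AddCommGroup V] [Module ℂ V] (g h : G) : Module.End ℂ (G → V) :=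
  shiftOp V g - shiftOp V h

@[simp] theorem diffOp_apply (g h : G) (f : G → V) (p : G) :
    diffOp V g h f p = f (p + g) - f (p + h) := rfl

theorem commute_diffOp_shiftOp (g h x : G) : Commute (diffOp V g h) (shiftOp V x) :=
  (commute_shiftOp _ _).sub_left (commute_shiftOp _ _)

theorem commute_diffOp (g h g' h' : G) : Commute (diffOp V g h) (diffOp V g' h') :=
  (commute_diffOp_shiftOp _ _ _).sub_right (commute_diffOp_shiftOp _ _ _)

theorem diffOp_pow_apply (g h : G) (N : ℕ) (f : G → V) (p : G) :
    (diffOp V g h ^ N) f p = ∑ j ∈ Finset.range (N + 1), ((-1 : ℂ) ^ j * (N.choose j : ℂ)) •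
      f (p + ((N - j : ℕ) • g + j • h)) := by
  have hc : Commute ((-1 : ℂ) • shiftOp V h) (shiftOp V g) := (commute_shiftOp h g).smul_left _
  have hd : diffOp V g h = (-1 : ℂ) • shiftOp V h + shiftOp V g := by
    rw [diffOp]; module
  rw [hd, hc.add_pow, LinearMap.sum_apply, Finset.sum_apply]
  refine Finset.sum_congr rfl fun j _ => ?_
  rw [← nsmul_eq_mul', smul_pow, smul_mul_assoc, ← Nat.cast_smul_eq_nsmul ℂ, smul_smul,
    mul_comm, LinearMap.smul_apply, Pi.smul_apply, Module.End.mul_apply, shiftOp_pow_apply,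
    shiftOp_pow_apply]
  congr 2
  abel

theorem diffOp_pow_eq_zero_of_le {g h : G} {N M : ℕ} (hNM : N ≤ M) {f : G → V}
    (hf : (diffOp V g h ^ N) f = 0) : (diffOp V g h ^ M) f = 0 := by
  rw [← Nat.sub_add_cancel hNM, pow_add, Module.End.mul_apply, hf, map_zero]

/-- In the binomial expansion of degree `2 * N` every term contains `N` factors `x` or `N + 1`
factors `y`. In Dong's lemma `x` and `y` are multiplication by z - u and z - w, with difference w -
u. -/
theorem sub_pow_apply_eq_zero {x y : Module.End ℂ V} (hxy : Commute x y) {N : ℕ} {f : V}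
    (hx : (x ^ N) f = 0) (hy : (y ^ (N + 1)) f = 0) : ((x - y) ^ (2 * N)) f = 0 := by
  rw [sub_eq_add_neg, (hxy.neg_right).add_pow, LinearMap.sum_apply]
  refine Finset.sum_eq_zero fun j hj => ?_
  have hj' : j ≤ 2 * N := by simpa [Nat.lt_succ_iff] using hj
  rw [← nsmul_eq_mul', LinearMap.smul_apply]
  by_cases h : N ≤ j
  · rw [((hxy.neg_right).pow_pow j _).eq, Module.End.mul_apply, ← Nat.sub_add_cancel h, pow_add,
      Module.End.mul_apply, hx]
    simp
  · have h1 : N + 1 ≤ 2 * N - j := by omega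
    rw [Module.End.mul_apply, neg_pow, Module.End.mul_apply, ← Nat.sub_add_cancel h1, pow_add y,
      Module.End.mul_apply, hy]
    simp

/-- Functions vanishing far out in the direction `h - g`, on which `diffOp g h` is invertible. -/
def truncated (V : Type*) [AddCommGroup V] [Module ℂ V] (g h : G) : Submodule ℂ (G → V) where
  carrier := {f | ∀ p, ∃ J : ℕ, ∀ j : ℕ, J ≤ j → f (p - j • g + j • h) = 0}
  zero_mem' := fun _ => ⟨0, fun _ _ => rfl⟩
  add_mem' := by
    intro a b ha hb p
    obtain ⟨J, hJ⟩ := ha p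
    obtain ⟨K, hK⟩ := hb p
    refine ⟨max J K, fun j hj => ?_⟩
    rw [Pi.add_apply, hJ j (le_trans (le_max_left _ _) hj), hK j (le_trans (le_max_right _ _) hj),
      add_zero]
  smul_mem' := by
    intro c a ha p
    obtain ⟨J, hJ⟩ := ha p
    exact ⟨J, fun j hj => by rw [Pi.smul_apply, hJ j hj, smul_zero]⟩

theorem shiftOp_mem_truncated {g h : G} {f : G → V} (hf : f ∈ truncated V g h) (x : G) :
    shiftOp V x f ∈ truncated V g h := by
  intro p
  obtain ⟨J, hJ⟩ := hf (p + x)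
  refine ⟨J, fun j hj => ?_⟩
  rw [shiftOp_apply, ← hJ j hj]
  congr 1
  abel

theorem diffOp_pow_mem_truncated {g h : G} {f : G → V} (hf : f ∈ truncated V g h) (x y : G)
    (N : ℕ) : (diffOp V x y ^ N) f ∈ truncated V g h := by
  induction N with
  | zero => simpa
  | succ N ih =>
    rw [pow_succ', Module.End.mul_apply]
    exact Submodule.sub_mem _ (shiftOp_mem_truncated ih x) (shiftOp_mem_truncated ih y)

/-- An element of the kernel is constant along the points `p - j • g + j • h`, and truncation makes
it vanish far out. -/
theorem eq_zero_of_diffOp_eq_zero {g h : G} {f : G → V} (hf : f ∈ truncated V g h)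
    (h0 : diffOp V g h f = 0) : f = 0 := by
  funext p
  have key : ∀ j : ℕ, f (p - j • g + j • h) = f p := by
    intro j
    induction j with
    | zero => simp
    | succ j ih =>
      rw [← ih]
      have := congrFun h0 (p - (j + 1) • g + j • h)
      rw [diffOp_apply, Pi.zero_apply, sub_eq_zero] at this
      convert this.symm using 2
      · rw [succ_nsmul h]; abel
      · rw [succ_nsmul g]; abel
  obtain ⟨J, hJ⟩ := hf p
  rw [← key J, hJ J le_rfl, Pi.zero_apply]

/-- The inverse of `diffOp g h` on truncated functions: multiplication by the expansion of
`(z - w)⁻¹`. -/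
def diffInv (g h : G) (f : G → V) (p : G) : V := ∑ᶠ j : ℕ, f (p - (j + 1) • g + j • h)

theorem exists_diffInv_eq_sum {g h : G} {f : G → V} (hf : f ∈ truncated V g h) (p : G) :
    ∃ J : ℕ, ∀ L, J ≤ L →
      diffInv g h f p = ∑ j ∈ Finset.range L, f (p - (j + 1) • g + j • h) := by
  obtain ⟨J, hJ⟩ := hf (p - g)
  refine ⟨J, fun L hL => finsum_eq_sum_of_support_subset _ fun j hj => ?_⟩
  rw [Finset.coe_range, Set.mem_Iio]
  by_contra hlt
  refine hj ?_
  rw [← hJ j (by omega)]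
  simp only [succ_nsmul g]
  congr 1
  abel

theorem diffOp_diffInv {g h : G} {f : G → V} (hf : f ∈ truncated V g h) :
    diffOp V g h (diffInv g h f) = f := by
  funext p
  obtain ⟨J, hJ⟩ := exists_diffInv_eq_sum hf (p + g)
  obtain ⟨K, hK⟩ := exists_diffInv_eq_sum hf (p + h)
  -- The sum at `p + g` is taken one term longer than the sum at `p + h`. They cancel term by term
  -- and leave the summand `j = 0` of the first, which is `f p`.
  rw [diffOp_apply, hJ (max J K + 1) (by omega), hK (max J K) (by omega),
    Finset.sum_range_succ', add_comm, add_sub_assoc, ← Finset.sum_sub_distrib]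
  rw [Finset.sum_eq_zero, add_zero]
  · congr 1
    simp
  · intro j _
    rw [sub_eq_zero]
    congr 1
    simp only [succ_nsmul]
    abel

theorem diffInv_mem_truncated {g h : G} {f : G → V} (hf : f ∈ truncated V g h) :
    diffInv g h f ∈ truncated V g h := by
  intro p
  obtain ⟨J, hJ⟩ := hf (p - g)
  refine ⟨J, fun i hi => ?_⟩
  refine finsum_eq_zero_of_forall_eq_zero fun j => ?_
  rw [← hJ (i + j) (by omega)]
  congr 1
  simp only [succ_nsmul, add_nsmul]
  abel

end Difference

/-! ## Fields, locality and normally ordered products -/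

section Field

variable {V : Type*} [AddCommGroup V] [Module ℂ V]

/-- Fields on `V`, as sequences of modes. -/
def fieldModule (V : Type*) [AddCommGroup V] [Module ℂ V] : Submodule ℂ (ℤ → Module.End ℂ V) where
  carrier := {A | ∀ v, ∃ N : ℤ, ∀ m, N ≤ m → A m v = 0}
  zero_mem' := fun _ => ⟨0, fun _ _ => rfl⟩
  add_mem' := by
    intro a b ha hb v
    obtain ⟨J, hJ⟩ := ha v
    obtain ⟨K, hK⟩ := hb v
    refine ⟨max J K, fun j hj => ?_⟩
    rw [Pi.add_apply, LinearMap.add_apply, hJ j (le_trans (le_max_left _ _) hj),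
      hK j (le_trans (le_max_right _ _) hj), add_zero]
  smul_mem' := by
    intro c a ha v
    obtain ⟨J, hJ⟩ := ha v
    exact ⟨J, fun j hj => by rw [Pi.smul_apply, LinearMap.smul_apply, hJ j hj, smul_zero]⟩

/-- The type of fields on `V`. -/
abbrev FieldOn (V : Type*) [AddCommGroup V] [Module ℂ V] : Type _ := fieldModule V

theorem FieldOn.ext_apply {A B : FieldOn V} (h : ∀ m v, A.1 m v = B.1 m v) : A = B :=
  Subtype.ext (funext fun m => LinearMap.ext fun v => h m v)

/-- The supercommutator of the modes of two fields, with exchange sign `ε`. -/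
def superComm (ε : ℂ) (A B : FieldOn V) (v : V) (p : ℤ × ℤ) : V :=
  A.1 p.1 (B.1 p.2 v) - ε • B.1 p.2 (A.1 p.1 v)

/-- Mutual locality with exchange sign `ε`. -/
def IsLocal (ε : ℂ) (A B : FieldOn V) : Prop :=
  ∃ N : ℕ, ∀ v, (diffOp V ((1, 0) : ℤ × ℤ) (0, 1) ^ N) (superComm ε A B v) = 0

theorem diffOp_pow_apply_pair (N : ℕ) (f : ℤ × ℤ → V) (m k : ℤ) :
    (diffOp V ((1, 0) : ℤ × ℤ) (0, 1) ^ N) f (m, k) =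
      ∑ j ∈ Finset.range (N + 1), ((-1 : ℂ) ^ j * (N.choose j : ℂ)) • f (m + N - j, k + j) := by
  rw [diffOp_pow_apply]
  refine Finset.sum_congr rfl fun j hj => ?_
  have hj' : j ≤ N := by simpa [Nat.lt_succ_iff] using hj
  congr 2
  ext
  · simp [Nat.cast_sub hj', add_sub_assoc]
  · simp

theorem diffOp_swap (g h : ℤ × ℤ) (f : ℤ × ℤ → V) (N : ℕ) (p : ℤ × ℤ) :
    (diffOp V g h ^ N) (f ∘ Prod.swap) p = (diffOp V g.swap h.swap ^ N) f p.swap := by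
  simp [diffOp_pow_apply, -nsmul_eq_mul]

theorem diffOp_neg_pow (g h : ℤ × ℤ) (N : ℕ) :
    diffOp V h g ^ N = (-1 : ℂ) ^ N • diffOp V g h ^ N := by
  rw [← smul_pow]
  congr 1
  rw [diffOp, diffOp]
  module

theorem IsLocal.symm {ε : ℂ} (hε : ε * ε = 1) {A B : FieldOn V} (h : IsLocal ε A B) :
    IsLocal ε B A := by
  obtain ⟨N, hN⟩ := h
  refine ⟨N, fun v => ?_⟩
  have h1 : superComm ε B A v = (-ε) • (superComm ε A B v ∘ Prod.swap) := by
    funext p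
    simp only [superComm, Pi.smul_apply, Function.comp, Prod.fst_swap, Prod.snd_swap, smul_sub,
      smul_smul]
    rw [neg_mul, hε]
    module
  have h2 : (diffOp V ((1, 0) : ℤ × ℤ) (0, 1) ^ N) (superComm ε A B v ∘ Prod.swap) = 0 := by
    funext p
    rw [diffOp_swap, Prod.swap_prod_mk, Prod.swap_prod_mk, diffOp_neg_pow (1, 0) (0, 1),
      LinearMap.smul_apply, hN v]
    simp
  rw [h1, map_smul, h2, smul_zero]

/-- The fields that are local with respect to `B`. -/
def localTo (ε : ℂ) (B : FieldOn V) : Submodule ℂ (FieldOn V) where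
  carrier := {A | IsLocal ε A B}
  zero_mem' := ⟨0, fun v => by
    funext p
    simp [superComm]⟩
  add_mem' := by
    rintro a b ⟨N, hN⟩ ⟨M, hM⟩
    refine ⟨max N M, fun v => ?_⟩
    have h1 : superComm ε (a + b) B v = superComm ε a B v + superComm ε b B v := by
      funext p
      simp only [superComm, Submodule.coe_add, Pi.add_apply, LinearMap.add_apply, map_add, smul_add]
      abel
    rw [h1, map_add, diffOp_pow_eq_zero_of_le (le_max_left _ _) (hN v),
      diffOp_pow_eq_zero_of_le (le_max_right _ _) (hM v), add_zero]
  smul_mem' := by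
    rintro c a ⟨N, hN⟩
    refine ⟨N, fun v => ?_⟩
    have h1 : superComm ε (c • a) B v = c • superComm ε a B v := by
      funext p
      simp only [superComm, Submodule.coe_smul, Pi.smul_apply, LinearMap.smul_apply, map_smul,
        smul_sub]
      rw [smul_comm c ε]
    rw [h1, map_smul, hN v, smul_zero]

theorem mem_localTo {ε : ℂ} {A B : FieldOn V} : A ∈ localTo ε B ↔ IsLocal ε A B := Iff.rfl

/-! ### Normally ordered products -/

theorem exists_nat_forall_ge (A : FieldOn V) (v : V) (k : ℤ) :
    ∃ J : ℕ, ∀ j : ℕ, J ≤ j → A.1 (k + j) v = 0 := by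
  obtain ⟨N, hN⟩ := A.2 v
  exact ⟨(N - k).toNat, fun j hj => hN _ (by omega)⟩

theorem exists_nopTerm_eq_zero (ε : ℂ) (A B : FieldOn V) (m : ℤ) (v : V) :
    ∃ J : ℕ, ∀ j : ℕ, J ≤ j →
      A.1 (-1 - j) (B.1 (m + j) v) + ε • B.1 (m - 1 - j) (A.1 j v) = 0 := by
  obtain ⟨J, hJ⟩ := exists_nat_forall_ge B v m
  obtain ⟨K, hK⟩ := exists_nat_forall_ge A v 0
  refine ⟨max J K, fun j hj => ?_⟩
  have h1 := hK j (le_trans (le_max_right _ _) hj)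
  rw [zero_add] at h1
  rw [hJ j (le_trans (le_max_left _ _) hj), h1]
  simp

/-- The modes of `:A(z) B(z):` applied to a vector. -/
def nopFun (ε : ℂ) (A B : FieldOn V) (m : ℤ) (v : V) : V :=
  ∑ᶠ j : ℕ, (A.1 (-1 - j) (B.1 (m + j) v) + ε • B.1 (m - 1 - j) (A.1 j v))

theorem exists_nopFun_eq_sum (ε : ℂ) (A B : FieldOn V) (m : ℤ) (v : V) :
    ∃ J : ℕ, ∀ L, J ≤ L → nopFun ε A B m v = ∑ j ∈ Finset.range L,
      (A.1 (-1 - j) (B.1 (m + j) v) + ε • B.1 (m - 1 - j) (A.1 j v)) := by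
  obtain ⟨J, hJ⟩ := exists_nopTerm_eq_zero ε A B m v
  refine ⟨J, fun L hL => finsum_eq_sum_of_support_subset _ fun j hj => ?_⟩
  rw [Finset.coe_range, Set.mem_Iio]
  by_contra hlt
  exact hj (hJ j (by omega))

/-- The normally ordered product `:A(z) B(z):`. -/
def nop (ε : ℂ) (A B : FieldOn V) : FieldOn V :=
  ⟨fun m =>
    { toFun := nopFun ε A B m
      map_add' := by
        intro v w
        obtain ⟨J, hJ⟩ := exists_nopFun_eq_sum ε A B m v
        obtain ⟨K, hK⟩ := exists_nopFun_eq_sum ε A B m w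
        obtain ⟨L, hL⟩ := exists_nopFun_eq_sum ε A B m (v + w)
        rw [hJ (J + K + L) (by omega), hK (J + K + L) (by omega), hL (J + K + L) (by omega),
          ← Finset.sum_add_distrib]
        refine Finset.sum_congr rfl fun j _ => ?_
        simp only [map_add, smul_add]
        abel
      map_smul' := by
        intro c v
        obtain ⟨J, hJ⟩ := exists_nopFun_eq_sum ε A B m v
        obtain ⟨L, hL⟩ := exists_nopFun_eq_sum ε A B m (c • v)
        rw [hJ (J + L) (by omega), hL (J + L) (by omega), Finset.smul_sum]
        refine Finset.sum_congr rfl fun j _ => ?_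
        simp only [map_smul, smul_add, RingHom.id_apply]
        rw [smul_comm ε c] }, by
    intro v
    obtain ⟨N, hN⟩ := B.2 v
    obtain ⟨K, hK⟩ := exists_nat_forall_ge A v 0
    -- Only the vectors `A.1 j v` with `j < K` can be non-zero, so a single bound serves the second
    -- halves of all terms.
    have hM : ∃ M : ℤ, ∀ j < K, ∀ m, M ≤ m → B.1 (m - 1 - j) (A.1 j v) = 0 := by
      clear hK
      induction K with
      | zero => exact ⟨0, fun j hj => absurd hj (by omega)⟩
      | succ K ih =>
        obtain ⟨M, hM⟩ := ih
        obtain ⟨M', hM'⟩ := B.2 (A.1 K v)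
        refine ⟨max M (M' + 1 + K), fun j hj m hm => ?_⟩
        rcases Nat.lt_succ_iff_lt_or_eq.1 hj with h | rfl
        · exact hM j h m (by omega)
        · exact hM' _ (by omega)
    obtain ⟨M, hM⟩ := hM
    refine ⟨max N M, fun m hm => finsum_eq_zero_of_forall_eq_zero fun j => ?_⟩
    rw [hN _ (by omega), map_zero, zero_add]
    by_cases hj : j < K
    · rw [hM j hj m (by omega), smul_zero]
    · have := hK j (by omega)
      rw [zero_add] at this
      rw [this, map_zero, smul_zero]⟩

theorem nop_apply (ε : ℂ) (A B : FieldOn V) (m : ℤ) (v : V) : (nop ε A B).1 m v =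
    ∑ᶠ j : ℕ, (A.1 (-1 - j) (B.1 (m + j) v) + ε • B.1 (m - 1 - j) (A.1 j v)) := rfl

theorem exists_nop_eq_sum (ε : ℂ) (A B : FieldOn V) (m : ℤ) (v : V) :
    ∃ J : ℕ, ∀ L, J ≤ L → (nop ε A B).1 m v = ∑ j ∈ Finset.range L,
      (A.1 (-1 - j) (B.1 (m + j) v) + ε • B.1 (m - 1 - j) (A.1 j v)) :=
  exists_nopFun_eq_sum ε A B m v

/-! ### Dong's lemma -/

/-- Products of modes of three fields; the arguments of `F` are the mode indices of the first, the
second and the third field. -/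
theorem mem_truncated_left {F : ℤ × ℤ × ℤ → V}
    (hF : ∀ k l, ∃ J : ℤ, ∀ m j, J ≤ k + j → F (m, k + j, l) = 0) :
    F ∈ truncated V ((1, 0, 0) : ℤ × ℤ × ℤ) (0, 1, 0) := by
  rintro ⟨m, k, l⟩
  obtain ⟨J, hJ⟩ := hF k l
  refine ⟨(J - k).toNat, fun j hj => ?_⟩
  have := hJ (m - j) j (by omega)
  rw [← this]
  congr 1
  simp

theorem mem_truncated_right {F : ℤ × ℤ × ℤ → V}
    (hF : ∀ m l, ∃ J : ℤ, ∀ k j, J ≤ m + j → F (m + j, k, l) = 0) :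
    F ∈ truncated V ((0, 1, 0) : ℤ × ℤ × ℤ) (1, 0, 0) := by
  rintro ⟨m, k, l⟩
  obtain ⟨J, hJ⟩ := hF m l
  refine ⟨(J - m).toNat, fun j hj => ?_⟩
  have := hJ (k - j) j (by omega)
  rw [← this]
  congr 1
  simp

/-- Transfers locality of two out of three fields to functions of three mode indices. The third
index is frozen; its mode acts either last, through `L`, or first, inside the vector to which the
pair is applied. -/
theorem diffOp_pow_eq_zero_of_pair {a b : ℤ × ℤ × ℤ} {N : ℕ} {F : ℤ × ℤ × ℤ → V}
    (h : ∀ p, ∃ (L : V →ₗ[ℂ] V) (f : ℤ × ℤ → V) (q : ℤ × ℤ),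
      (diffOp V ((1, 0) : ℤ × ℤ) (0, 1) ^ N) f = 0 ∧
      ∀ i j : ℕ, F (p + (i • a + j • b)) = L (f (q + (i • (1, 0) + j • (0, 1))))) :
    (diffOp V a b ^ N) F = 0 := by
  funext p
  obtain ⟨L, f, q, h0, hF⟩ := h p
  have := congrArg L (congrFun h0 q)
  rw [diffOp_pow_apply, map_sum] at this
  rw [diffOp_pow_apply]
  simpa only [hF, ← map_smul, Pi.zero_apply, map_zero] using this

-- Dong's lemma. The field :A(w)B(w): is the residue in z of A(z)B(w)/(z - w) + ε₁ B(w)A(z)/(w - z),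
-- expanded for |z| > |w| and |w| > |z| respectively. With C(u) placed to the right or to the left
-- this gives series `Q₁` and `Q₂` in z, w, u. Each is killed by (z - w)^(N+1), and `Q₁ - (ε₂ * ε₃)
-- • Q₂` is killed by (z - u)^N (w - u)^N. Since w - u = (z - u) - (z - w), that combination is
-- killed by (w - u)^(3N), and taking the residue in z commutes with multiplication by w - u.
set_option maxHeartbeats 1000000 in
theorem IsLocal.nop {ε₁ ε₂ ε₃ : ℂ} {A B C : FieldOn V} (hAB : IsLocal ε₁ A B)
    (hAC : IsLocal ε₂ A C) (hBC : IsLocal ε₃ B C) : IsLocal (ε₂ * ε₃) (nop ε₁ A B) C := by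
  obtain ⟨N₁, h₁⟩ := hAB
  obtain ⟨N₂, h₂⟩ := hAC
  obtain ⟨N₃, h₃⟩ := hBC
  set N := max N₁ (max N₂ N₃) with hN
  have hAB : ∀ v, (diffOp V ((1, 0) : ℤ × ℤ) (0, 1) ^ N) (superComm ε₁ A B v) = 0 := fun v =>
    diffOp_pow_eq_zero_of_le (by omega) (h₁ v)
  have hAC : ∀ v, (diffOp V ((1, 0) : ℤ × ℤ) (0, 1) ^ N) (superComm ε₂ A C v) = 0 := fun v =>
    diffOp_pow_eq_zero_of_le (by omega) (h₂ v)
  have hBC : ∀ v, (diffOp V ((1, 0) : ℤ × ℤ) (0, 1) ^ N) (superComm ε₃ B C v) = 0 := fun v =>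
    diffOp_pow_eq_zero_of_le (by omega) (h₃ v)
  clear h₁ h₂ h₃
  refine ⟨2 * N + N, fun v => ?_⟩
  let ABC : ℤ × ℤ × ℤ → V := fun p => A.1 p.1 (B.1 p.2.1 (C.1 p.2.2 v))
  let BAC : ℤ × ℤ × ℤ → V := fun p => B.1 p.2.1 (A.1 p.1 (C.1 p.2.2 v))
  let CAB : ℤ × ℤ × ℤ → V := fun p => C.1 p.2.2 (A.1 p.1 (B.1 p.2.1 v))
  let CBA : ℤ × ℤ × ℤ → V := fun p => C.1 p.2.2 (B.1 p.2.1 (A.1 p.1 v))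
  let ACB : ℤ × ℤ × ℤ → V := fun p => A.1 p.1 (C.1 p.2.2 (B.1 p.2.1 v))
  let BCA : ℤ × ℤ × ℤ → V := fun p => B.1 p.2.1 (C.1 p.2.2 (A.1 p.1 v))
  let z : ℤ × ℤ × ℤ := (1, 0, 0)
  let w : ℤ × ℤ × ℤ := (0, 1, 0)
  let u : ℤ × ℤ × ℤ := (0, 0, 1)
  have tABC : ABC ∈ truncated V z w := mem_truncated_left fun k l => by
    obtain ⟨J, hJ⟩ := B.2 (C.1 l v)
    exact ⟨J, fun m j hj => by simp only [ABC, hJ _ hj, map_zero]⟩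
  have tCAB : CAB ∈ truncated V z w := mem_truncated_left fun k l => by
    obtain ⟨J, hJ⟩ := B.2 v
    exact ⟨J, fun m j hj => by simp only [CAB, hJ _ hj, map_zero]⟩
  have tBAC : BAC ∈ truncated V w z := mem_truncated_right fun k l => by
    obtain ⟨J, hJ⟩ := A.2 (C.1 l v)
    exact ⟨J, fun m j hj => by simp only [BAC, hJ _ hj, map_zero]⟩
  have tCBA : CBA ∈ truncated V w z := mem_truncated_right fun k l => by
    obtain ⟨J, hJ⟩ := A.2 v
    exact ⟨J, fun m j hj => by simp only [CBA, hJ _ hj, map_zero]⟩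
  have c₁ : (diffOp V z w ^ N) (ABC - ε₁ • BAC) = 0 := diffOp_pow_eq_zero_of_pair fun p =>
    ⟨LinearMap.id, _, (p.1, p.2.1), hAB (C.1 p.2.2 v), fun i j => by
      simp [ABC, BAC, superComm, z, w]⟩
  have c₂ : (diffOp V z w ^ N) (CAB - ε₁ • CBA) = 0 := diffOp_pow_eq_zero_of_pair fun p =>
    ⟨C.1 p.2.2, _, (p.1, p.2.1), hAB v, fun i j => by
      simp [CAB, CBA, superComm, z, w]⟩
  have c₃ : (diffOp V z u ^ N) (ACB - ε₂ • CAB) = 0 := diffOp_pow_eq_zero_of_pair fun p =>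
    ⟨LinearMap.id, _, (p.1, p.2.2), hAC (B.1 p.2.1 v), fun i j => by
      simp [ACB, CAB, superComm, z, u]⟩
  have c₄ : (diffOp V z u ^ N) (BAC - ε₂ • BCA) = 0 := diffOp_pow_eq_zero_of_pair fun p =>
    ⟨B.1 p.2.1, _, (p.1, p.2.2), hAC v, fun i j => by
      simp [BAC, BCA, superComm, z, u]⟩
  have c₅ : (diffOp V w u ^ N) (ABC - ε₃ • ACB) = 0 := diffOp_pow_eq_zero_of_pair fun p =>
    ⟨A.1 p.1, _, (p.2.1, p.2.2), hBC v, fun i j => by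
      simp [ABC, ACB, superComm, w, u]⟩
  have c₆ : (diffOp V w u ^ N) (BCA - ε₃ • CBA) = 0 := diffOp_pow_eq_zero_of_pair fun p =>
    ⟨LinearMap.id, _, (p.2.1, p.2.2), hBC (A.1 p.1 v), fun i j => by
      simp [BCA, CBA, superComm, w, u]⟩
  have c₇ : (diffOp V z u ^ N * diffOp V w u ^ N) (ABC - (ε₂ * ε₃) • CAB) = 0 := by
    have : ABC - (ε₂ * ε₃) • CAB = (ABC - ε₃ • ACB) + ε₃ • (ACB - ε₂ • CAB) := by module
    rw [this, map_add, map_smul, Module.End.mul_apply, c₅, map_zero,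
      ((commute_diffOp _ _ _ _).pow_pow N N).eq, Module.End.mul_apply, c₃]
    simp
  have c₈ : (diffOp V z u ^ N * diffOp V w u ^ N) (BAC - (ε₂ * ε₃) • CBA) = 0 := by
    have : BAC - (ε₂ * ε₃) • CBA = (BAC - ε₂ • BCA) + ε₂ • (BCA - ε₃ • CBA) := by module
    rw [this, map_add, map_smul, ((commute_diffOp _ _ _ _).pow_pow N N).eq, Module.End.mul_apply,
      c₄, map_zero, ((commute_diffOp _ _ _ _).pow_pow N N).eq, Module.End.mul_apply, c₆]
    simp
  have inv₁ : ∀ F ∈ truncated V w z, diffOp V z w (diffInv w z F) = -F := by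
    intro F hF
    have h1 : diffOp V z w = -diffOp V w z := by rw [diffOp, diffOp]; abel
    rw [h1, LinearMap.neg_apply, diffOp_diffInv hF]
  -- the four summands of the supercommutator, as expansions of quotients by `z - w`
  let Q₁ : ℤ × ℤ × ℤ → V := diffInv z w ABC + ε₁ • diffInv w z BAC
  let Q₂ : ℤ × ℤ × ℤ → V := diffInv z w CAB + ε₁ • diffInv w z CBA
  have q₁ : (diffOp V z w ^ (N + 1)) Q₁ = 0 := by
    rw [pow_succ, Module.End.mul_apply, map_add, map_smul, diffOp_diffInv tABC, inv₁ _ tBAC,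
      smul_neg, ← sub_eq_add_neg, c₁]
  have q₂ : (diffOp V z w ^ (N + 1)) Q₂ = 0 := by
    rw [pow_succ, Module.End.mul_apply, map_add, map_smul, diffOp_diffInv tCAB, inv₁ _ tCBA,
      smul_neg, ← sub_eq_add_neg, c₂]
  have q₃ : (diffOp V z u ^ N * diffOp V w u ^ N)
      (diffInv z w ABC - (ε₂ * ε₃) • diffInv z w CAB) = 0 := by
    have ht : diffInv z w ABC - (ε₂ * ε₃) • diffInv z w CAB ∈ truncated V z w :=
      Submodule.sub_mem _ (diffInv_mem_truncated tABC)
        (Submodule.smul_mem _ _ (diffInv_mem_truncated tCAB))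
    -- Multiplication by z - w is injective on truncated functions, commutes with the other factors
    -- and undoes `diffInv`. This reduces the claim to `c₇`.
    refine eq_zero_of_diffOp_eq_zero (g := z) (h := w) ?_ ?_
    · rw [Module.End.mul_apply]
      exact diffOp_pow_mem_truncated (diffOp_pow_mem_truncated ht _ _ _) _ _ _
    · have hc : Commute (diffOp V z w) (diffOp V z u ^ N * diffOp V w u ^ N) :=
        ((commute_diffOp _ _ _ _).pow_right N).mul_right ((commute_diffOp _ _ _ _).pow_right N)
      rw [← Module.End.mul_apply, hc.eq, Module.End.mul_apply, map_sub, map_smul,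
        diffOp_diffInv tABC, diffOp_diffInv tCAB, c₇]
  have q₄ : (diffOp V z u ^ N * diffOp V w u ^ N)
      (diffInv w z BAC - (ε₂ * ε₃) • diffInv w z CBA) = 0 := by
    have ht : diffInv w z BAC - (ε₂ * ε₃) • diffInv w z CBA ∈ truncated V w z :=
      Submodule.sub_mem _ (diffInv_mem_truncated tBAC)
        (Submodule.smul_mem _ _ (diffInv_mem_truncated tCBA))
    refine eq_zero_of_diffOp_eq_zero (g := w) (h := z) ?_ ?_
    · rw [Module.End.mul_apply]
      exact diffOp_pow_mem_truncated (diffOp_pow_mem_truncated ht _ _ _) _ _ _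
    · have hc : Commute (diffOp V w z) (diffOp V z u ^ N * diffOp V w u ^ N) :=
        ((commute_diffOp _ _ _ _).pow_right N).mul_right ((commute_diffOp _ _ _ _).pow_right N)
      rw [← Module.End.mul_apply, hc.eq, Module.End.mul_apply, map_sub, map_smul,
        diffOp_diffInv tBAC, diffOp_diffInv tCBA, c₈]
  have key : (diffOp V w u ^ (2 * N + N)) (Q₁ - (ε₂ * ε₃) • Q₂) = 0 := by
    have hwu : diffOp V w u = diffOp V z u - diffOp V z w := by
      rw [diffOp, diffOp, diffOp]; abel
    rw [pow_add, Module.End.mul_apply]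
    nth_rewrite 1 [hwu]
    refine sub_pow_apply_eq_zero (commute_diffOp _ _ _ _) ?_ ?_
    · rw [← Module.End.mul_apply]
      have : Q₁ - (ε₂ * ε₃) • Q₂ = (diffInv z w ABC - (ε₂ * ε₃) • diffInv z w CAB) +
          ε₁ • (diffInv w z BAC - (ε₂ * ε₃) • diffInv w z CBA) := by
        simp only [Q₁, Q₂]; module
      rw [this, map_add, map_smul, q₃, q₄, smul_zero, add_zero]
    · rw [← Module.End.mul_apply, ((commute_diffOp _ _ _ _).pow_pow _ _).eq, Module.End.mul_apply,
        map_sub, map_smul, q₁, q₂]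
      simp
  -- The first mode index 0 is the coefficient of z⁻¹, that is, the residue in z.
  have hQ : ∀ k l, superComm (ε₂ * ε₃) (_root_.nop ε₁ A B) C v (k, l) =
      (Q₁ - (ε₂ * ε₃) • Q₂) (0, k, l) := by
    intro k l
    obtain ⟨J₁, hJ₁⟩ := exists_nop_eq_sum ε₁ A B k (C.1 l v)
    obtain ⟨J₂, hJ₂⟩ := exists_nop_eq_sum ε₁ A B k v
    obtain ⟨J₃, hJ₃⟩ := exists_diffInv_eq_sum tABC (0, k, l)
    obtain ⟨J₄, hJ₄⟩ := exists_diffInv_eq_sum tBAC (0, k, l)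
    obtain ⟨J₅, hJ₅⟩ := exists_diffInv_eq_sum tCAB (0, k, l)
    obtain ⟨J₆, hJ₆⟩ := exists_diffInv_eq_sum tCBA (0, k, l)
    have e₁ : ∀ j : ℕ, ((0, k, l) : ℤ × ℤ × ℤ) - (j + 1) • z + j • w =
        ((-1 - (j : ℤ), k + (j : ℤ), l) : ℤ × ℤ × ℤ) := by
      intro j
      ext <;> simp [z, w]
      ring
    have e₂ : ∀ j : ℕ, ((0, k, l) : ℤ × ℤ × ℤ) - (j + 1) • w + j • z =
        (((j : ℤ), k - 1 - (j : ℤ), l) : ℤ × ℤ × ℤ) := by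
      intro j
      ext <;> simp [z, w]
      ring
    set L := J₁ + J₂ + J₃ + J₄ + J₅ + J₆ with hL
    have r₁ : (_root_.nop ε₁ A B).1 k (C.1 l v) = Q₁ (0, k, l) := by
      simp only [Q₁, Pi.add_apply, Pi.smul_apply]
      rw [hJ₁ L (by omega), hJ₃ L (by omega), hJ₄ L (by omega), Finset.smul_sum,
        ← Finset.sum_add_distrib]
      exact Finset.sum_congr rfl fun j _ => by rw [e₁, e₂]
    have r₂ : C.1 l ((_root_.nop ε₁ A B).1 k v) = Q₂ (0, k, l) := by
      simp only [Q₂, Pi.add_apply, Pi.smul_apply]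
      rw [hJ₂ L (by omega), hJ₅ L (by omega), hJ₆ L (by omega), Finset.smul_sum,
        ← Finset.sum_add_distrib, map_sum]
      exact Finset.sum_congr rfl fun j _ => by rw [e₁, e₂, map_add, map_smul]
    rw [superComm, r₁, r₂, Pi.sub_apply, Pi.smul_apply]
  funext p
  obtain ⟨k, l⟩ := p
  rw [diffOp_pow_apply_pair]
  have := congrFun key (0, k, l)
  rw [diffOp_pow_apply] at this
  refine Eq.trans ?_ this
  refine Finset.sum_congr rfl fun j hj => ?_
  have hj' : j ≤ 2 * N + N := by simpa [Nat.lt_succ_iff] using hj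
  have hp : ((0, k, l) : ℤ × ℤ × ℤ) + ((2 * N + N - j) • w + j • u) =
      ((0, k + (2 * N + N : ℕ) - (j : ℤ), l + (j : ℤ)) : ℤ × ℤ × ℤ) := by
    ext
    · simp [w, u]
    · simp [w, u, Nat.cast_sub hj', add_sub_assoc]
    · simp [w, u]
  rw [hQ, hp]

end Field

/-! ### Derivatives of fields and their normally ordered products -/

section Derivative

variable {V : Type*} [AddCommGroup V] [Module ℂ V]

/-- The derivative of a field. -/
def derF (A : FieldOn V) : FieldOn V :=
  ⟨fun m => (-(m : ℂ)) • A.1 (m - 1), fun v => by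
    obtain ⟨N, hN⟩ := A.2 v
    exact ⟨N + 1, fun m hm => by rw [LinearMap.smul_apply, hN _ (by omega), smul_zero]⟩⟩

theorem derF_apply (A : FieldOn V) (m : ℤ) (v : V) :
    (derF A).1 m v = (-(m : ℂ)) • A.1 (m - 1) v := rfl

/-- The divided derivative `∂ᵏ A / k!`. -/
def divDer : ℕ → FieldOn V → FieldOn V
  | 0, A => A
  | k + 1, A => ((k + 1 : ℂ)⁻¹) • derF (divDer k A)

theorem divDer_succ_apply (k : ℕ) (A : FieldOn V) (m : ℤ) (v : V) :
    (divDer (k + 1) A).1 m v = ((k + 1 : ℂ)⁻¹ * -(m : ℂ)) • (divDer k A).1 (m - 1) v := by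
  rw [mul_smul]
  rfl

theorem divDer_apply_neg (k j : ℕ) (A : FieldOn V) (v : V) :
    (divDer k A).1 (-1 - j) v = ((k + j).choose j : ℂ) • A.1 (-k - 1 - j) v := by
  induction k generalizing j with
  | zero => simp [divDer]
  | succ k ih =>
    have h1 : (-1 - j - 1 : ℤ) = -1 - ((j + 1 : ℕ) : ℤ) := by push_cast; ring
    rw [divDer_succ_apply, h1, ih, smul_smul]
    have h2 : (-k - 1 - ((j + 1 : ℕ) : ℤ) : ℤ) = -((k + 1 : ℕ) : ℤ) - 1 - j := by push_cast; ring
    rw [h2]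
    congr 1
    have h3 := Nat.choose_succ_right_eq (k + j + 1) k
    have h4 : (k + j + 1).choose (j + 1) = (k + j + 1).choose k := by
      rw [← Nat.choose_symm_of_eq_add]
      ring
    have h5 : (k + 1 + j).choose j = (k + j + 1).choose (k + 1) := by
      rw [show k + 1 + j = k + j + 1 by ring, ← Nat.choose_symm_of_eq_add]
      ring
    have h6 : k + j + 1 - k = j + 1 := by omega
    rw [h6] at h3
    rw [← add_assoc, h4, h5]
    have h7 : ((k + 1 : ℕ) : ℂ) ≠ 0 := Nat.cast_ne_zero.2 (by omega)
    have h8 : ((k + j + 1).choose (k + 1) : ℂ) * ((k + 1 : ℕ) : ℂ) =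
        ((k + j + 1).choose k : ℂ) * ((j + 1 : ℕ) : ℂ) := by exact_mod_cast h3
    push_cast at h7 h8 ⊢
    field_simp
    linear_combination -h8

theorem divDer_apply_nat (k i : ℕ) (A : FieldOn V) (v : V) :
    (divDer k A).1 i v = ((-1) ^ k * (i.choose k : ℂ)) • A.1 (i - k) v := by
  induction k generalizing i with
  | zero => simp [divDer]
  | succ k ih =>
    rw [divDer_succ_apply]
    cases i with
    | zero => simp
    | succ i =>
      have h1 : (((i + 1 : ℕ) : ℤ) - 1 : ℤ) = (i : ℤ) := by push_cast; ring
      rw [h1, ih, smul_smul]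
      have h2 : (((i + 1 : ℕ) : ℤ) - ((k + 1 : ℕ) : ℤ) : ℤ) = i - k := by push_cast; ring
      rw [h2]
      congr 1
      have h3 := Nat.add_one_mul_choose_eq i k
      have h7 : ((k + 1 : ℕ) : ℂ) ≠ 0 := Nat.cast_ne_zero.2 (by omega)
      have h8 : ((i + 1 : ℕ) : ℂ) * (i.choose k : ℂ) =
        ((i + 1).choose (k + 1) : ℂ) * ((k + 1 : ℕ) : ℂ) := by exact_mod_cast h3
      push_cast at h7 h8 ⊢
      field_simp
      linear_combination (-1) ^ (k + 1) * h8

/-- Links the explicit binomial sum of the statement to `nop`, to which Dong's lemma applies. The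
non-negative modes i < k of ∂ᵏA/k! carry the factor C(i, k) = 0, so the annihilation half starts at
i = k + j; this is the origin of the index m - k - 1 - j. -/
theorem normalOrder_eq_nop (A B : FieldOn V) (ε : ℂ) (k : ℕ) (m : ℤ) (v : V) :
    normalOrder (fun m v => A.1 m v) ε k (fun m v => B.1 m v) m v =
      (nop ε (divDer k A) B).1 m v := by
  obtain ⟨J, hJ⟩ := exists_nat_forall_ge B v m
  obtain ⟨K, hK⟩ := exists_nat_forall_ge A v 0
  obtain ⟨M, hM⟩ := exists_nop_eq_sum ε (divDer k A) B m v
  simp only [zero_add] at hK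
  obtain ⟨L, hL⟩ : ∃ L, L = J + K + M := ⟨_, rfl⟩
  have h1 : normalOrder (fun m v => A.1 m v) ε k (fun m v => B.1 m v) m v =
      ∑ j ∈ Finset.range L, ((k + j).choose j : ℂ) •
    (A.1 (-k - 1 - j) (B.1 (m + j) v) + ((-1) ^ k * ε) • B.1 (m - k - 1 - j) (A.1 j v)) := by
    refine finsum_eq_sum_of_support_subset _ fun j hj => ?_
    rw [Finset.coe_range, Set.mem_Iio]
    by_contra hlt
    refine hj ?_
    simp only [hJ j (by omega), hK j (by omega), map_zero, smul_zero, add_zero]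
  -- With `k + L` terms, the creation half can drop its last `k` terms by truncation, and the
  -- annihilation half its first `k` terms.
  rw [h1, hM (k + L) (by omega), Finset.sum_add_distrib, ← Finset.smul_sum]
  simp only [smul_add]
  rw [Finset.sum_add_distrib]
  congr 1
  · rw [add_comm k L, Finset.sum_range_add]
    have h2 : ∀ x : ℕ, B.1 (m + ((L + x : ℕ) : ℤ)) v = 0 := fun x => hJ _ (by omega)
    simp only [h2, map_zero, Finset.sum_const_zero, add_zero]
    refine Finset.sum_congr rfl fun j _ => ?_
    rw [divDer_apply_neg]
  · have h2 : ∑ j ∈ Finset.range k, B.1 (m - 1 - j) ((divDer k A).1 j v) = 0 :=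
      Finset.sum_eq_zero fun j hj => by
        rw [divDer_apply_nat, Nat.choose_eq_zero_of_lt (Finset.mem_range.1 hj)]
        simp
    rw [Finset.sum_range_add (fun j : ℕ => B.1 (m - 1 - j) ((divDer k A).1 j v)), h2, zero_add,
      Finset.smul_sum]
    refine Finset.sum_congr rfl fun j _ => ?_
    rw [divDer_apply_nat, map_smul, smul_smul, smul_smul]
    have h3 : (m - 1 - ((k + j : ℕ) : ℤ)) = m - k - 1 - j := by push_cast; ring
    have h4 : (((k + j : ℕ) : ℤ) - k) = j := by push_cast; ring
    rw [h3, h4]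
    congr 1
    rw [Nat.choose_symm_add]
    ring

/-- Since (z - w) ∂_z f = ∂_z((z - w) f) - f, one extra power of z - w absorbs the derivative. -/
theorem diffOp_pow_derivative {N : ℕ} {f : ℤ × ℤ → V}
    (hf : (diffOp V ((1, 0) : ℤ × ℤ) (0, 1) ^ N) f = 0) :
    (diffOp V ((1, 0) : ℤ × ℤ) (0, 1) ^ (N + 1))
      (fun p => (-(p.1 : ℂ)) • f (p.1 - 1, p.2)) = 0 := by
  induction N generalizing f with
  | zero =>
    have : f = 0 := hf
    rw [this]
    simp only [Pi.zero_apply, smul_zero]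
    exact map_zero _
  | succ N ih =>
    rw [pow_succ, Module.End.mul_apply] at hf
    have h1 : diffOp V ((1, 0) : ℤ × ℤ) (0, 1) (fun p => (-(p.1 : ℂ)) • f (p.1 - 1, p.2)) =
        (fun p => (-(p.1 : ℂ)) • (diffOp V ((1, 0) : ℤ × ℤ) (0, 1) f) (p.1 - 1, p.2)) - f := by
      funext ⟨m, k⟩
      simp only [diffOp_apply, Pi.sub_apply, Prod.mk_add_mk, add_zero, add_sub_cancel_right,
        sub_add_cancel]
      push_cast
      module
    have h2 : (diffOp V ((1, 0) : ℤ × ℤ) (0, 1) ^ (N + 1)) f = 0 := by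
      rw [pow_succ, Module.End.mul_apply, hf]
    rw [pow_succ, Module.End.mul_apply, h1, map_sub, ih hf, h2, sub_zero]

theorem IsLocal.derF {ε : ℂ} {A B : FieldOn V} (h : IsLocal ε A B) : IsLocal ε (derF A) B := by
  obtain ⟨N, hN⟩ := h
  refine ⟨N + 1, fun v => ?_⟩
  rw [← diffOp_pow_derivative (hN v)]
  congr 1
  funext p
  simp only [superComm, derF_apply, map_smul, smul_sub]
  rw [smul_comm ε]

theorem IsLocal.divDer {ε : ℂ} {A B : FieldOn V} (h : IsLocal ε A B) (k : ℕ) :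
    IsLocal ε (divDer k A) B := by
  induction k with
  | zero => exact h
  | succ k ih => exact (localTo ε B).smul_mem _ ih.derF

/-- The identity field. -/
def idF (V : Type*) [AddCommGroup V] [Module ℂ V] : FieldOn V :=
  ⟨fun m => if m = -1 then 1 else 0, fun v => ⟨0, fun m hm => by
    have h : ¬ m = -1 := by omega
    simp [h]⟩⟩

theorem idF_apply (m : ℤ) (v : V) : (idF V).1 m v = if m = -1 then v else 0 := by
  by_cases h : m = -1 <;> simp [idF, h]

theorem isLocal_idF (A : FieldOn V) : IsLocal 1 (idF V) A := by
  refine ⟨0, fun v => funext fun p => ?_⟩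
  by_cases h : p.1 = -1 <;> simp [superComm, idF_apply, h]

end Derivative

/-! ## Translation covariance and uniqueness -/

section Good

variable {V : Type*} [AddCommGroup V] [Module ℂ V]

/-- Translation covariance of a field. -/
def IsCovariant (T : Module.End ℂ V) (A : FieldOn V) : Prop :=
  ∀ m v, T (A.1 m v) - A.1 m (T v) = (-(m : ℂ)) • A.1 (m - 1) v

theorem IsCovariant.derF {T : Module.End ℂ V} {A : FieldOn V} (h : IsCovariant T A) :
    IsCovariant T (derF A) := by
  intro m v
  simp only [derF_apply, map_smul]
  rw [← smul_sub, h, smul_comm]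

theorem IsCovariant.nop {T : Module.End ℂ V} {A B : FieldOn V} (hA : IsCovariant T A)
    (hB : IsCovariant T B) (ε : ℂ) : IsCovariant T (nop ε A B) := by
  intro m v
  obtain ⟨J₁, h₁⟩ := exists_nop_eq_sum ε A B m v
  obtain ⟨J₂, h₂⟩ := exists_nop_eq_sum ε A B m (T v)
  obtain ⟨J₃, h₃⟩ := exists_nop_eq_sum ε A B (m - 1) v
  obtain ⟨J₄, h₄⟩ := exists_nat_forall_ge B v (m - 1)
  obtain ⟨J₅, h₅⟩ := exists_nat_forall_ge A v (-1)
  set L := J₁ + J₂ + J₃ + J₄ + J₅ with hL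
  rw [h₁ L (by omega), h₂ L (by omega), h₃ L (by omega), map_sum, Finset.smul_sum,
    ← Finset.sum_sub_distrib, ← sub_eq_zero, ← Finset.sum_sub_distrib]
  -- Moving `T` past the two factors shifts mode indices with weights. The `j`-th terms of the two
  -- sides differ by `t (j + 1) - t j`, so the discrepancy telescopes: `t 0` has zero weights and `t
  -- L` vanishes by truncation.
  let t : ℕ → V := fun j => (j : ℂ) • A.1 (-1 - j) (B.1 (m - 1 + j) v) +
    (ε * j) • B.1 (m - 1 - j) (A.1 (-1 + j) v)
  have ht : ∑ j ∈ Finset.range L, (t (j + 1) - t j) = 0 := by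
    rw [Finset.sum_range_sub]
    simp only [t]
    rw [h₄ L (by omega), h₅ L (by omega)]
    simp
  rw [← ht]
  refine Finset.sum_congr rfl fun j _ => ?_
  have a₁ := hA (-1 - j) (B.1 (m + j) v)
  have a₂ := hA j v
  have b₁ := hB (m + j) v
  have b₂ := hB (m - 1 - j) (A.1 j v)
  rw [sub_eq_iff_eq_add] at a₁ a₂ b₁ b₂
  simp only [map_add, map_smul]
  rw [a₁, b₂, b₁, a₂]
  simp only [t, map_add, map_smul]
  have i₁ : (m + j - 1 : ℤ) = m - 1 + j := by ring
  have i₂ : (-1 - j - 1 : ℤ) = -1 - ((j + 1 : ℕ) : ℤ) := by push_cast; ring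
  have i₃ : (m - 1 + ((j + 1 : ℕ) : ℤ)) = m + j := by push_cast; ring
  have i₄ : (m - 1 - j - 1 : ℤ) = m - 1 - ((j + 1 : ℕ) : ℤ) := by push_cast; ring
  have i₅ : (-1 + ((j + 1 : ℕ) : ℤ)) = j := by push_cast; ring
  have i₆ : (m - 1 - 1 - j : ℤ) = m - 1 - ((j + 1 : ℕ) : ℤ) := by push_cast; ring
  have i₇ : (j - 1 : ℤ) = -1 + j := by ring
  rw [i₁, i₂, i₃, i₄, i₅, i₆, i₇]
  push_cast
  module

/-- The sign of exchanging elements of parities `p` and `q`. -/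
def superSign (p q : ZMod 2) : ℂ := if p * q = 0 then 1 else -1

theorem superSign_comm (p q : ZMod 2) : superSign p q = superSign q p := by
  rw [superSign, superSign, mul_comm]

theorem superSign_mul_self (p q : ZMod 2) : superSign p q * superSign p q = 1 := by
  unfold superSign; split_ifs <;> norm_num

theorem superSign_add (p q r : ZMod 2) :
    superSign (p + q) r = superSign p r * superSign q r := by
  have h : ∀ p q r : ZMod 2, ((p + q) * r = 0 ↔ (p * r = 0 ↔ q * r = 0)) := by decide
  unfold superSign
  have := h p q r
  split_ifs <;> simp_all

@[simp] theorem superSign_zero_left (q : ZMod 2) : superSign 0 q = 1 := by simp [superSign]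

@[simp] theorem superSign_zero_right (q : ZMod 2) : superSign q 0 = 1 := by simp [superSign]

/-- A space with a vacuum, a translation operator, a parity, and a family of fields whose modes
generate it from the vacuum. -/
structure GeneratingFields (V ι : Type*) [AddCommGroup V] [Module ℂ V] where
  vac : V
  T : Module.End ℂ V
  par : ZMod 2 → Submodule ℂ V
  gen : ι → FieldOn V
  deg : ι → ZMod 2
  T_vac : T vac = 0
  vac_mem : vac ∈ par 0
  span : ∀ K : Submodule ℂ V, vac ∈ K → (∀ i m v, v ∈ K → (gen i).1 m v ∈ K) → K = ⊤

namespace GeneratingFields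

variable {ι : Type*} (D : GeneratingFields V ι)

/-- Translation covariant fields of parity `p` that create states from the vacuum and are local
with respect to the generating fields. -/
def good (p : ZMod 2) : Submodule ℂ (FieldOn V) where
  carrier := {A | IsCovariant D.T A ∧ (∀ m, 0 ≤ m → A.1 m D.vac = 0) ∧
    (∀ m q v, v ∈ D.par q → A.1 m v ∈ D.par (p + q)) ∧
    ∀ i, IsLocal (superSign p (D.deg i)) A (D.gen i)}
  zero_mem' := ⟨fun m v => by simp, fun _ _ => rfl, fun m q v _ => zero_mem _,
    fun i => (localTo _ _).zero_mem⟩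
  add_mem' := by
    rintro a b ⟨a₁, a₂, a₃, a₄⟩ ⟨b₁, b₂, b₃, b₄⟩
    refine ⟨fun m v => ?_, fun m hm => ?_, fun m q v hv => ?_, fun i =>
      (localTo _ _).add_mem (a₄ i) (b₄ i)⟩
    · have := congrArg₂ (· + ·) (a₁ m v) (b₁ m v)
      simp only [Submodule.coe_add, Pi.add_apply, LinearMap.add_apply, map_add, smul_add] at this ⊢
      rw [← this]
      abel
    · simp [a₂ m hm, b₂ m hm]
    · exact add_mem (a₃ m q v hv) (b₃ m q v hv)
  smul_mem' := by
    rintro c a ⟨a₁, a₂, a₃, a₄⟩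
    refine ⟨fun m v => ?_, fun m hm => ?_, fun m q v hv => ?_, fun i =>
      (localTo _ _).smul_mem c (a₄ i)⟩
    · simp only [Submodule.coe_smul, Pi.smul_apply, LinearMap.smul_apply, map_smul]
      rw [← smul_sub, a₁, smul_comm]
    · simp [a₂ m hm]
    · exact Submodule.smul_mem _ _ (a₃ m q v hv)

variable {D}

/-- At the vacuum, covariance reads T A_m 𝟙 = -m A_{m-1} 𝟙. For m = -1 - k the factor k + 1 is
non-zero, so vanishing passes from each negative mode to the next lower one. -/
theorem good_apply_vac {p : ZMod 2} {A : FieldOn V} (hA : A ∈ D.good p)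
    (h : A.1 (-1) D.vac = 0) (m : ℤ) : A.1 m D.vac = 0 := by
  have neg : ∀ k : ℕ, A.1 (-1 - k) D.vac = 0 := by
    intro k
    induction k with
    | zero => simpa using h
    | succ k ih =>
      have := hA.1 (-1 - k) D.vac
      rw [ih, D.T_vac, map_zero, map_zero, sub_zero] at this
      rcases smul_eq_zero.1 this.symm with h0 | h0
      · exfalso
        have h1 : ((k + 1 : ℕ) : ℂ) = 0 := by
          push_cast at h0 ⊢
          linear_combination h0
        exact Nat.cast_ne_zero.2 (Nat.succ_ne_zero k) h1
      · rw [← h0]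
        congr 2
        push_cast
        ring_nf
  rcases le_or_gt 0 m with hm | hm
  · exact hA.2.1 m hm
  · have := neg (-1 - m).toNat
    rwa [show (-1 - ((-1 - m).toNat : ℤ)) = m by omega] at this

/-- A good field is determined by the state it creates from the vacuum. -/
theorem good_eq_zero {p : ZMod 2} {A : FieldOn V} (hA : A ∈ D.good p)
    (h : A.1 (-1) D.vac = 0) : A = 0 := by
  have hK := D.span (⨅ m, LinearMap.ker (A.1 m))
    (by simpa [Submodule.mem_iInf] using good_apply_vac hA h) ?_
  · refine FieldOn.ext_apply fun m v => ?_
    have : v ∈ (⨅ m, LinearMap.ker (A.1 m)) := hK ▸ Submodule.mem_top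
    exact (Submodule.mem_iInf _).1 this m
  · intro i k v hv
    simp only [Submodule.mem_iInf, LinearMap.mem_ker] at hv ⊢
    obtain ⟨N, hN⟩ := hA.2.2.2 i
    obtain ⟨M, hM⟩ := (D.gen i).2 v
    -- Descending induction on the mode `k` of the generator, starting from its truncation bound
    -- `M`. As `v` is killed by all modes of `A`, locality at `(m - N, k)` expresses the vector
    -- through those with `A` in mode `m - j` and the generator in mode `k + j`, where `j ≥ 1`.
    have key : ∀ d : ℕ, ∀ k, M - d ≤ k → ∀ m, A.1 m ((D.gen i).1 k v) = 0 := by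
      intro d
      induction d with
      | zero =>
        intro k hk m
        rw [hM k (by simpa using hk), map_zero]
      | succ d ih =>
        intro k hk m
        have h0 := congrFun (hN v) (m - N, k)
        rw [diffOp_pow_apply_pair, Finset.sum_range_succ', Finset.sum_eq_zero] at h0
        · simpa [superComm, hv] using h0
        · intro j _
          simp only [superComm, hv, map_zero, smul_zero, sub_zero]
          rw [ih _ (by push_cast at hk ⊢; omega), smul_zero]
    exact key (M - k).toNat k (by omega)

theorem good_ext {p : ZMod 2} {A B : FieldOn V} (hA : A ∈ D.good p) (hB : B ∈ D.good p)
    (h : A.1 (-1) D.vac = B.1 (-1) D.vac) : A = B := by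
  rw [← sub_eq_zero]
  refine good_eq_zero (Submodule.sub_mem _ hA hB) ?_
  simp [h]

theorem good_translation {p : ZMod 2} {A : FieldOn V} (hA : A ∈ D.good p) :
    A.1 (-2) D.vac = D.T (A.1 (-1) D.vac) := by
  have := hA.1 (-1) D.vac
  rw [D.T_vac, map_zero, sub_zero] at this
  simpa using this.symm

theorem derF_mem_good {p : ZMod 2} {A : FieldOn V} (hA : A ∈ D.good p) : derF A ∈ D.good p := by
  refine ⟨hA.1.derF, fun m hm => ?_, fun m q v hv => ?_, fun i => (hA.2.2.2 i).derF⟩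
  · rw [derF_apply]
    rcases hm.eq_or_lt with rfl | hm
    · simp
    · rw [hA.2.1 _ (by omega), smul_zero]
  · exact Submodule.smul_mem _ _ (hA.2.2.1 _ q v hv)

theorem divDer_mem_good {p : ZMod 2} {A : FieldOn V} (hA : A ∈ D.good p) (k : ℕ) :
    divDer k A ∈ D.good p := by
  induction k with
  | zero => exact hA
  | succ k ih => exact Submodule.smul_mem _ _ (derF_mem_good ih)

theorem nop_mem_good {p q : ZMod 2} {A B : FieldOn V} (hA : A ∈ D.good p) (hB : B ∈ D.good q)
    (h : IsLocal (superSign p q) A B) : nop (superSign p q) A B ∈ D.good (p + q) := by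
  refine ⟨hA.1.nop hB.1 _, fun m hm => ?_, fun m r v hv => ?_, fun i => ?_⟩
  · rw [nop_apply]
    refine finsum_eq_zero_of_forall_eq_zero fun j => ?_
    rw [hB.2.1 _ (by omega), hA.2.1 _ (by omega), map_zero, map_zero, smul_zero, zero_add]
  · obtain ⟨J, hJ⟩ := exists_nop_eq_sum (superSign p q) A B m v
    rw [hJ J le_rfl]
    refine Submodule.sum_mem _ fun j _ => Submodule.add_mem _ ?_ (Submodule.smul_mem _ _ ?_)
    · rw [add_assoc]
      exact hA.2.2.1 _ _ _ (hB.2.2.1 _ _ _ hv)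
    · rw [add_comm p q, add_assoc]
      exact hB.2.2.1 _ _ _ (hA.2.2.1 _ _ _ hv)
  · rw [superSign_add]
    exact h.nop (hA.2.2.2 i) (hB.2.2.2 i)

theorem nop_apply_vac {q : ZMod 2} (ε : ℂ) (A : FieldOn V) {B : FieldOn V} (hA : ∀ m, 0 ≤ m → A.1 m D.vac = 0)
    (hB : B ∈ D.good q) :
    (nop ε A B).1 (-1) D.vac = A.1 (-1) (B.1 (-1) D.vac) := by
  rw [nop_apply, finsum_eq_single _ 0]
  · simp [hA 0 le_rfl]
  · intro j hj
    rw [hB.2.1 _ (by omega), hA _ (by omega), map_zero, map_zero, smul_zero, zero_add]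

variable (D)

/-- Good fields that are local with respect to all good fields. -/
def full (p : ZMod 2) : Submodule ℂ (FieldOn V) :=
  D.good p ⊓ ⨅ q, ⨅ B ∈ D.good q, localTo (superSign p q) B

variable {D}

theorem mem_full {p : ZMod 2} {A : FieldOn V} : A ∈ D.full p ↔
    A ∈ D.good p ∧ ∀ q, ∀ B ∈ D.good q, IsLocal (superSign p q) A B := by
  simp [full, Submodule.mem_iInf, mem_localTo]

/-- Good fields are local to the generators by definition, and locality is symmetric. -/
theorem gen_mem_full (h : ∀ i, D.gen i ∈ D.good (D.deg i)) (i : ι) :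
    D.gen i ∈ D.full (D.deg i) :=
  mem_full.2 ⟨h i, fun q B hB => by
    rw [superSign_comm]
    exact (hB.2.2.2 i).symm (superSign_mul_self _ _)⟩

theorem divDer_mem_full {p : ZMod 2} {A : FieldOn V} (hA : A ∈ D.full p) (k : ℕ) :
    divDer k A ∈ D.full p :=
  mem_full.2 ⟨divDer_mem_good (mem_full.1 hA).1 k, fun q B hB => ((mem_full.1 hA).2 q B hB).divDer k⟩

/-- The reason for introducing `full`: Dong's lemma needs the two factors to be mutually local, and
for members of `full` this is automatic, so normally ordered products can be iterated. -/
theorem nop_mem_full {p q : ZMod 2} {A B : FieldOn V} (hA : A ∈ D.full p) (hB : B ∈ D.full q) :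
    nop (superSign p q) A B ∈ D.full (p + q) := by
  have hl := (mem_full.1 hA).2 q B (mem_full.1 hB).1
  refine mem_full.2 ⟨nop_mem_good (mem_full.1 hA).1 (mem_full.1 hB).1 hl, fun r C hC => ?_⟩
  rw [superSign_add]
  exact hl.nop ((mem_full.1 hA).2 r C hC) ((mem_full.1 hB).2 r C hC)

theorem idF_mem_full : idF V ∈ D.full 0 := by
  refine mem_full.2 ⟨⟨fun m v => ?_, fun m hm => ?_, fun m q v hv => ?_, fun i => ?_⟩, fun q B _ => ?_⟩
  · simp only [idF_apply]
    by_cases h : m = -1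
    · simp [h]
    · by_cases h' : m = 0
      · simp [h']
      · rw [if_neg h, if_neg h, if_neg (by omega)]
        simp
  · rw [idF_apply, if_neg (by omega)]
  · rw [idF_apply, zero_add]
    split_ifs
    · exact hv
    · exact zero_mem _
  · rw [superSign_zero_left]
    exact isLocal_idF _
  · rw [superSign_zero_left]
    exact isLocal_idF _

end GeneratingFields

end Good

/-! ## Differential polynomials -/

section DiffPoly

open MvPolynomial

variable {n : ℕ}

/-- A commutator of derivations is a derivation, so it suffices to compare on the variables. -/
theorem pderiv_diffPolyDeriv (i : Fin n) (k : ℕ) (u : DiffPoly n) :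
    pderiv (i, k) (diffPolyDeriv n u) = diffPolyDeriv n (pderiv (i, k) u) +
      if k = 0 then 0 else pderiv (i, k - 1) u := by
  have h : ⁅(pderiv (i, k) : Derivation ℂ (DiffPoly n) (DiffPoly n)), diffPolyDeriv n⁆ =
      if k = 0 then 0 else (pderiv (i, k - 1) : Derivation ℂ (DiffPoly n) (DiffPoly n)) := by
    refine MvPolynomial.derivation_ext fun s => ?_
    obtain ⟨j, l⟩ := s
    rw [Derivation.commutator_apply, diffPolyDeriv, mkDerivation_X, pderiv_X]
    have h0 : ∀ a : Fin n × ℕ, diffPolyDeriv n ((Pi.single a 1 : Fin n × ℕ → DiffPoly n) (j, l)) = 0 := by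
      intro a
      rw [Pi.single_apply]
      split_ifs <;> simp
    rw [← diffPolyDeriv, pderiv_X, h0, sub_zero]
    rcases k with _ | k <;> simp [Pi.single_apply, Prod.ext_iff]
  have := congrArg (fun D : Derivation ℂ (DiffPoly n) (DiffPoly n) => D u) h
  simp only [Derivation.commutator_apply, sub_eq_iff_eq_add] at this
  rw [this, add_comm]
  congr 1
  split_ifs <;> rfl

theorem pderiv_dPhi (i : Fin n) (k : ℕ) (α : Euc n) :
    pderiv (i, k) (dPhi α) = if k = 0 then C (α i : ℂ) else 0 := by
  rw [dPhi, map_sum]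
  simp only [pderiv_C_mul, pderiv_X, Pi.single_apply, Prod.mk.injEq]
  rw [Finset.sum_eq_single i]
  · rcases k with _ | k
    · simp
    · simp
  · intro b _ hb
    simp [hb]
  · simp

theorem dPhi_add (α β : Euc n) : dPhi (α + β) = dPhi α + dPhi β := by
  simp [dPhi, add_mul, Finset.sum_add_distrib]

theorem dPhi_zero : dPhi (0 : Euc n) = 0 := by simp [dPhi]

@[simp] theorem expCoeffInt_natCast (α : Euc n) (j : ℕ) : expCoeffInt α (j : ℤ) = expCoeff α j := rfl

@[simp] theorem expCoeffInt_zero (α : Euc n) : expCoeffInt α 0 = 1 := rfl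

theorem expCoeffInt_of_neg (α : Euc n) {j : ℤ} (hj : j < 0) : expCoeffInt α j = 0 := by
  cases j with
  | ofNat j => exact absurd hj (by simp)
  | negSucc j => rfl

theorem expCoeffInt_add_one (α : Euc n) (j : ℤ) :
    ((j + 1 : ℤ) : ℂ) • expCoeffInt α (j + 1) =
      diffPolyDeriv n (expCoeffInt α j) + dPhi α * expCoeffInt α j := by
  rcases lt_trichotomy j (-1) with h | rfl | h
  · rw [expCoeffInt_of_neg _ (by omega), expCoeffInt_of_neg _ (by omega)]
    simp
  · rw [expCoeffInt_of_neg α (j := -1) (by omega)]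
    simp
  · lift j to ℕ using by omega
    have : ((j : ℤ) + 1) = ((j + 1 : ℕ) : ℤ) := by push_cast; ring
    rw [this, expCoeffInt_natCast, expCoeffInt_natCast, expCoeff, smul_smul]
    have h1 : ((j : ℂ) + 1) ≠ 0 := Nat.cast_add_one_ne_zero j
    push_cast
    rw [mul_inv_cancel₀ h1, one_smul]

/-- The generating series ∑ P_j z^j is exp(∑_k ∂^{1+k}φ_α z^{k+1}/(k+1)!), and differentiating in
the variable (i, k) multiplies it by α_i z^{k+1}/(k+1)!. The proof extracts this from the recursion
for the P_j. -/
theorem factorial_smul_pderiv_expCoeffInt (α : Euc n) (i : Fin n) (k : ℕ) (j : ℤ) :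
    ((k + 1).factorial : ℂ) • pderiv (i, k) (expCoeffInt α j) =
      (α i : ℂ) • expCoeffInt α (j - (k + 1)) := by
  rcases lt_or_ge j 0 with h | h
  · rw [expCoeffInt_of_neg _ h, expCoeffInt_of_neg _ (by omega)]
    simp
  lift j to ℕ using h
  induction j generalizing k with
  | zero =>
    rw [expCoeffInt_of_neg α (j := ((0 : ℕ) : ℤ) - (k + 1)) (by push_cast; omega)]
    simp
  | succ j ih =>
    have h1 : ((j : ℂ) + 1) ≠ 0 := Nat.cast_add_one_ne_zero j
    refine smul_right_injective _ h1 ?_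
    have h2 := congrArg (pderiv (i, k)) (expCoeffInt_add_one α j)
    rw [Derivation.map_smul] at h2
    push_cast at h2 ⊢
    rw [smul_comm, h2, map_add, pderiv_diffPolyDeriv, Derivation.leibniz, pderiv_dPhi]
    have h3 := expCoeffInt_add_one α (j - (k + 1))
    have h4 := congrArg (diffPolyDeriv n) (ih k)
    have h5 := congrArg (dPhi α * ·) (ih k)
    simp only [Derivation.map_smul, mul_smul_comm] at h4 h5
    have e1 : ((j : ℤ) + 1 - (k + 1)) = j - (k + 1) + 1 := by ring
    rcases k with _ | k
    · simp only [if_true, smul_eq_mul, smul_add] at h4 h5 ⊢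
      rw [e1]
      simp only [mul_comm (expCoeffInt α (j : ℤ)), ← smul_eq_C_mul]
      have h6 := congrArg ((α i : ℂ) • ·) h3
      simp only [smul_add] at h6
      simp only [zero_add, Nat.factorial_one, Nat.cast_one, one_smul, smul_zero, add_zero,
        CharP.cast_eq_zero] at *
      simp only [sub_add_cancel] at *
      rw [h4, h5]
      rw [← add_assoc, ← h6]
      push_cast
      module
    · have h7 := ih k
      have e2 : (j - (k + 1) : ℤ) = j - ((k + 1 : ℕ) + 1) + 1 := by push_cast; ring
      rw [e2] at h7
      have h6 := congrArg ((α i : ℂ) • ·) h3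
      simp only [smul_add] at h6
      simp only [Nat.succ_ne_zero, if_false, smul_eq_mul, smul_add,
        Nat.add_sub_cancel] at h4 h5 ⊢
      rw [e1, h4, h5]
      have h8 : ((k + 1 + 1).factorial : ℂ) • pderiv (i, k) (expCoeffInt α j) =
          (k + 1 + 1 : ℂ) • (α i : ℂ) • expCoeffInt α (j - ((k + 1 : ℕ) + 1) + 1) := by
        rw [← h7, smul_smul, Nat.factorial_succ (k + 1)]
        push_cast
        rfl
      rw [h8, mul_zero, smul_zero, add_zero, add_right_comm, ← h6]
      push_cast
      module

/-- The coefficient form of e^{φ_α} e^{φ_β} = e^{φ_{α+β}}: both sides satisfy the same first-order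
recursion in `q`. -/
theorem sum_antidiagonal_expCoeff (α β : Euc n) (q : ℕ) :
    ∑ s ∈ Finset.HasAntidiagonal.antidiagonal q, expCoeff α s.1 * expCoeff β s.2 = expCoeff (α + β) q := by
  have hrec : ∀ (γ : Euc n) (j : ℕ), ((j : ℂ) + 1) • expCoeff γ (j + 1) =
      diffPolyDeriv n (expCoeff γ j) + dPhi γ * expCoeff γ j := by
    intro γ j
    have := expCoeffInt_add_one γ j
    push_cast at this
    exact this
  induction q with
  | zero => simp [expCoeff]
  | succ q ih =>
    have h1 : ((q : ℂ) + 1) ≠ 0 := Nat.cast_add_one_ne_zero q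
    refine smul_right_injective _ h1 ?_
    beta_reduce
    rw [hrec, ← ih, map_sum, Finset.mul_sum, ← Finset.sum_add_distrib]
    have e1 : ((q : ℂ) + 1) • ∑ s ∈ Finset.HasAntidiagonal.antidiagonal (q + 1), expCoeff α s.1 * expCoeff β s.2 =
        ∑ s ∈ Finset.HasAntidiagonal.antidiagonal (q + 1), ((s.1 : ℂ) • (expCoeff α s.1 * expCoeff β s.2)) +
        ∑ s ∈ Finset.HasAntidiagonal.antidiagonal (q + 1), ((s.2 : ℂ) • (expCoeff α s.1 * expCoeff β s.2)) := by
      rw [Finset.smul_sum, ← Finset.sum_add_distrib]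
      refine Finset.sum_congr rfl fun s hs => ?_
      rw [← add_smul]
      congr 1
      have := Finset.HasAntidiagonal.mem_antidiagonal.1 hs
      exact_mod_cast this.symm
    rw [e1, Finset.Nat.sum_antidiagonal_succ, Finset.Nat.sum_antidiagonal_succ']
    simp only [Nat.cast_zero, zero_smul, zero_add]
    rw [← Finset.sum_add_distrib]
    refine Finset.sum_congr rfl fun s _ => ?_
    rw [← smul_mul_assoc, ← mul_smul_comm]
    push_cast
    rw [hrec, hrec, dPhi_add, Derivation.leibniz]
    simp only [smul_eq_mul]
    ring

theorem expCoeff_zero_left (j : ℕ) : expCoeff (0 : Euc n) j = if j = 0 then 1 else 0 := by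
  induction j with
  | zero => rfl
  | succ j ih =>
    rw [expCoeff, ih, dPhi_zero]
    split_ifs <;> simp_all

/-- The operator on differential polynomials underlying the modes of `Y(e^{φ_α})`. -/
def expOp (α : Euc n) (r : ℤ) : DiffPoly n →ₗ[ℂ] DiffPoly n :=
  (Polynomial.lsum fun l : ℕ => LinearMap.mulLeft ℂ (expCoeffInt α (l - r))) ∘ₗ
    (expPairing α).toLinearMap

theorem expOp_one (α : Euc n) (r : ℤ) : expOp α r 1 = expCoeffInt α (-r) := by
  rw [expOp, LinearMap.comp_apply, AlgHom.toLinearMap_apply, map_one, ← Polynomial.C_1]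
  simp only [Polynomial.lsum, LinearMap.coe_mk, AddHom.coe_mk, LinearMap.mulLeft_apply]
  rw [Polynomial.sum_C_index (by simp)]
  simp

theorem lsum_X_pow_mul (α : Euc n) (r : ℤ) (k : ℕ) (c : DiffPoly n)
    (p : Polynomial (DiffPoly n)) :
    (Polynomial.lsum fun l : ℕ => LinearMap.mulLeft ℂ (expCoeffInt α (l - r)))
      (Polynomial.C c * Polynomial.X ^ k * p) =
    c * (Polynomial.lsum fun l : ℕ => LinearMap.mulLeft ℂ (expCoeffInt α (l - (r - k)))) p := by
  induction p using Polynomial.induction_on' with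
  | add p q hp hq => rw [mul_add, map_add, map_add, hp, hq, mul_add]
  | monomial m a =>
    rw [Polynomial.C_mul_X_pow_eq_monomial, Polynomial.monomial_mul_monomial]
    simp only [Polynomial.lsum, LinearMap.coe_mk, AddHom.coe_mk, LinearMap.mulLeft_apply]
    rw [Polynomial.sum_monomial_index _ _ (by simp), Polynomial.sum_monomial_index _ _ (by simp)]
    have : (((k + m : ℕ) : ℤ) - r) = m - (r - k) := by push_cast; ring
    rw [this]
    ring

/-- Together with `factorial_smul_pderiv_expOp`, this is the commutator of a free boson with an
exponential, stripped of the lattice and the cocycle. -/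
theorem expOp_X_mul (α : Euc n) (r : ℤ) (i : Fin n) (k : ℕ) (u : DiffPoly n) :
    expOp α r (X (i, k) * u) = X (i, k) * expOp α r u -
      ((α i : ℂ) * (k.factorial : ℂ)) • expOp α (r - (k + 1)) u := by
  have h0 := lsum_X_pow_mul α r 0 (X (i, k)) (expPairing α u)
  have h1 := lsum_X_pow_mul α r (k + 1) (C ((α i : ℂ) * (k.factorial : ℂ))) (expPairing α u)
  rw [pow_zero, mul_one, Nat.cast_zero, sub_zero] at h0
  simp only [expOp, LinearMap.comp_apply, AlgHom.toLinearMap_apply, map_mul (expPairing α)]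
  rw [expPairing, MvPolynomial.aeval_X, sub_mul, map_sub]
  rw [expPairing] at h0 h1
  rw [h0, h1, ← smul_eq_C_mul]
  push_cast
  rfl

theorem diffPoly_induction {P : DiffPoly n → Prop} (u : DiffPoly n) (one : P 1)
    (add : ∀ u v, P u → P v → P (u + v)) (smul : ∀ (c : ℂ) u, P u → P (c • u))
    (X_mul : ∀ i k u, P u → P (X (i, k) * u)) : P u := by
  induction u using MvPolynomial.induction_on with
  | C a => simpa [smul_eq_C_mul] using smul a 1 one
  | add p q hp hq => exact add p q hp hq
  | mul_X p s hp => rw [mul_comm]; exact X_mul s.1 s.2 p hp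

theorem factorial_smul_pderiv_expOp (α : Euc n) (i : Fin n) (k : ℕ) (r : ℤ) (u : DiffPoly n) :
    ((k + 1).factorial : ℂ) • pderiv (i, k) (expOp α r u) =
      ((k + 1).factorial : ℂ) • expOp α r (pderiv (i, k) u) +
        (α i : ℂ) • expOp α (r + (k + 1)) u := by
  induction u using diffPoly_induction generalizing r with
  | one =>
    rw [expOp_one, factorial_smul_pderiv_expCoeffInt, expOp_one, pderiv_one, map_zero, smul_zero,
      zero_add, neg_add']
  | add u v hu hv => simp only [map_add, smul_add, hu, hv]; abel
  | smul c u hu =>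
    simp only [map_smul, Derivation.map_smul]
    rw [smul_comm, hu, smul_add, smul_comm c, smul_comm c]
  | X_mul j l u hu =>
    have h1 := hu r
    have h2 := hu (r - (l + 1))
    rw [expOp_X_mul, map_sub, Derivation.map_smul, Derivation.leibniz, Derivation.leibniz, expOp_X_mul,
      map_add, smul_eq_mul, smul_eq_mul, smul_eq_mul, smul_eq_mul, expOp_X_mul, smul_sub,
      smul_add, ← mul_smul_comm, h1, smul_comm, h2, pderiv_X]
    have e1 : r + (k + 1) - (l + 1 : ℤ) = r - (l + 1) + (k + 1) := by ring
    rw [e1]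
    by_cases h : ((i, k) : Fin n × ℕ) = (j, l)
    · rw [← h, Pi.single_eq_same, mul_one, mul_one, mul_add, mul_smul_comm, mul_smul_comm]
      module
    · rw [Pi.single_eq_of_ne (Ne.symm h), mul_zero, mul_zero, map_zero, mul_add, mul_smul_comm,
        mul_smul_comm]
      module

theorem exists_expOp_eq_zero (α : Euc n) (u : DiffPoly n) :
    ∃ N : ℤ, ∀ r, N ≤ r → expOp α r u = 0 := by
  induction u using diffPoly_induction with
  | one => exact ⟨1, fun r hr => by rw [expOp_one, expCoeffInt_of_neg _ (by omega)]⟩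
  | add u v hu hv =>
    obtain ⟨N, hN⟩ := hu
    obtain ⟨M, hM⟩ := hv
    exact ⟨max N M, fun r hr => by rw [map_add, hN r (by omega), hM r (by omega), add_zero]⟩
  | smul c u hu =>
    obtain ⟨N, hN⟩ := hu
    exact ⟨N, fun r hr => by rw [map_smul, hN r hr, smul_zero]⟩
  | X_mul j l u hu =>
    obtain ⟨N, hN⟩ := hu
    exact ⟨N + (l + 1), fun r hr => by
      rw [expOp_X_mul, hN r (by omega), hN _ (by omega), mul_zero, smul_zero, sub_zero]⟩

end DiffPoly

/-! ## The generating fields of a lattice vertex superalgebra -/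

section Lattice

open MvPolynomial

variable {n : ℕ} {Λ : AddSubgroup (Euc n)}

theorem inner_eq_sum (x y : Euc n) : ⟪x, y⟫_ℝ = ∑ i, x i * y i := by
  simp [PiLp.inner_apply, mul_comm]

theorem intInner_comm (x y : Euc n) : intInner x y = intInner y x := by
  rw [intInner, intInner, real_inner_comm]

/-- Integral lattices. -/
def IsIntegralLattice (Λ : AddSubgroup (Euc n)) : Prop :=
  ∀ x y : Λ, ((intInner (x : Euc n) y : ℤ) : ℝ) = ⟪(x : Euc n), (y : Euc n)⟫_ℝ

theorem IsIntegralLattice.add_left (hΛ : IsIntegralLattice Λ) (x y z : Λ) :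
    intInner ((x + y : Λ) : Euc n) z = intInner (x : Euc n) z + intInner (y : Euc n) z := by
  have h : ((intInner ((x + y : Λ) : Euc n) z : ℤ) : ℝ) =
      ((intInner (x : Euc n) z + intInner (y : Euc n) z : ℤ) : ℝ) := by
    rw [Int.cast_add, hΛ, hΛ, hΛ, AddSubgroup.coe_add, inner_add_left]
  exact_mod_cast h

theorem IsIntegralLattice.add_right (hΛ : IsIntegralLattice Λ) (x y z : Λ) :
    intInner (z : Euc n) ((x + y : Λ) : Euc n) = intInner (z : Euc n) x + intInner (z : Euc n) y := by
  rw [intInner_comm, hΛ.add_left, intInner_comm (x : Euc n), intInner_comm (y : Euc n)]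

theorem IsIntegralLattice.zero_left (hΛ : IsIntegralLattice Λ) (x : Λ) : intInner ((0 : Λ) : Euc n) x = 0 := by
  have := hΛ.add_left 0 0 x
  rw [add_zero] at this
  omega

theorem IsIntegralLattice.zero_right (hΛ : IsIntegralLattice Λ) (x : Λ) : intInner (x : Euc n) ((0 : Λ) : Euc n) = 0 := by
  rw [intInner_comm, hΛ.zero_left]

theorem IsIntegralLattice.complex_sum (hΛ : IsIntegralLattice Λ) (x y : Λ) :
    ∑ i, ((x : Euc n) i : ℂ) * ((y : Euc n) i : ℂ) = (intInner (x : Euc n) y : ℂ) := by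
  have := hΛ x y
  rw [inner_eq_sum] at this
  have h2 := congrArg (fun t : ℝ => (t : ℂ)) this
  push_cast at h2
  exact h2.symm

/-- The modes of the free boson fields as linear maps. -/
def bosonLM (Λ : AddSubgroup (Euc n)) (i : Fin n) : ℤ → Module.End ℂ (LatticeSpace Λ)
  | Int.negSucc k => Finsupp.mapRange.linearMap
      (((k.factorial : ℂ)⁻¹) • LinearMap.mulLeft ℂ (X (i, k) : DiffPoly n))
  | Int.ofNat 0 => Finsupp.lsum ℂ fun l => ((l : Euc n) i : ℂ) • Finsupp.lsingle l
  | Int.ofNat (k + 1) => Finsupp.mapRange.linearMap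
      (((k + 1).factorial : ℂ) • (pderiv (i, k) : Derivation ℂ (DiffPoly n) _).toLinearMap)

theorem bosonLM_apply (i : Fin n) (m : ℤ) (v : LatticeSpace Λ) :
    bosonLM Λ i m v = bosonMode Λ i m v := by
  rcases m with (_ | k) | k
  · change (Finsupp.lsum ℂ fun l : Λ =>
        ((l : Euc n) i : ℂ) • (Finsupp.lsingle l : DiffPoly n →ₗ[ℂ] LatticeSpace Λ)) v =
      v.sum fun l u => Finsupp.single l (((l : Euc n) i : ℂ) • u)
    rw [Finsupp.lsum_apply]
    exact Finset.sum_congr rfl fun l _ => by simp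
  · rfl
  · rfl

theorem bosonLM_neg (i : Fin n) (k : ℕ) (l : Λ) (u : DiffPoly n) :
    bosonLM Λ i (-1 - k) (Finsupp.single l u) =
      Finsupp.single l (((k.factorial : ℂ)⁻¹) • (X (i, k) * u)) := by
  rw [show (-1 - k : ℤ) = Int.negSucc k by rw [Int.negSucc_eq]; ring]
  simp [bosonLM]

theorem bosonLM_zero (i : Fin n) (l : Λ) (u : DiffPoly n) :
    bosonLM Λ i 0 (Finsupp.single l u) = Finsupp.single l (((l : Euc n) i : ℂ) • u) := by
  change bosonLM Λ i (Int.ofNat 0) _ = _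
  simp [bosonLM]

theorem bosonLM_pos (i : Fin n) (k : ℕ) (l : Λ) (u : DiffPoly n) :
    bosonLM Λ i (k + 1) (Finsupp.single l u) =
      Finsupp.single l (((k + 1).factorial : ℂ) • pderiv (i, k) u) := by
  change bosonLM Λ i (Int.ofNat (k + 1)) _ = _
  simp [bosonLM]

theorem int_cases' {P : ℤ → Prop} (neg : ∀ k : ℕ, P (-1 - k)) (zero : P 0)
    (pos : ∀ k : ℕ, P (k + 1)) (m : ℤ) : P m := by
  rcases m with (_ | k) | k
  · exact zero
  · exact pos k
  · rw [show Int.negSucc k = (-1 - k : ℤ) by rw [Int.negSucc_eq]; ring]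
    exact neg k

theorem exists_lattice_trunc {A : ℤ → Module.End ℂ (LatticeSpace Λ)}
    (h : ∀ (l : Λ) (u : DiffPoly n), ∃ N : ℤ, ∀ m, N ≤ m → A m (Finsupp.single l u) = 0) :
    A ∈ fieldModule (LatticeSpace Λ) := by
  intro v
  induction v using Finsupp.induction_linear with
  | zero => exact ⟨0, fun _ _ => map_zero _⟩
  | add v w hv hw =>
    obtain ⟨N, hN⟩ := hv
    obtain ⟨M, hM⟩ := hw
    exact ⟨max N M, fun m hm => by rw [map_add, hN m (by omega), hM m (by omega), add_zero]⟩
  | single l u => exact h l u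

/-- The free boson fields. -/
def bosonF (Λ : AddSubgroup (Euc n)) (i : Fin n) : FieldOn (LatticeSpace Λ) :=
  ⟨bosonLM Λ i, exists_lattice_trunc fun l u => by
    have h : ∃ N : ℕ, ∀ k, N ≤ k → pderiv (i, k) u = 0 := by
      induction u using diffPoly_induction with
      | one => exact ⟨0, fun k _ => pderiv_one⟩
      | add u v hu hv =>
        obtain ⟨N, hN⟩ := hu
        obtain ⟨M, hM⟩ := hv
        exact ⟨max N M, fun m hm => by rw [map_add, hN m (by omega), hM m (by omega), add_zero]⟩
      | smul c u hu =>
        obtain ⟨N, hN⟩ := hu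
        exact ⟨N, fun k hk => by rw [Derivation.map_smul, hN k hk, smul_zero]⟩
      | X_mul j t u hu =>
        obtain ⟨N, hN⟩ := hu
        refine ⟨max N (t + 1), fun k hk => ?_⟩
        rw [Derivation.leibniz, hN k (by omega), pderiv_X, Pi.single_eq_of_ne]
        · simp
        · intro h
          have := (Prod.ext_iff.1 h).2
          simp only at this
          omega
    obtain ⟨N, hN⟩ := h
    refine ⟨N + 1, fun m hm => ?_⟩
    obtain ⟨k, rfl⟩ : ∃ k : ℕ, m = k + 1 := ⟨(m - 1).toNat, by omega⟩
    rw [bosonLM_pos, hN k (by omega), smul_zero, Finsupp.single_zero]⟩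

theorem boson_closed_eq_top {K : Submodule ℂ (LatticeSpace Λ)}
    (h0 : ∀ l : Λ, Finsupp.single l 1 ∈ K)
    (hK : ∀ (i : Fin n) (k : ℕ), ∀ v ∈ K, bosonLM Λ i (-1 - k) v ∈ K) : K = ⊤ := by
  rw [eq_top_iff]
  rintro v -
  induction v using Finsupp.induction_linear with
  | zero => exact zero_mem _
  | add v w hv hw => exact add_mem hv hw
  | single l u =>
    induction u using diffPoly_induction with
    | one => exact h0 l
    | add u v hu hv => rw [Finsupp.single_add]; exact add_mem hu hv
    | smul c u hu => rw [← Finsupp.smul_single]; exact Submodule.smul_mem _ _ hu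
    | X_mul i k u hu =>
      have := Submodule.smul_mem _ (k.factorial : ℂ) (hK i k _ hu)
      rwa [bosonLM_neg, Finsupp.smul_single, smul_smul, mul_inv_cancel₀, one_smul] at this
      exact Nat.cast_ne_zero.2 k.factorial_ne_zero

/-- A family of operators on which the negative boson modes act linearly vanishes if it vanishes
on the exponentials. -/
theorem eq_zero_of_exp {J : Type*} {A : J → Module.End ℂ (LatticeSpace Λ)}
    (h0 : ∀ x (l : Λ), A x (Finsupp.single l 1) = 0)
    (hA : ∀ (i : Fin n) (k : ℕ) x v, (∀ y, A y v = 0) →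
      A x (bosonLM Λ i (-1 - k) v) = 0) (x : J) : A x = 0 := by
  have hK : (⨅ y, LinearMap.ker (A y)) = ⊤ := boson_closed_eq_top
    (fun l => by simpa [Submodule.mem_iInf] using fun y => h0 y l) fun i k v hv => by
      simp only [Submodule.mem_iInf, LinearMap.mem_ker] at hv ⊢
      exact fun y => hA i k y v hv
  refine LinearMap.ext fun v => ?_
  have : v ∈ (⨅ y, LinearMap.ker (A y)) := hK ▸ Submodule.mem_top
  exact (Submodule.mem_iInf _).1 this x

/-- The translation operator. -/
def latticeT (Λ : AddSubgroup (Euc n)) : Module.End ℂ (LatticeSpace Λ) :=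
  Finsupp.lsum ℂ fun l => Finsupp.lsingle l ∘ₗ
    ((diffPolyDeriv n).toLinearMap + LinearMap.mulLeft ℂ (dPhi (l : Euc n)))

theorem latticeT_single (l : Λ) (u : DiffPoly n) : latticeT Λ (Finsupp.single l u) =
    Finsupp.single l (diffPolyDeriv n u + dPhi (l : Euc n) * u) := by
  simp [latticeT]

theorem pderiv_pderiv_comm {σ R : Type*} [CommRing R] (s t : σ) (u : MvPolynomial σ R) :
    pderiv s (pderiv t u) = pderiv t (pderiv s u) := by
  classical
  have : ⁅(pderiv s : Derivation R (MvPolynomial σ R) (MvPolynomial σ R)),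
      (pderiv t : Derivation R (MvPolynomial σ R) (MvPolynomial σ R))⁆ = 0 := by
    refine MvPolynomial.derivation_ext fun r => ?_
    rw [Derivation.commutator_apply, pderiv_X, pderiv_X, Pi.single_apply, Pi.single_apply]
    split_ifs <;> simp
  have h2 := congrArg (fun D : Derivation R (MvPolynomial σ R) (MvPolynomial σ R) => D u) this
  simpa [Derivation.commutator_apply, sub_eq_zero] using h2

theorem bosonLM_comm (i j : Fin n) (m k : ℤ) (v : LatticeSpace Λ) :
    bosonLM Λ i m (bosonLM Λ j k v) - bosonLM Λ j k (bosonLM Λ i m v) =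
      if i = j ∧ m + k = 0 then (m : ℂ) • v else 0 := by
  induction v using Finsupp.induction_linear with
  | zero => simp
  | add v w hv hw =>
    have e : (if i = j ∧ m + k = 0 then (m : ℂ) • (v + w) else 0) =
        (if i = j ∧ m + k = 0 then (m : ℂ) • v else 0) +
          (if i = j ∧ m + k = 0 then (m : ℂ) • w else 0) := by
      split_ifs <;> simp
    rw [e, ← hv, ← hw]
    simp only [map_add]
    abel
  | single l u =>
    have mixed : ∀ (i j : Fin n) (s t : ℕ),
        bosonLM Λ i (s + 1) (bosonLM Λ j (-1 - t) (Finsupp.single l u)) -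
          bosonLM Λ j (-1 - t) (bosonLM Λ i (s + 1) (Finsupp.single l u)) =
        if i = j ∧ s = t then ((s + 1 : ℕ) : ℂ) • Finsupp.single l u else 0 := by
      intro i j s t
      rw [bosonLM_neg, bosonLM_pos, bosonLM_pos, bosonLM_neg, Derivation.map_smul,
        Derivation.leibniz, pderiv_X, ← Finsupp.single_sub]
      by_cases h : i = j ∧ s = t
      · obtain ⟨rfl, rfl⟩ := h
        have h1 : (s.factorial : ℂ) ≠ 0 := Nat.cast_ne_zero.2 s.factorial_ne_zero
        rw [Pi.single_eq_same, if_pos ⟨rfl, rfl⟩, Finsupp.smul_single]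
        congr 1
        simp only [smul_eq_mul, mul_one, mul_smul_comm, smul_add, smul_smul]
        rw [mul_comm (s.factorial : ℂ)⁻¹, add_sub_cancel_left, Nat.factorial_succ]
        congr 1
        push_cast
        field_simp
      · rw [Pi.single_eq_of_ne, if_neg h]
        · simp only [smul_eq_mul, mul_zero, mul_smul_comm, smul_add, smul_smul]
          rw [mul_comm (s.succ.factorial : ℂ)]
          simp
        · intro h'
          exact h ⟨(Prod.ext_iff.1 h').1.symm, (Prod.ext_iff.1 h').2.symm⟩
    induction m using int_cases' with
    | neg s =>
      induction k using int_cases' with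
      | neg t =>
        rw [if_neg (by omega)]
        simp only [bosonLM_neg]
        rw [sub_eq_zero]
        congr 1
        simp only [mul_smul_comm, smul_smul]
        rw [mul_comm (s.factorial : ℂ)⁻¹, mul_left_comm]
      | zero =>
        rw [if_neg (by omega)]
        simp only [bosonLM_neg, bosonLM_zero]
        rw [sub_eq_zero, mul_smul_comm, smul_comm]
      | pos t =>
        rw [← neg_sub, mixed]
        by_cases h : i = j ∧ s = t
        · obtain ⟨rfl, rfl⟩ := h
          rw [if_pos ⟨rfl, rfl⟩, if_pos ⟨rfl, by ring⟩, ← neg_smul]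
          congr 1
          push_cast
          ring
        · rw [if_neg (fun h' => h ⟨h'.1.symm, h'.2.symm⟩), if_neg (fun h' => h ⟨h'.1, by omega⟩),
            neg_zero]
    | zero =>
      rw [Int.cast_zero, zero_smul, ite_self]
      induction k using int_cases' with
      | neg t =>
        simp only [bosonLM_neg, bosonLM_zero]
        rw [sub_eq_zero, mul_smul_comm, smul_comm]
      | zero =>
        simp only [bosonLM_zero]
        rw [sub_eq_zero, smul_comm]
      | pos t =>
        simp only [bosonLM_pos, bosonLM_zero]
        rw [sub_eq_zero, Derivation.map_smul, smul_comm]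
    | pos s =>
      induction k using int_cases' with
      | neg t =>
        rw [mixed]
        by_cases h : i = j ∧ s = t
        · obtain ⟨rfl, rfl⟩ := h
          rw [if_pos ⟨rfl, rfl⟩, if_pos ⟨rfl, by ring⟩]
          push_cast
          rfl
        · rw [if_neg h, if_neg (fun h' => h ⟨h'.1, by omega⟩)]
      | zero =>
        rw [if_neg (by omega)]
        simp only [bosonLM_pos, bosonLM_zero]
        rw [sub_eq_zero, Derivation.map_smul, smul_comm]
      | pos t =>
        rw [if_neg (by omega)]
        simp only [bosonLM_pos, Derivation.map_smul]
        rw [sub_eq_zero, smul_comm]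
        rw [pderiv_pderiv_comm]

theorem isLocal_bosonF (i j : Fin n) : IsLocal 1 (bosonF Λ i) (bosonF Λ j) := by
  -- The commutator is supported on m + k = 0 and linear in m, so its second difference along m + k
  -- = const vanishes.
  refine ⟨2, fun v => funext fun p => ?_⟩
  obtain ⟨m, k⟩ := p
  have h : superComm 1 (bosonF Λ i) (bosonF Λ j) v = fun p => if i = j ∧ p.1 + p.2 = 0 then
      (p.1 : ℂ) • v else 0 := by
    funext p
    rw [superComm, one_smul]
    exact bosonLM_comm i j p.1 p.2 v
  rw [h, diffOp_pow_apply_pair]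
  simp only [Finset.sum_range_succ, Finset.sum_range_zero]
  have e1 : (m + (2 : ℕ) - (0 : ℕ) + (k + (0 : ℕ)) : ℤ) = m + k + 2 := by push_cast; ring
  have e2 : (m + (2 : ℕ) - (1 : ℕ) + (k + (1 : ℕ)) : ℤ) = m + k + 2 := by push_cast; ring
  have e3 : (m + (2 : ℕ) - (2 : ℕ) + (k + (2 : ℕ)) : ℤ) = m + k + 2 := by push_cast; ring
  rw [e1, e2, e3]
  split_ifs
  · simp
    module
  · simp

theorem bosonF_covariant (i : Fin n) : IsCovariant (latticeT Λ) (bosonF Λ i) := by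
  intro m v
  change latticeT Λ (bosonLM Λ i m v) - bosonLM Λ i m (latticeT Λ v) =
    (-(m : ℂ)) • bosonLM Λ i (m - 1) v
  induction v using Finsupp.induction_linear with
  | zero => simp
  | add v w hv hw =>
    simp only [map_add, smul_add]
    rw [← hv, ← hw]
    abel
  | single l u =>
    induction m using int_cases' with
    | neg k =>
      have e : (-1 - k - 1 : ℤ) = -1 - ((k + 1 : ℕ) : ℤ) := by push_cast; ring
      rw [e]
      simp only [bosonLM_neg, latticeT_single]
      rw [← Finsupp.single_sub, Finsupp.smul_single, Derivation.map_smul, Derivation.leibniz]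
      congr 1
      have h1 : diffPolyDeriv n (X (i, k)) = X (i, k + 1) := by simp [diffPolyDeriv]
      have h2 : ((k : ℂ) + 1) ≠ 0 := Nat.cast_add_one_ne_zero k
      rw [h1, Nat.factorial_succ, smul_smul]
      push_cast
      rw [mul_inv, ← mul_assoc, show -(-1 - (k : ℂ)) * ((k : ℂ) + 1)⁻¹ = 1 by field_simp; ring,
        one_mul]
      simp only [smul_eq_mul, mul_smul_comm]
      rw [← smul_add, ← smul_sub]
      congr 1
      ring
    | zero =>
      simp only [bosonLM_zero, latticeT_single]
      rw [← Finsupp.single_sub, Derivation.map_smul, mul_smul_comm, ← smul_add, sub_self]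
      simp
    | pos k =>
      rcases k with _ | k
      · have e : (((0 : ℕ) : ℤ) + 1 - 1) = 0 := by simp
        rw [e]
        simp only [bosonLM_pos, latticeT_single, bosonLM_zero]
        rw [← Finsupp.single_sub, Finsupp.smul_single, map_add, pderiv_diffPolyDeriv,
          Derivation.leibniz, pderiv_dPhi, Derivation.map_smul]
        congr 1
        simp only [if_true, zero_add, Nat.factorial_one, Nat.cast_one, one_smul, add_zero,
          smul_eq_mul, mul_comm u, ← smul_eq_C_mul]
        push_cast
        module
      · have e : (((k + 1 : ℕ) : ℤ) + 1 - 1) = k + 1 := by push_cast; ring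
        rw [e]
        simp only [bosonLM_pos, latticeT_single]
        rw [← Finsupp.single_sub, Finsupp.smul_single, map_add, pderiv_diffPolyDeriv,
          Derivation.leibniz, pderiv_dPhi, Derivation.map_smul, Nat.factorial_succ (k + 1)]
        congr 1
        simp only [Nat.succ_ne_zero, if_false, smul_eq_mul, mul_zero, add_zero,
          Nat.add_sub_cancel, mul_smul_comm, smul_add]
        push_cast
        module

/-- The subspace spanned by the `u e^{φ_λ}` with `(λ, λ)` of parity `p`. -/
def latticePar (Λ : AddSubgroup (Euc n)) (p : ZMod 2) : Submodule ℂ (LatticeSpace Λ) :=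
  Finsupp.supported (DiffPoly n) ℂ {l : Λ | ((intInner (l : Euc n) l : ℤ) : ZMod 2) = p}

theorem latticePar_map {p q : ZMod 2} {f : Module.End ℂ (LatticeSpace Λ)}
    (h : ∀ (l : Λ) u, ((intInner (l : Euc n) l : ℤ) : ZMod 2) = p →
      f (Finsupp.single l u) ∈ latticePar Λ q) {v : LatticeSpace Λ} (hv : v ∈ latticePar Λ p) :
    f v ∈ latticePar Λ q := by
  rw [← Finsupp.sum_single v, map_finsuppSum]
  refine Submodule.sum_mem _ fun l hl => h l _ ?_
  exact (Finsupp.mem_supported _ _).1 hv hl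

theorem single_mem_latticePar {p : ZMod 2} {l : Λ} (h : ((intInner (l : Euc n) l : ℤ) : ZMod 2) = p)
    (u : DiffPoly n) : Finsupp.single l u ∈ latticePar Λ p :=
  Finsupp.single_mem_supported _ _ h

theorem bosonLM_mem_latticePar (i : Fin n) (m : ℤ) {p : ZMod 2} {v : LatticeSpace Λ}
    (hv : v ∈ latticePar Λ p) : bosonLM Λ i m v ∈ latticePar Λ p := by
  refine latticePar_map (fun l u hl => ?_) hv
  induction m using int_cases' with
  | neg k => rw [bosonLM_neg]; exact single_mem_latticePar hl _
  | zero => rw [bosonLM_zero]; exact single_mem_latticePar hl _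
  | pos k => rw [bosonLM_pos]; exact single_mem_latticePar hl _

end Lattice

/-! ### Exponential fields: commutators with the bosons and translation covariance -/

section Exponential

open MvPolynomial

variable {n : ℕ} {Λ : AddSubgroup (Euc n)} {κ : Λ → Λ → ℂˣ}

theorem expMode_single (α β : Λ) (m : ℤ) (u : DiffPoly n) :
    expMode κ α m (Finsupp.single β u) = Finsupp.single (β + α)
      ((κ β α : ℂ) • expOp (α : Euc n) (m + 1 + intInner (α : Euc n) β) u) := by
  rw [expMode, Finsupp.lsum_single, LinearMap.comp_apply, Finsupp.lsingle_apply]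
  simp only [LinearMap.comp_apply, LinearMap.smul_apply, expOp, sub_sub]

/-- The field `Y(e^{φ_α})`. -/
def expF (κ : Λ → Λ → ℂˣ) (α : Λ) : FieldOn (LatticeSpace Λ) :=
  ⟨expMode κ α, exists_lattice_trunc fun l u => by
    obtain ⟨N, hN⟩ := exists_expOp_eq_zero (α : Euc n) u
    refine ⟨N - 1 - intInner (α : Euc n) l, fun m hm => ?_⟩
    rw [expMode_single, hN _ (by omega), smul_zero, Finsupp.single_zero]⟩

theorem expMode_exp (α β : Λ) (m : ℤ) :
    expMode κ α m (Finsupp.single β 1) = Finsupp.single (β + α)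
      ((κ β α : ℂ) • expCoeffInt (α : Euc n) (-m - 1 - intInner (α : Euc n) β)) := by
  rw [expMode_single, expOp_one]
  congr 3
  ring

/-- Negative, zero and positive `p` are three different facts: multiplication by a variable, the
charge of `l + α`, and differentiation. Together they reduce later identities between exponential
modes to the vectors `e^{φ_l}`, through `eq_zero_of_exp`. -/
theorem bosonLM_expMode (α : Λ) (i : Fin n) (p m : ℤ) (v : LatticeSpace Λ) :
    bosonLM Λ i p (expMode κ α m v) = expMode κ α m (bosonLM Λ i p v) +
      ((α : Euc n) i : ℂ) • expMode κ α (m + p) v := by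
  induction v using Finsupp.induction_linear with
  | zero => simp
  | add v w hv hw =>
    simp only [map_add, smul_add, hv, hw]
    abel
  | single l u =>
    rw [expMode_single, expMode_single, Finsupp.smul_single]
    induction p using int_cases' with
    | neg k =>
      rw [bosonLM_neg, bosonLM_neg, expMode_single, ← Finsupp.single_add, LinearMap.map_smul,
        expOp_X_mul]
      congr 1
      have e : m + (-1 - (k : ℤ)) + 1 + intInner (α : Euc n) l =
          m + 1 + intInner (α : Euc n) l - (k + 1) := by ring
      have h : (k.factorial : ℂ) ≠ 0 := Nat.cast_ne_zero.2 k.factorial_ne_zero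
      have h' : (k.factorial : ℂ)⁻¹ * ((α : Euc n) i * (k.factorial : ℂ)) = (α : Euc n) i := by
        field_simp
      rw [e, smul_sub, smul_smul _ _ (expOp _ _ _), h', smul_sub, mul_smul_comm]
      module
    | zero =>
      rw [bosonLM_zero, bosonLM_zero, expMode_single, ← Finsupp.single_add, LinearMap.map_smul,
        add_zero]
      congr 1
      have : ((((l + α : Λ) : Euc n)) i : ℂ) = (l : Euc n) i + (α : Euc n) i := by simp
      rw [this]
      module
    | pos k =>
      rw [bosonLM_pos, bosonLM_pos, expMode_single, ← Finsupp.single_add, LinearMap.map_smul,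
        Derivation.map_smul, smul_comm, factorial_smul_pderiv_expOp]
      congr 1
      have e : m + ((k : ℤ) + 1) + 1 + intInner (α : Euc n) l =
          m + 1 + intInner (α : Euc n) l + (k + 1) := by ring
      rw [e]
      module

theorem isLocal_expF_bosonF (α : Λ) (i : Fin n) : IsLocal 1 (expF κ α) (bosonF Λ i) := by
  -- The commutator depends on the mode indices only through their sum, so one factor z - w
  -- suffices.
  refine ⟨1, fun v => funext fun p => ?_⟩
  obtain ⟨m, k⟩ := p
  have h : superComm 1 (expF κ α) (bosonF Λ i) v = fun p =>
      (-((α : Euc n) i : ℂ)) • expMode κ α (p.1 + p.2) v := by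
    funext p
    rw [superComm, one_smul]
    change expMode κ α p.1 (bosonLM Λ i p.2 v) - bosonLM Λ i p.2 (expMode κ α p.1 v) = _
    rw [bosonLM_expMode]
    module
  rw [h, pow_one, diffOp_apply]
  have e : (m, k).1 + 1 + ((m, k).2 + 0) = (m, k).1 + 0 + ((m, k).2 + 1) := by ring
  simp only [Prod.fst_add, Prod.snd_add]
  rw [e, sub_self, Pi.zero_apply]

theorem dPhi_mul_eq (l α : Λ) (u : DiffPoly n) : Finsupp.single l (dPhi (α : Euc n) * u) =
    ∑ i, ((α : Euc n) i : ℂ) • bosonLM Λ i (-1) (Finsupp.single l u) := by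
  have h : ∀ i, bosonLM Λ i (-1) (Finsupp.single l u) = Finsupp.single l (X (i, 0) * u) := by
    intro i
    have := bosonLM_neg i 0 l u
    simpa using this
  simp only [h, Finsupp.smul_single]
  rw [← Finsupp.single_finsetSum, dPhi, Finset.sum_mul]
  simp only [smul_mul_assoc, ← smul_eq_C_mul]

/-- Commuting `Y(e^{φ_α})` with multiplication by `∂φ_β`. -/
theorem expMode_dPhi_mul (hΛ : IsIntegralLattice Λ) (α β l : Λ) (m : ℤ) (u : DiffPoly n) :
    expMode κ α m (Finsupp.single l (dPhi (β : Euc n) * u)) =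
      Finsupp.single (l + α) (dPhi (β : Euc n) * ((κ l α : ℂ) •
        expOp (α : Euc n) (m + 1 + intInner (α : Euc n) l) u)) -
      (intInner (α : Euc n) β : ℂ) • expMode κ α (m - 1) (Finsupp.single l u) := by
  have h : ∀ i, expMode κ α m (bosonLM Λ i (-1) (Finsupp.single l u)) =
      bosonLM Λ i (-1) (expMode κ α m (Finsupp.single l u)) -
        ((α : Euc n) i : ℂ) • expMode κ α (m - 1) (Finsupp.single l u) := fun i => by
    rw [bosonLM_expMode, ← sub_eq_add_neg, add_sub_cancel_right]
  rw [dPhi_mul_eq, map_sum, dPhi_mul_eq, ← expMode_single, ← hΛ.complex_sum, Finset.sum_smul,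
    ← Finset.sum_sub_distrib]
  refine Finset.sum_congr rfl fun i _ => ?_
  rw [map_smul, h, smul_sub, smul_smul, mul_comm]

theorem expF_covariant (hΛ : IsIntegralLattice Λ) (α : Λ) : IsCovariant (latticeT Λ) (expF κ α) := by
  -- The defect of covariance. On exponentials it vanishes by the recursion for the P_j; since the
  -- bosons are covariant, commuting it with a boson mode only produces a defect at a shifted index.
  let A : ℤ → Module.End ℂ (LatticeSpace Λ) := fun m =>
    latticeT Λ * expMode κ α m - expMode κ α m * latticeT Λ + (m : ℂ) • expMode κ α (m - 1)
  have hA : ∀ m, A m = 0 := by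
    refine eq_zero_of_exp (fun m l => ?_) fun i k m v hv => ?_
    · simp only [A, LinearMap.add_apply, LinearMap.sub_apply, Module.End.mul_apply,
        LinearMap.smul_apply]
      rw [latticeT_single, Derivation.map_one_eq_zero, zero_add, expMode_dPhi_mul hΛ, expOp_one,
        expMode_exp, latticeT_single, expMode_exp, Finsupp.smul_single, Finsupp.smul_single,
        ← Finsupp.single_sub, ← Finsupp.single_sub, ← Finsupp.single_add,
        ← Finsupp.single_zero (l + α)]
      congr 1
      have e1 : (-(m + 1 + intInner (α : Euc n) l)) = -m - 1 - intInner (α : Euc n) l := by ring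
      have e2 : (-(m - 1) - 1 - intInner (α : Euc n) l) =
        (-m - 1 - intInner (α : Euc n) l) + 1 := by ring
      have h := expCoeffInt_add_one (α : Euc n) (-m - 1 - intInner (α : Euc n) l)
      rw [e1, e2, Derivation.map_smul, AddSubgroup.coe_add, dPhi_add, add_mul, mul_smul_comm,
        mul_smul_comm]
      rw [← sub_eq_iff_eq_add] at h
      rw [← h]
      push_cast
      module
    · simp only [A, LinearMap.add_apply, LinearMap.sub_apply, Module.End.mul_apply,
        LinearMap.smul_apply] at hv ⊢
      set p : ℤ := -1 - k with hp
      have hT : ∀ w, latticeT Λ (bosonLM Λ i p w) = bosonLM Λ i p (latticeT Λ w) -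
          (p : ℂ) • bosonLM Λ i (p - 1) w := fun w => by
        have := bosonF_covariant i p w
        change latticeT Λ (bosonLM Λ i p w) - bosonLM Λ i p (latticeT Λ w) =
          (-(p : ℂ)) • bosonLM Λ i (p - 1) w at this
        rw [sub_eq_iff_eq_add] at this
        rw [this]
        module
      have hE : ∀ q m w, expMode κ α m (bosonLM Λ i q w) = bosonLM Λ i q (expMode κ α m w) -
        ((α : Euc n) i : ℂ) • expMode κ α (m + q) w := fun q m w => by
          rw [bosonLM_expMode, add_sub_cancel_right]
      have h1 := congrArg (bosonLM Λ i p) (hv m)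
      have h2 := congrArg (((α : Euc n) i : ℂ) • ·) (hv (m + p))
      simp only [map_add, map_sub, map_smul, map_zero, smul_zero] at h1 h2
      rw [hE, hT, map_sub, map_sub, hT, map_smul, map_smul, hE, hE, hE]
      have e1 : m + p - 1 = m + (p - 1) := by ring
      have e2 : m - 1 + p = m + (p - 1) := by ring
      rw [e1] at h2
      rw [e2]
      have h3 := congrArg₂ (· - ·) h1 h2
      simp only [sub_zero] at h3
      rw [← h3]
      push_cast
      module
  intro m v
  have := LinearMap.congr_fun (hA m) v
  simp only [A, LinearMap.add_apply, LinearMap.sub_apply, Module.End.mul_apply,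
    LinearMap.smul_apply, LinearMap.zero_apply] at this
  change latticeT Λ (expMode κ α m v) - expMode κ α m (latticeT Λ v) =
    (-(m : ℂ)) • expMode κ α (m - 1) v
  rw [eq_neg_of_add_eq_zero_left this, neg_smul]

end Exponential

/-! ### Mutual locality of exponential fields -/

section ExponentialLocality

open MvPolynomial

variable {n : ℕ} {Λ : AddSubgroup (Euc n)} {κ : Λ → Λ → ℂˣ}

/-- The coefficients of `(1 - x)^a`. -/
def binCoeff (a : ℤ) (s : ℕ) : ℂ := (-1) ^ s * (Ring.choose a s : ℤ)

theorem binCoeff_zero_right (a : ℤ) : binCoeff a 0 = 1 := by simp [binCoeff]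

theorem binCoeff_pascal (a : ℤ) (s : ℕ) :
    binCoeff (a + 1) (s + 1) = binCoeff a (s + 1) - binCoeff a s := by
  rw [binCoeff, Ring.choose_succ_succ, binCoeff, binCoeff]
  push_cast
  ring

theorem binCoeff_succ (a : ℤ) (s : ℕ) :
    (s + 1 : ℂ) * binCoeff a (s + 1) = (s - a) * binCoeff a s := by
  have h := Ring.choose_smul_choose a (Nat.le_succ s)
  rw [Nat.choose_succ_self_right, Nat.succ_eq_add_one, Nat.add_sub_cancel_left,
    Ring.choose_one_right] at h
  have h2 : ((s + 1 : ℕ) : ℂ) * (Ring.choose a (s + 1) : ℤ) =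
      (Ring.choose a s : ℤ) * ((a - s : ℤ) : ℂ) := by
    have := congrArg (fun t : ℤ => (t : ℂ)) h
    simpa using this
  rw [binCoeff, binCoeff, pow_succ]
  push_cast at h2
  linear_combination (-1) ^ s * (-1) * h2

theorem binCoeff_natCast (D s : ℕ) : binCoeff D s = (-1) ^ s * (D.choose s : ℂ) := by
  rw [binCoeff, Ring.choose_natCast]
  simp

theorem binCoeff_neg_one (s : ℕ) : binCoeff (-1) s = 1 := by
  induction s with
  | zero => exact binCoeff_zero_right _
  | succ s ih =>
    have h := binCoeff_succ (-1) s
    have h1 : ((s : ℂ) + 1) ≠ 0 := Nat.cast_add_one_ne_zero s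
    rw [ih] at h
    push_cast at h
    apply mul_left_cancel₀ h1
    rw [h]
    ring

/-- The coefficients of `(1 - w/z)^a` times the product of two exponentials. -/
def expProd (α β : Euc n) (a p q : ℤ) : DiffPoly n :=
  ∑ s ∈ Finset.range (q + 1).toNat,
    binCoeff a s • (expCoeffInt α (p - a + s) * expCoeffInt β (q - s))

theorem expProd_eq_sum (α β : Euc n) (a p q : ℤ) {L : ℕ} (hL : (q + 1).toNat ≤ L) :
    expProd α β a p q = ∑ s ∈ Finset.range L,
      binCoeff a s • (expCoeffInt α (p - a + s) * expCoeffInt β (q - s)) := by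
  refine Finset.sum_subset (Finset.range_subset_range.2 hL) fun s _ hs => ?_
  rw [Finset.mem_range, not_lt] at hs
  rw [expCoeffInt_of_neg β (by omega), mul_zero, smul_zero]

/-- `expProd α β a p q` is the coefficient of z^p w^q in (z - w)^a times the two exponential series,
expanded for |z| > |w|. Multiplication by z - w raises the exponent, which is Pascal's rule for
`binCoeff`. -/
theorem expProd_sub (α β : Euc n) (a p q : ℤ) :
    expProd α β a (p - 1) q - expProd α β a p (q - 1) = expProd α β (a + 1) p q := by
  set L := (q + 1).toNat with hL
  rw [expProd_eq_sum α β a (p - 1) q (L := L + 1) (by omega),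
    expProd_eq_sum α β a p (q - 1) (L := L) (by omega),
    expProd_eq_sum α β (a + 1) p q (L := L + 1) (by omega), Finset.sum_range_succ',
    Finset.sum_range_succ', add_sub_right_comm, ← Finset.sum_sub_distrib]
  congr 1
  · refine Finset.sum_congr rfl fun s _ => ?_
    rw [binCoeff_pascal]
    have e1 : p - 1 - a + ((s + 1 : ℕ) : ℤ) = p - a + s := by push_cast; ring
    have e2 : q - ((s + 1 : ℕ) : ℤ) = q - 1 - s := by push_cast; ring
    have e3 : p - (a + 1) + ((s + 1 : ℕ) : ℤ) = p - a + s := by push_cast; ring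
    rw [e1, e2, e3, sub_smul]
  · rw [binCoeff_zero_right, binCoeff_zero_right]
    congr 3
    ring

/-- For a non-negative exponent (z - w)^D is a polynomial, so its expansion does not depend on the
region, and exchanging z and w costs (-1)^D. Locality of exponentials comes from this. -/
theorem expProd_symm (α β : Euc n) (D : ℕ) (p q : ℤ) :
    expProd α β D p q = (-1 : ℂ) ^ D • expProd β α D q p := by
  have h : ∀ (α β : Euc n) (p q : ℤ), expProd α β D p q = ∑ s ∈ Finset.range (D + 1),
      binCoeff D s • (expCoeffInt α (p - D + s) * expCoeffInt β (q - s)) := by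
    intro α β p q
    rw [expProd_eq_sum α β D p q (le_max_left _ (D + 1))]
    symm
    refine Finset.sum_subset (Finset.range_subset_range.2 (le_max_right _ _)) fun s _ hs => ?_
    rw [Finset.mem_range, not_lt] at hs
    rw [binCoeff_natCast, Nat.choose_eq_zero_of_lt (by omega)]
    simp
  rw [h, h, ← Finset.sum_range_reflect, Finset.smul_sum]
  refine Finset.sum_congr rfl fun s hs => ?_
  have hs' : s ≤ D := by simpa [Nat.lt_succ_iff] using hs
  have e0 : D + 1 - 1 - s = D - s := by omega
  rw [e0, binCoeff_natCast, binCoeff_natCast, Nat.choose_symm hs', smul_smul, mul_comm (expCoeffInt α _)]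
  have e1 : q - ((D - s : ℕ) : ℤ) = q - D + s := by push_cast [Nat.cast_sub hs']; ring
  have e2 : p - D + ((D - s : ℕ) : ℤ) = p - s := by push_cast [Nat.cast_sub hs']; ring
  have e3 : (-1 : ℂ) ^ (D - s) = (-1) ^ D * (-1) ^ s := by
    have : (-1 : ℂ) ^ D = (-1) ^ (D - s) * (-1) ^ s := by rw [← pow_add, Nat.sub_add_cancel hs']
    rw [this, mul_assoc, ← mul_pow]
    simp
  rw [e1, e2, e3, mul_assoc]

/-- The operator ∂_z + ∂_w annihilates (z - w)^a, and on the product of the exponential series it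
acts as ∂ + ∂φ_{α+β}. Comparing coefficients of z^p w^q gives the recursion. -/
theorem expProd_succ (α β : Euc n) (a p q : ℤ) :
    ((q + 1 : ℤ) : ℂ) • expProd α β a p (q + 1) =
      diffPolyDeriv n (expProd α β a p q) + dPhi (α + β) * expProd α β a p q -
        ((p + 1 : ℤ) : ℂ) • expProd α β a (p + 1) q := by
  set L := (q + 2).toNat with hL
  rw [expProd_eq_sum α β a p (q + 1) (L := L + 1) (by omega),
    expProd_eq_sum α β a p q (L := L) (by omega),
    expProd_eq_sum α β a (p + 1) q (L := L) (by omega), map_sum, Finset.mul_sum, Finset.smul_sum,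
    Finset.smul_sum, ← Finset.sum_add_distrib, ← Finset.sum_sub_distrib]
  have h1 : ∀ s : ℕ, diffPolyDeriv n (binCoeff a s •
        (expCoeffInt α (p - a + s) * expCoeffInt β (q - s))) +
      dPhi (α + β) * binCoeff a s • (expCoeffInt α (p - a + s) * expCoeffInt β (q - s)) -
      ((p + 1 : ℤ) : ℂ) • binCoeff a s • (expCoeffInt α (p + 1 - a + s) * expCoeffInt β (q - s)) =
      ((s : ℂ) + 1) • binCoeff a (s + 1) •
        (expCoeffInt α (p - a + ((s + 1 : ℕ) : ℤ)) * expCoeffInt β (q + 1 - ((s + 1 : ℕ) : ℤ))) +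
      ((q + 1 - s : ℤ) : ℂ) • binCoeff a s •
        (expCoeffInt α (p - a + s) * expCoeffInt β (q + 1 - s)) := by
    intro s
    have r1 := expCoeffInt_add_one α (p - a + s)
    have r2 := expCoeffInt_add_one β (q - s)
    have e1 : p + 1 - a + (s : ℤ) = p - a + s + 1 := by ring
    have e2 : p - a + ((s + 1 : ℕ) : ℤ) = p - a + s + 1 := by push_cast; ring
    have e3 : q + 1 - ((s + 1 : ℕ) : ℤ) = q - s := by push_cast; ring
    have e4 : q + 1 - (s : ℤ) = q - s + 1 := by ring
    rw [e1, e2, e3, e4, smul_smul ((s : ℂ) + 1), binCoeff_succ, Derivation.map_smul,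
      Derivation.leibniz, dPhi_add]
    have r3 : diffPolyDeriv n (expCoeffInt α (p - a + s)) =
      ((p - a + s + 1 : ℤ) : ℂ) • expCoeffInt α (p - a + s + 1) -
        dPhi α * expCoeffInt α (p - a + s) := by rw [r1]; ring
    have r4 : diffPolyDeriv n (expCoeffInt β (q - s)) =
      ((q - s + 1 : ℤ) : ℂ) • expCoeffInt β (q - s + 1) -
        dPhi β * expCoeffInt β (q - s) := by rw [r2]; ring
    rw [r3, r4]
    simp only [smul_eq_mul, mul_smul_comm, mul_sub, smul_sub, add_mul, smul_add]
    push_cast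
    rw [mul_comm (expCoeffInt β _) (expCoeffInt α _)]
    have c1 : expCoeffInt α (p - a + s) * (dPhi β * expCoeffInt β (q - s)) =
      dPhi β * (expCoeffInt α (p - a + s) * expCoeffInt β (q - s)) := by ring
    have c2 : expCoeffInt β (q - s) * (dPhi α * expCoeffInt α (p - a + s)) =
      dPhi α * (expCoeffInt α (p - a + s) * expCoeffInt β (q - s)) := by ring
    rw [c1, c2]
    module
  simp only [h1]
  rw [Finset.sum_add_distrib]
  have h2 : ∑ s ∈ Finset.range L, ((s : ℂ) + 1) • binCoeff a (s + 1) •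
        (expCoeffInt α (p - a + ((s + 1 : ℕ) : ℤ)) * expCoeffInt β (q + 1 - ((s + 1 : ℕ) : ℤ))) =
      ∑ s ∈ Finset.range (L + 1), (s : ℂ) • binCoeff a s •
        (expCoeffInt α (p - a + s) * expCoeffInt β (q + 1 - s)) := by
    rw [Finset.sum_range_succ' _ L]
    simp
  have h3 : ∑ s ∈ Finset.range L, ((q + 1 - s : ℤ) : ℂ) • binCoeff a s •
        (expCoeffInt α (p - a + s) * expCoeffInt β (q + 1 - s)) =
      ∑ s ∈ Finset.range (L + 1), ((q + 1 - s : ℤ) : ℂ) • binCoeff a s •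
        (expCoeffInt α (p - a + s) * expCoeffInt β (q + 1 - s)) := by
    rw [Finset.sum_range_succ _ L, expCoeffInt_of_neg β (j := q + 1 - L) (by omega), mul_zero,
      smul_zero, smul_zero, add_zero]
  rw [h2, h3, ← Finset.sum_add_distrib]
  refine Finset.sum_congr rfl fun s _ => ?_
  rw [← add_smul]
  congr 1
  push_cast
  ring

/-- Gives the product of two exponential modes on `e^{φ_l}`. Covariance moves `T` past the mode of
`e^{φ_α}` and thereby raises `q`; `expProd_succ` is the matching recursion on the right. -/
theorem expMode_expCoeffInt (hΛ : IsIntegralLattice Λ) (α β l : Λ) (m q : ℤ) :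
    expMode κ α m (Finsupp.single (l + β) (expCoeffInt (β : Euc n) q)) =
      Finsupp.single (l + β + α) ((κ (l + β) α : ℂ) • expProd (α : Euc n) β
        (intInner (α : Euc n) β) (-m - 1 - intInner (α : Euc n) l) q) := by
  rcases lt_or_ge q 0 with h | h
  · rw [expCoeffInt_of_neg _ h, Finsupp.single_zero, map_zero, expProd, Int.toNat_of_nonpos (by omega)]
    simp
  lift q to ℕ using h
  induction q generalizing m with
  | zero =>
    rw [Nat.cast_zero, expCoeffInt_zero, expMode_exp, expProd]
    congr 2
    simp only [zero_add, Int.toNat_one, Finset.sum_range_one, binCoeff_zero_right, one_smul,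
      Nat.cast_zero, add_zero, sub_zero, expCoeffInt_zero, mul_one]
    rw [hΛ.add_right]
    congr 1
    ring
  | succ q ih =>
    have h1 : ((q : ℂ) + 1) ≠ 0 := Nat.cast_add_one_ne_zero q
    refine smul_right_injective _ h1 ?_
    beta_reduce
    have hq := expCoeffInt_add_one (β : Euc n) q
    -- On momentum `l + β` the operator `T` involves `dPhi (l + β)`, whereas the recursion for `β`
    -- needs only `dPhi β`; hence the correction by `dPhi l`.
    have hT : ((q : ℂ) + 1) • (Finsupp.single (l + β) (expCoeffInt (β : Euc n) ((q + 1 : ℕ) : ℤ)) :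
        LatticeSpace Λ) = latticeT Λ (Finsupp.single (l + β) (expCoeffInt (β : Euc n) q)) -
          Finsupp.single (l + β) (dPhi (l : Euc n) * expCoeffInt (β : Euc n) q) := by
      rw [latticeT_single, ← Finsupp.single_sub, Finsupp.smul_single]
      congr 1
      rw [AddSubgroup.coe_add, dPhi_add]
      push_cast at hq ⊢
      rw [hq]
      ring
    have hc := expF_covariant (κ := κ) hΛ α m (Finsupp.single (l + β) (expCoeffInt (β : Euc n) q))
    change latticeT Λ (expMode κ α m _) - expMode κ α m (latticeT Λ _) =
      (-(m : ℂ)) • expMode κ α (m - 1) _ at hc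
    rw [sub_eq_iff_eq_add, ← sub_eq_iff_eq_add'] at hc
    have hd := expMode_dPhi_mul (κ := κ) hΛ α l (l + β) m (expCoeffInt (β : Euc n) q)
    have hs := expMode_single (κ := κ) α (l + β) m (expCoeffInt (β : Euc n) q)
    rw [ih] at hs
    rw [← map_smul, hT, map_sub, ← hc, hd, ih, ih, latticeT_single]
    rw [← Finsupp.single_injective _ hs]
    simp only [Finsupp.smul_single]
    rw [← Finsupp.single_sub, ← Finsupp.single_sub, ← Finsupp.single_sub]
    congr 1
    have e : -(m - 1) - 1 - intInner (α : Euc n) l = -m - 1 - intInner (α : Euc n) l + 1 := by ring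
    rw [e]
    have hp := expProd_succ (α : Euc n) β (intInner (α : Euc n) β)
      (-m - 1 - intInner (α : Euc n) l) q
    push_cast at hp ⊢
    rw [smul_comm ((q : ℂ) + 1), hp, dPhi_add, dPhi_add, dPhi_add, Derivation.map_smul]
    simp only [add_mul, mul_smul_comm]
    module

theorem diffOp_pow_linear {G W : Type*} [AddCommGroup G] [AddCommGroup W] [Module ℂ W]
    (g h : G) (N : ℕ) (f : G → W) (L : Module.End ℂ W) (p : G) :
    (diffOp W g h ^ N) (fun p => L (f p)) p = L ((diffOp W g h ^ N) f p) := by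
  simp [diffOp_pow_apply, map_sum, -nsmul_eq_mul]

/-- Difference operators commute with shifts and with applying a fixed operator. So if a power of z
- w kills the supercommutator on `v`, this formula shows that it does so on `bosonLM Λ i r v`. -/
theorem superComm_bosonLM (ε : ℂ) (α β : Λ) (i : Fin n) (r : ℤ) (v : LatticeSpace Λ) :
    superComm ε (expF κ α) (expF κ β) (bosonLM Λ i r v) =
      (fun p => bosonLM Λ i r (superComm ε (expF κ α) (expF κ β) v p)) -
      ((α : Euc n) i : ℂ) • shiftOp _ (r, 0) (superComm ε (expF κ α) (expF κ β) v) -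
      ((β : Euc n) i : ℂ) • shiftOp _ (0, r) (superComm ε (expF κ α) (expF κ β) v) := by
  funext ⟨m, k⟩
  have hE : ∀ (α : Λ) q m w, expMode κ α m (bosonLM Λ i q w) =
      bosonLM Λ i q (expMode κ α m w) - ((α : Euc n) i : ℂ) • expMode κ α (m + q) w :=
    fun α q m w => by rw [bosonLM_expMode, add_sub_cancel_right]
  simp only [superComm, Pi.sub_apply, Pi.smul_apply, shiftOp_apply, Prod.mk_add_mk, add_zero]
  change expMode κ α m (expMode κ β k _) - ε • expMode κ β k (expMode κ α m _) =
    bosonLM Λ i r (expMode κ α m (expMode κ β k v) - ε • expMode κ β k (expMode κ α m v)) -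
    ((α : Euc n) i : ℂ) • (expMode κ α (m + r) (expMode κ β k v) -
      ε • expMode κ β k (expMode κ α (m + r) v)) -
    ((β : Euc n) i : ℂ) • (expMode κ α m (expMode κ β (k + r) v) -
      ε • expMode κ β (k + r) (expMode κ α m v))
  rw [hE, hE, map_sub, map_sub, hE, hE, map_sub, map_smul, map_smul, map_smul]
  module

theorem superComm_exp (hΛ : IsIntegralLattice Λ) (ε : ℂ) (α β l : Λ) (p : ℤ × ℤ) :
    superComm ε (expF κ α) (expF κ β) (Finsupp.single l 1) p =
      Finsupp.single (l + β + α) (((κ l β * κ (l + β) α : ℂˣ) : ℂ) •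
        expProd (α : Euc n) β (intInner (α : Euc n) β) (-p.1 - 1 - intInner (α : Euc n) l)
          (-p.2 - 1 - intInner (β : Euc n) l) -
        (ε * ((κ l α * κ (l + α) β : ℂˣ) : ℂ)) •
        expProd (β : Euc n) α (intInner (α : Euc n) β) (-p.2 - 1 - intInner (β : Euc n) l)
          (-p.1 - 1 - intInner (α : Euc n) l)) := by
  change expMode κ α p.1 (expMode κ β p.2 _) - ε • expMode κ β p.2 (expMode κ α p.1 _) = _
  rw [expMode_exp, expMode_exp, ← Finsupp.smul_single, ← Finsupp.smul_single, map_smul, map_smul,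
    expMode_expCoeffInt hΛ, expMode_expCoeffInt hΛ, add_right_comm l α β, Finsupp.smul_single,
    Finsupp.smul_single, Finsupp.smul_single, ← Finsupp.single_sub, intInner_comm (β : Euc n) α]
  congr 1
  simp only [Units.val_mul, smul_smul]

theorem neg_one_zpow_eq (z : ℤ) : (-1 : ℂ) ^ z = if (z : ZMod 2) = 0 then 1 else -1 := by
  have h : (z : ZMod 2) = 0 ↔ Even z := by
    rw [even_iff_two_dvd]
    exact ZMod.intCast_zmod_eq_zero_iff_dvd z 2
  split_ifs with h'
  · exact (h.1 h').neg_one_zpow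
  · exact (Int.not_even_iff_odd.1 fun h2 => h' (h.2 h2)).neg_one_zpow

/-- The parity of `e^{φ_α}`. -/
def normPar (α : Λ) : ZMod 2 := (intInner (α : Euc n) α : ℤ)

/-- The cocycle identity extracts the common factor κ(l, α + β) from both products and leaves the
comparison of κ(β, α) with κ(α, β). -/
theorem cocycle_exchange (hκ : IsLatticeCocycle κ) (α β l : Λ) :
    ((κ l β * κ (l + β) α : ℂˣ) : ℂ) = superSign (normPar α) (normPar β) *
      (-1) ^ intInner (α : Euc n) β * ((κ l α * κ (l + α) β : ℂˣ) : ℂ) := by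
  rw [hκ.cocycle, hκ.cocycle, hκ.commutator β α, add_comm β α]
  have h : ((-1 : ℂˣ) : ℂ) = -1 := by simp
  rw [Units.val_mul, Units.val_mul, Units.val_mul, Units.val_zpow_eq_zpow_val, h,
    zpow_add₀ (by norm_num), neg_one_zpow_eq (_ * _), superSign, normPar, normPar,
    intInner_comm (β : Euc n) α]
  push_cast
  rw [mul_comm ((intInner (β : Euc n) β : ℤ) : ZMod 2)]
  ring

theorem diffOp_pow_superComm_exp (hΛ : IsIntegralLattice Λ) (hκ : IsLatticeCocycle κ) (α β l : Λ)
    (N : ℕ) (hN : 0 ≤ intInner (α : Euc n) β + N) :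
    (diffOp (LatticeSpace Λ) ((1, 0) : ℤ × ℤ) (0, 1) ^ N) (superComm (superSign (normPar α) (normPar β))
      (expF κ α) (expF κ β) (Finsupp.single l 1)) = 0 := by
  set a := intInner (α : Euc n) β with ha
  set ε := superSign (normPar α) (normPar β) with hε
  let P : ℤ × ℤ → ℤ := fun p => -p.1 - 1 - intInner (α : Euc n) l
  let Q : ℤ × ℤ → ℤ := fun p => -p.2 - 1 - intInner (β : Euc n) l
  -- The closed form of (z - w)^M times the supercommutator: each factor raises the exponent (α, β)
  -- by one. The second term is written with z and w exchanged, which accounts for `(-1) ^ M`. Once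
  -- the exponent is non-negative, `expProd_symm` and `cocycle_exchange` make the two terms cancel.
  let S : ℕ → ℤ × ℤ → LatticeSpace Λ := fun M p =>
    Finsupp.single (l + β + α) (((κ l β * κ (l + β) α : ℂˣ) : ℂ) •
        expProd (α : Euc n) β (a + M) (P p) (Q p) -
        (ε * (-1) ^ M * ((κ l α * κ (l + α) β : ℂˣ) : ℂ)) •
        expProd (β : Euc n) α (a + M) (Q p) (P p))
  have hS : ∀ M, (diffOp (LatticeSpace Λ) ((1, 0) : ℤ × ℤ) (0, 1) ^ M) (superComm ε
      (expF κ α) (expF κ β) (Finsupp.single l 1)) = S M := by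
    intro M
    induction M with
    | zero =>
      funext p
      rw [pow_zero, Module.End.one_apply, superComm_exp hΛ]
      simp [S, P, Q, ha]
    | succ M ih =>
      rw [pow_succ', Module.End.mul_apply, ih]
      funext ⟨m, k⟩
      rw [diffOp_apply]
      simp only [S]
      rw [← Finsupp.single_sub]
      congr 1
      have p1 : P ((m, k) + (1, 0)) = P (m, k) - 1 := by simp [P]; ring
      have p2 : P ((m, k) + (0, 1)) = P (m, k) := by simp [P]
      have q1 : Q ((m, k) + (1, 0)) = Q (m, k) := by simp [Q]
      have q2 : Q ((m, k) + (0, 1)) = Q (m, k) - 1 := by simp [Q]; ring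
      have e : a + ((M + 1 : ℕ) : ℤ) = a + M + 1 := by push_cast; ring
      rw [p1, p2, q1, q2, e, ← expProd_sub, ← expProd_sub, pow_succ]
      module
  rw [hS]
  funext p
  simp only [S]
  obtain ⟨D, hD⟩ := Int.eq_ofNat_of_zero_le hN
  have hs : (-1 : ℂ) ^ a = (-1) ^ N * (-1) ^ D := by
    have : a = D - N := by omega
    rw [this, zpow_sub₀ (by norm_num), zpow_natCast, zpow_natCast, div_eq_mul_inv, ← inv_pow,
      mul_comm]
    norm_num
  rw [hD, expProd_symm _ _ D (P p), cocycle_exchange hκ, ← hε, ← ha, hs, smul_smul, ← sub_smul]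
  have hD2 : (-1 : ℂ) ^ D * (-1) ^ D = 1 := by rw [← mul_pow]; simp
  have : ε * ((-1) ^ N * (-1) ^ D) * ((κ l α * κ (l + α) β : ℂˣ) : ℂ) * (-1) ^ D -
      ε * (-1) ^ N * ((κ l α * κ (l + α) β : ℂˣ) : ℂ) = 0 := by
    linear_combination ε * (-1) ^ N * ((κ l α * κ (l + α) β : ℂˣ) : ℂ) * hD2
  rw [this, zero_smul, Finsupp.single_zero, Pi.zero_apply]

/-- The supercommutator as a linear map. -/
def superCommL {V : Type*} [AddCommGroup V] [Module ℂ V] (ε : ℂ) (A B : FieldOn V) :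
    V →ₗ[ℂ] (ℤ × ℤ → V) where
  toFun := superComm ε A B
  map_add' v w := by
    funext p
    simp only [superComm, map_add, smul_add, Pi.add_apply]
    abel
  map_smul' c v := by
    funext p
    simp only [superComm, map_smul, Pi.smul_apply, RingHom.id_apply, smul_sub]
    rw [smul_comm c ε]

theorem diffOp_pow_superComm_expF (hΛ : IsIntegralLattice Λ) (hκ : IsLatticeCocycle κ) (α β : Λ)
    (N : ℕ) (hN : 0 ≤ intInner (α : Euc n) β + N) (v : LatticeSpace Λ) :
    (diffOp (LatticeSpace Λ) ((1, 0) : ℤ × ℤ) (0, 1) ^ N)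
      (superComm (superSign (normPar α) (normPar β)) (expF κ α) (expF κ β) v) = 0 := by
  set ε := superSign (normPar α) (normPar β) with hε
  let A : ℤ × ℤ → Module.End ℂ (LatticeSpace Λ) := fun p => LinearMap.proj p ∘ₗ
    (diffOp (LatticeSpace Λ) ((1, 0) : ℤ × ℤ) (0, 1) ^ N) ∘ₗ superCommL ε (expF κ α) (expF κ β)
  have hAv : ∀ p v, A p v = (diffOp (LatticeSpace Λ) ((1, 0) : ℤ × ℤ) (0, 1) ^ N)
      (superComm ε (expF κ α) (expF κ β) v) p := fun p v => rfl
  have hA : ∀ p, A p = 0 := by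
    refine eq_zero_of_exp (fun p l => ?_) fun i k p v hv => ?_
    · rw [hAv, diffOp_pow_superComm_exp hΛ hκ α β l N hN, Pi.zero_apply]
    · simp only [hAv] at hv ⊢
      have hv' := funext hv
      have hc : ∀ g : ℤ × ℤ, (diffOp (LatticeSpace Λ) ((1, 0) : ℤ × ℤ) (0, 1) ^ N)
          (shiftOp _ g (superComm ε (expF κ α) (expF κ β) v)) = 0 := by
        intro g
        have := (commute_diffOp_shiftOp (V := LatticeSpace Λ) ((1, 0) : ℤ × ℤ) (0, 1) g).pow_left N
        rw [← Module.End.mul_apply, this.eq, Module.End.mul_apply]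
        exact (congrArg _ hv').trans (map_zero _)
      rw [superComm_bosonLM, map_sub, map_sub, map_smul, map_smul, hc, hc, Pi.sub_apply,
        Pi.sub_apply, diffOp_pow_linear, hv, map_zero]
      simp
  funext p
  exact LinearMap.congr_fun (hA p) v

theorem isLocal_expF (hΛ : IsIntegralLattice Λ) (hκ : IsLatticeCocycle κ) (α β : Λ) :
    IsLocal (superSign (normPar α) (normPar β)) (expF κ α) (expF κ β) :=
  ⟨(-intInner (α : Euc n) β).toNat, diffOp_pow_superComm_expF hΛ hκ α β _ (by omega)⟩

/-- Exponentials with nonnegative inner product supercommute. -/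
theorem expMode_supercomm (hΛ : IsIntegralLattice Λ) (hκ : IsLatticeCocycle κ) (α β : Λ)
    (h : 0 ≤ intInner (α : Euc n) β) (m k : ℤ) (v : LatticeSpace Λ) :
    expMode κ α m (expMode κ β k v) =
      superSign (normPar α) (normPar β) • expMode κ β k (expMode κ α m v) := by
  have := congrFun (diffOp_pow_superComm_expF hΛ hκ α β 0 (by simpa using h) v) (m, k)
  rw [pow_zero, Module.End.one_apply] at this
  exact sub_eq_zero.1 this

end ExponentialLocality

/-! ## The vertex superalgebra of an integral lattice -/

section LatticeVertexAlgebra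

open MvPolynomial

variable {n : ℕ} {Λ : AddSubgroup (Euc n)} {κ : Λ → Λ → ℂˣ}

theorem IsLatticeCocycle.zero_right (hκ : IsLatticeCocycle κ) (l : Λ) : κ l 0 = 1 := by
  have := hκ.cocycle l 0 0
  rw [hκ.normalized, add_zero, add_zero, one_mul] at this
  exact mul_eq_right.1 this

theorem IsLatticeCocycle.zero_left (hκ : IsLatticeCocycle κ) (l : Λ) : κ 0 l = 1 := by
  have := hκ.cocycle 0 0 l
  rw [hκ.normalized, zero_add, zero_add, one_mul] at this
  exact mul_eq_left.1 this.symm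

theorem normPar_add (hΛ : IsIntegralLattice Λ) (α β : Λ) :
    normPar (α + β) = normPar α + normPar β := by
  rw [normPar, hΛ.add_left, hΛ.add_right, hΛ.add_right, intInner_comm (β : Euc n) α, normPar,
    normPar]
  push_cast
  have : ∀ a b c : ZMod 2, a + b + (b + c) = a + c := by decide
  exact this _ _ _

theorem expMode_mem_latticePar (hΛ : IsIntegralLattice Λ) (α : Λ) (m : ℤ) {q : ZMod 2}
    {v : LatticeSpace Λ} (hv : v ∈ latticePar Λ q) :
    expMode κ α m v ∈ latticePar Λ (normPar α + q) := by
  refine latticePar_map (fun l u hl => ?_) hv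
  rw [expMode_single]
  refine single_mem_latticePar ?_ _
  change normPar (l + α) = _
  rw [normPar_add hΛ, add_comm, ← hl]
  rfl

theorem expMode_vac (hΛ : IsIntegralLattice Λ) (hκ : IsLatticeCocycle κ) (α : Λ) (m : ℤ) :
    expMode κ α m (latticeVac Λ) = Finsupp.single α (expCoeffInt (α : Euc n) (-m - 1)) := by
  rw [latticeVac, expMode_exp, hκ.zero_left, hΛ.zero_right, zero_add, sub_zero, Units.val_one,
    one_smul]

theorem bosonLM_vac_of_nonneg (i : Fin n) (m : ℤ) (hm : 0 ≤ m) :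
    bosonLM Λ i m (latticeVac Λ) = 0 := by
  rw [latticeVac]
  rcases hm.eq_or_lt with rfl | hm
  · rw [bosonLM_zero]
    simp
  · obtain ⟨k, rfl⟩ : ∃ k : ℕ, m = k + 1 := ⟨(m - 1).toNat, by omega⟩
    rw [bosonLM_pos, pderiv_one, smul_zero, Finsupp.single_zero]

/-- The boson fields and the exponentials as generating fields. -/
def latticeGen (hΛ : IsIntegralLattice Λ) (hκ : IsLatticeCocycle κ) :
    GeneratingFields (LatticeSpace Λ) (Fin n ⊕ Λ) where
  vac := latticeVac Λ
  T := latticeT Λ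
  par := latticePar Λ
  gen := Sum.elim (bosonF Λ) (expF κ)
  deg := Sum.elim (fun _ => 0) normPar
  T_vac := by
    rw [latticeVac, latticeT_single]
    simp [dPhi_zero]
  vac_mem := single_mem_latticePar (by rw [hΛ.zero_left]; rfl) _
  span := by
    intro K h0 hK
    refine boson_closed_eq_top (fun l => ?_) fun i k v hv => hK (Sum.inl i) _ v hv
    have : expMode κ l (-1) (latticeVac Λ) ∈ K := hK (Sum.inr l) (-1) _ h0
    rw [expMode_vac hΛ hκ] at this
    exact this

theorem latticeGen_good (hΛ : IsIntegralLattice Λ) (hκ : IsLatticeCocycle κ) (x : Fin n ⊕ Λ) :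
    (latticeGen hΛ hκ).gen x ∈ (latticeGen hΛ hκ).good ((latticeGen hΛ hκ).deg x) := by
  rcases x with i | α
  · refine ⟨bosonF_covariant i, bosonLM_vac_of_nonneg i, fun m q v hv => ?_, fun y => ?_⟩
    · change bosonLM Λ i m v ∈ latticePar Λ (0 + q)
      rw [zero_add]
      exact bosonLM_mem_latticePar i m hv
    · change IsLocal (superSign 0 _) (bosonF Λ i) _
      rw [superSign_zero_left]
      rcases y with j | β
      · exact isLocal_bosonF i j
      · exact (isLocal_expF_bosonF β i).symm (one_mul 1)
  · refine ⟨expF_covariant hΛ α, fun m hm => ?_, fun m q v hv => expMode_mem_latticePar hΛ α m hv,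
      fun y => ?_⟩
    · change expMode κ α m (latticeVac Λ) = 0
      rw [expMode_vac hΛ hκ, expCoeffInt_of_neg _ (by omega), Finsupp.single_zero]
    · rcases y with j | β
      · change IsLocal (superSign _ 0) (expF κ α) (bosonF Λ j)
        rw [superSign_zero_right]
        exact isLocal_expF_bosonF α j
      · exact isLocal_expF hΛ hκ α β

theorem bosonF_mem_full (hΛ : IsIntegralLattice Λ) (hκ : IsLatticeCocycle κ) (i : Fin n) :
    bosonF Λ i ∈ (latticeGen hΛ hκ).full 0 :=
  GeneratingFields.gen_mem_full (latticeGen_good hΛ hκ) (Sum.inl i)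

theorem expF_mem_full (hΛ : IsIntegralLattice Λ) (hκ : IsLatticeCocycle κ) (α : Λ) :
    expF κ α ∈ (latticeGen hΛ hκ).full (normPar α) :=
  GeneratingFields.gen_mem_full (latticeGen_good hΛ hκ) (Sum.inr α)

/-- The field of a monomial times an exponential. -/
def monomialField (κ : Λ → Λ → ℂˣ) (α : Λ) (l : List (Fin n × ℕ)) : FieldOn (LatticeSpace Λ) :=
  l.foldr (fun s B => (s.2.factorial : ℂ) • nop 1 (divDer s.2 (bosonF Λ s.1)) B) (expF κ α)

theorem latticeMonomialMode_eq (α : Λ) (l : List (Fin n × ℕ)) :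
    latticeMonomialMode κ α l = fun m v => (monomialField κ α l).1 m v := by
  induction l with
  | nil => rfl
  | cons s l ih =>
    funext m v
    have h : (fun m v => (bosonF Λ s.1).1 m v) = bosonMode Λ s.1 :=
      funext fun m => funext fun v => bosonLM_apply s.1 m v
    change (s.2.factorial : ℂ) • normalOrder (bosonMode Λ s.1) 1 s.2 (latticeMonomialMode κ α l) m v
      = (s.2.factorial : ℂ) • (nop 1 (divDer s.2 (bosonF Λ s.1)) (monomialField κ α l)).1 m v
    rw [ih, ← h, normalOrder_eq_nop]

theorem monomialField_mem_full (hΛ : IsIntegralLattice Λ) (hκ : IsLatticeCocycle κ) (α : Λ)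
    (l : List (Fin n × ℕ)) : monomialField κ α l ∈ (latticeGen hΛ hκ).full (normPar α) := by
  induction l with
  | nil => exact expF_mem_full hΛ hκ α
  | cons s l ih =>
    refine Submodule.smul_mem _ _ ?_
    have := GeneratingFields.nop_mem_full
      (GeneratingFields.divDer_mem_full (bosonF_mem_full hΛ hκ s.1) s.2) ih
    rwa [superSign_zero_left, zero_add] at this

theorem monomialField_vac (hΛ : IsIntegralLattice Λ) (hκ : IsLatticeCocycle κ) (α : Λ)
    (l : List (Fin n × ℕ)) : (monomialField κ α l).1 (-1) (latticeVac Λ) =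
      Finsupp.single α ((l.map X).prod) := by
  induction l with
  | nil =>
    change expMode κ α (-1) (latticeVac Λ) = _
    rw [expMode_vac hΛ hκ]
    rfl
  | cons s l ih =>
    change (s.2.factorial : ℂ) • (nop 1 (divDer s.2 (bosonF Λ s.1)) (monomialField κ α l)).1 (-1)
      (latticeVac Λ) = _
    have h := GeneratingFields.nop_apply_vac (D := latticeGen hΛ hκ) 1
      (divDer s.2 (bosonF Λ s.1)) (GeneratingFields.divDer_mem_good
        (GeneratingFields.mem_full.1 (bosonF_mem_full hΛ hκ s.1)).1 s.2).2.1
        (GeneratingFields.mem_full.1 (monomialField_mem_full hΛ hκ α l)).1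
    change (nop 1 _ (monomialField κ α l)).1 (-1) (latticeVac Λ) = (divDer s.2 _).1 (-1)
      ((monomialField κ α l).1 (-1) (latticeVac Λ)) at h
    have h0 := divDer_apply_neg s.2 0 (bosonF Λ s.1) (Finsupp.single α ((l.map X).prod))
    simp only [Nat.cast_zero, sub_zero, add_zero, Nat.choose_zero_right, Nat.cast_one,
      one_smul] at h0
    rw [h, ih, h0]
    change (s.2.factorial : ℂ) • bosonLM Λ s.1 _ _ = _
    rw [show (-(s.2 : ℤ) - 1) = -1 - s.2 by ring, bosonLM_neg, Finsupp.smul_single, smul_smul,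
      mul_inv_cancel₀ (Nat.cast_ne_zero.2 s.2.factorial_ne_zero), one_smul, List.map_cons,
      List.prod_cons]

/-- The state-field correspondence of the lattice vertex superalgebra. -/
def latticeYField (κ : Λ → Λ → ℂˣ) : LatticeSpace Λ →ₗ[ℂ] FieldOn (LatticeSpace Λ) :=
  Finsupp.lsum ℂ fun α => (MvPolynomial.basisMonomials (Fin n × ℕ) ℂ).constr ℂ fun d =>
    monomialField κ α (Finsupp.toMultiset d).toList

theorem latticeYField_single (α : Λ) (u : DiffPoly n) :
    latticeYField κ (Finsupp.single α u) = ∑ d ∈ u.support,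
      coeff d u • monomialField κ α (Finsupp.toMultiset d).toList := by
  rw [latticeYField, Finsupp.lsum_single]
  conv_lhs => rw [← support_sum_monomial_coeff u]
  rw [map_sum]
  refine Finset.sum_congr rfl fun d _ => ?_
  have : monomial d (coeff d u) = coeff d u • basisMonomials (Fin n × ℕ) ℂ d := by
    rw [coe_basisMonomials, smul_monomial, smul_eq_mul, mul_one]
  rw [this, map_smul, Module.Basis.constr_basis]

theorem latticeYField_apply (a b : LatticeSpace Λ) (m : ℤ) :
    (latticeYField κ a).1 m b = latticeY κ a m b := by
  let E : FieldOn (LatticeSpace Λ) →ₗ[ℂ] LatticeSpace Λ :=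
    LinearMap.applyₗ b ∘ₗ LinearMap.proj m ∘ₗ (fieldModule (LatticeSpace Λ)).subtype
  have hE : ∀ A, E A = A.1 m b := fun A => rfl
  rw [← hE, latticeY]
  conv_lhs => rw [← Finsupp.sum_single a]
  rw [map_finsuppSum, map_finsuppSum]
  refine Finset.sum_congr rfl fun α _ => ?_
  beta_reduce
  rw [latticeYField_single, map_sum]
  refine Finset.sum_congr rfl fun d _ => ?_
  rw [map_smul, hE, latticeMonomialMode_eq]

theorem latticeYField_vac (hΛ : IsIntegralLattice Λ) (hκ : IsLatticeCocycle κ) (a : LatticeSpace Λ) :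
    (latticeYField κ a).1 (-1) (latticeVac Λ) = a := by
  let E : FieldOn (LatticeSpace Λ) →ₗ[ℂ] LatticeSpace Λ :=
    LinearMap.applyₗ (latticeVac Λ) ∘ₗ LinearMap.proj (-1) ∘ₗ (fieldModule (LatticeSpace Λ)).subtype
  have hE : ∀ A, E A = A.1 (-1) (latticeVac Λ) := fun A => rfl
  rw [← hE]
  induction a using Finsupp.induction_linear with
  | zero => simp
  | add a b ha hb => rw [map_add, map_add, ha, hb]
  | single α u =>
    rw [latticeYField_single, map_sum]
    conv_rhs => rw [← support_sum_monomial_coeff u, Finsupp.single_finsetSum]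
    refine Finset.sum_congr rfl fun d _ => ?_
    rw [map_smul, hE, monomialField_vac hΛ hκ, Finsupp.smul_single]
    congr 1
    have h : (((Finsupp.toMultiset d).toList.map X).prod : DiffPoly n) = monomial d 1 := by
      rw [← Multiset.prod_coe, ← Multiset.map_coe, Multiset.coe_toList, monomial_eq, map_one,
        one_mul, Finsupp.toMultiset_map, Finsupp.prod_toMultiset, Finsupp.prod_mapDomain_index]
      · simp
      · simp [pow_add]
    rw [h, smul_monomial, smul_eq_mul, mul_one]

theorem latticeYField_mem_full (hΛ : IsIntegralLattice Λ) (hκ : IsLatticeCocycle κ) {p : ZMod 2}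
    {a : LatticeSpace Λ} (ha : a ∈ latticePar Λ p) :
    latticeYField κ a ∈ (latticeGen hΛ hκ).full p := by
  rw [← Finsupp.sum_single a, map_finsuppSum]
  refine Submodule.sum_mem _ fun α hα => ?_
  beta_reduce
  rw [latticeYField_single]
  refine Submodule.sum_mem _ fun d _ => Submodule.smul_mem _ _ ?_
  have : normPar α = p := (Finsupp.mem_supported _ _).1 ha hα
  rw [← this]
  exact monomialField_mem_full hΛ hκ α _

/-- A field in the vertex superalgebra is determined by its state. -/
theorem eq_latticeYField (hΛ : IsIntegralLattice Λ) (hκ : IsLatticeCocycle κ) {p : ZMod 2}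
    {A : FieldOn (LatticeSpace Λ)} (hA : A ∈ (latticeGen hΛ hκ).good p)
    (ha : A.1 (-1) (latticeVac Λ) ∈ latticePar Λ p) :
    A = latticeYField κ (A.1 (-1) (latticeVac Λ)) :=
  GeneratingFields.good_ext hA (GeneratingFields.mem_full.1 (latticeYField_mem_full hΛ hκ ha)).1
    (latticeYField_vac hΛ hκ _).symm

theorem latticeYField_isLocal (hΛ : IsIntegralLattice Λ) (hκ : IsLatticeCocycle κ)
    {a b : LatticeSpace Λ} (ha : a ∈ latticePar Λ 0) (hb : b ∈ latticePar Λ 0) :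
    ∃ N : ℕ, ∀ (m k : ℤ) (c : LatticeSpace Λ),
      ∑ j ∈ Finset.range (N + 1), ((-1 : ℂ) ^ j * (N.choose j : ℂ)) •
        ((latticeYField κ a).1 (m + N - j) ((latticeYField κ b).1 (k + j) c) -
          (latticeYField κ b).1 (k + j) ((latticeYField κ a).1 (m + N - j) c)) = 0 := by
  obtain ⟨N, hN⟩ := (GeneratingFields.mem_full.1 (latticeYField_mem_full hΛ hκ ha)).2 0 _
    (GeneratingFields.mem_full.1 (latticeYField_mem_full hΛ hκ hb)).1
  refine ⟨N, fun m k c => ?_⟩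
  have := congrFun (hN c) (m, k)
  rw [diffOp_pow_apply_pair] at this
  simp only [superComm, superSign_zero_left, one_smul] at this
  exact this

theorem latticeYField_translation (hΛ : IsIntegralLattice Λ) (hκ : IsLatticeCocycle κ)
    {a : LatticeSpace Λ} (ha : a ∈ latticePar Λ 0) :
    (latticeYField κ a).1 (-2) (latticeVac Λ) = latticeT Λ a := by
  have := GeneratingFields.good_translation
    (GeneratingFields.mem_full.1 (latticeYField_mem_full hΛ hκ ha)).1
  change _ = latticeT Λ ((latticeYField κ a).1 (-1) (latticeVac Λ)) at this
  rw [latticeYField_vac hΛ hκ] at this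
  exact this

theorem latticeYField_latticeVac (hΛ : IsIntegralLattice Λ) (hκ : IsLatticeCocycle κ) :
    latticeYField κ (latticeVac Λ) = idF (LatticeSpace Λ) := by
  have h1 : (idF (LatticeSpace Λ)).1 (-1) (latticeVac Λ) = latticeVac Λ := by
    rw [idF_apply, if_pos rfl]
  have h := eq_latticeYField (p := 0) hΛ hκ (GeneratingFields.mem_full.1
    (GeneratingFields.idF_mem_full (D := latticeGen hΛ hκ))).1
    (by rw [h1]; exact (latticeGen hΛ hκ).vac_mem)
  rw [h1] at h
  exact h.symm

section Subspace

variable {U : Submodule ℂ (LatticeSpace Λ)}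
  (hmode : ∀ a ∈ U, ∀ b ∈ U, ∀ m : ℤ, (latticeYField κ a).1 m b ∈ U)

/-- The products on a subspace that is closed under them. -/
def restrictedMode (m : ℤ) : U →ₗ[ℂ] U →ₗ[ℂ] U :=
  LinearMap.mk₂ ℂ (fun a b => ⟨(latticeYField κ a.1).1 m b.1, hmode a.1 a.2 b.1 b.2 m⟩)
    (fun a a' b => Subtype.ext (by simp))
    (fun c a b => Subtype.ext (by simp))
    (fun a b b' => Subtype.ext (by simp))
    (fun c a b => Subtype.ext (by simp))

theorem coe_restrictedMode (m : ℤ) (a b : U) :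
    (restrictedMode hmode m a b : LatticeSpace Λ) = (latticeYField κ a.1).1 m b.1 := rfl

/-- A subspace of the even part of a lattice vertex superalgebra that contains the vacuum and is
closed under the products is a vertex algebra. -/
def restrictedVA (hΛ : IsIntegralLattice Λ) (hκ : IsLatticeCocycle κ) (hU : U ≤ latticePar Λ 0)
    (hvac : latticeVac Λ ∈ U) : VertexAlgebra U where
  vac := ⟨latticeVac Λ, hvac⟩
  mode := restrictedMode hmode
  truncation a b := by
    obtain ⟨N, hN⟩ := (latticeYField κ a.1).2 b.1
    exact ⟨N, fun m hm => Subtype.ext (hN m hm)⟩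
  vac_mode m b := by
    refine Subtype.ext ?_
    rw [coe_restrictedMode, latticeYField_latticeVac hΛ hκ, idF_apply]
    split_ifs <;> rfl
  mode_vac a := Subtype.ext (latticeYField_vac hΛ hκ a.1)
  mode_vac_of_nonneg m a hm := Subtype.ext
    ((GeneratingFields.mem_full.1 (latticeYField_mem_full hΛ hκ (hU a.2))).1.2.1 m hm)
  translation m a b := by
    refine Subtype.ext ?_
    have h := (GeneratingFields.mem_full.1 (latticeYField_mem_full hΛ hκ (hU a.2))).1.1 m b
    have h1 := latticeYField_translation hΛ hκ (hU b.2)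
    have h2 := latticeYField_translation hΛ hκ (hU (restrictedMode hmode m a b).2)
    change (latticeYField κ (restrictedMode hmode m a b).1).1 (-2) (latticeVac Λ) -
      (latticeYField κ a.1).1 m ((latticeYField κ b.1).1 (-2) (latticeVac Λ)) =
      (-(m : ℂ)) • (latticeYField κ a.1).1 (m - 1) b.1
    rw [h1, h2]
    exact h
  locality a b := by
    obtain ⟨N, hN⟩ := latticeYField_isLocal hΛ hκ (hU a.2) (hU b.2)
    refine ⟨N, fun m k c => Subtype.ext ?_⟩
    rw [Submodule.coe_sum, Submodule.coe_zero, ← hN m k c]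
    refine Finset.sum_congr rfl fun j _ => ?_
    rw [Submodule.coe_smul, Submodule.coe_sub, coe_restrictedMode, coe_restrictedMode,
      coe_restrictedMode, coe_restrictedMode]

theorem restrictedVA_isRestrictionOf (hΛ : IsIntegralLattice Λ) (hκ : IsLatticeCocycle κ)
    (hU : U ≤ latticePar Λ 0) (hvac : latticeVac Λ ∈ U) :
    (restrictedVA hmode hΛ hκ hU hvac).IsRestrictionOf (latticeVac Λ) (latticeY κ) :=
  ⟨rfl, fun m a b => latticeYField_apply a.1 b.1 m⟩

end Subspace

theorem latticeYField_mem_latticePar (hΛ : IsIntegralLattice Λ) (hκ : IsLatticeCocycle κ)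
    {p q : ZMod 2} {a b : LatticeSpace Λ} (ha : a ∈ latticePar Λ p) (hb : b ∈ latticePar Λ q)
    (m : ℤ) : (latticeYField κ a).1 m b ∈ latticePar Λ (p + q) :=
  (GeneratingFields.mem_full.1 (latticeYField_mem_full hΛ hκ ha)).1.2.2.1 m q b hb

end LatticeVertexAlgebra

/-! ## The lattices `ℤⁿ` and `D_n` -/

section Lattices

variable {n : ℕ}

/-- The standard basis vector `e_k`, extended by zero to `n ≤ k`. -/
def stdVec (n k : ℕ) : Euc n := if h : k < n then EuclideanSpace.single ⟨k, h⟩ 1 else 0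

theorem stdVec_apply (k : ℕ) (j : Fin n) : stdVec n k j = if (j : ℕ) = k then 1 else 0 := by
  unfold stdVec
  split_ifs with h h1 h1
  · simp [Fin.ext_iff, h1]
  · simp [Fin.ext_iff, h1]
  · omega
  · simp

theorem stdVec_coe (i : Fin n) : stdVec n i = EuclideanSpace.single i 1 := by
  rw [stdVec, dif_pos i.2]

theorem simpleRoot_eq (i : Fin n) : simpleRoot n i = √2 • (stdVec n i - stdVec n (i + 1)) := by
  rw [simpleRoot, stdVec_coe]
  rfl

theorem simpleMomentum_eq (i : Fin n) :
    (simpleMomentum n i : Euc n) = stdVec n (i + 1) - stdVec n i := by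
  change -((√2)⁻¹ • simpleRoot n i) = _
  rw [simpleRoot_eq, smul_smul, inv_mul_cancel₀ (by positivity), one_smul, neg_sub]

/-- A telescoping sum; the convention `stdVec n n = 0` gives the last simple root the same form as
the others. The sign explains the minus in `shortCoord`. -/
theorem shortMomentum_eq (i : Fin n) : (shortMomentum n i : Euc n) = -stdVec n i := by
  have h0 : stdVec n n = 0 := by rw [stdVec, dif_neg (lt_irrefl n)]
  have h1 : ∑ k ∈ Finset.Ico (i : ℕ) n, (stdVec n (k + 1) - stdVec n k) =
      stdVec n n - stdVec n i := Finset.sum_Ico_sub _ i.2.le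
  rw [shortMomentum, AddSubgroup.val_finsetSum, Finset.sum_congr rfl fun k _ =>
    simpleMomentum_eq k, ← zero_sub, ← h0, ← h1, ← Fin.map_valEmbedding_Ici, Finset.sum_map]
  rfl

theorem shortMomentum_apply (i j : Fin n) :
    (shortMomentum n i : Euc n) j = if j = i then -1 else 0 := by
  rw [shortMomentum_eq, PiLp.neg_apply, stdVec_apply]
  by_cases h : j = i
  · rw [if_pos h, if_pos (congrArg _ h)]
  · rw [if_neg h, if_neg fun h1 => h (Fin.ext h1), neg_zero]

theorem shortMomentum_orthonormal : Orthonormal ℝ fun i => (shortMomentum n i : Euc n) := by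
  rw [orthonormal_iff_ite]
  intro i j
  rw [inner_eq_sum]
  simp only [shortMomentum_apply, ite_mul, zero_mul, Finset.sum_ite_eq',
    Finset.mem_univ, if_true]
  split_ifs <;> norm_num

theorem exists_int_of_mem_shortLattice {v : Euc n} (hv : v ∈ shortLattice n) (j : Fin n) :
    ∃ z : ℤ, v j = z := by
  induction hv using AddSubgroup.closure_induction with
  | mem x hx =>
    obtain ⟨i, rfl⟩ := hx
    have := congrArg (fun t : Euc n => t j) (simpleMomentum_eq i)
    change (-((√2)⁻¹ • simpleRoot n i)) j = (stdVec n (i + 1) - stdVec n i) j at this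
    rw [PiLp.sub_apply, stdVec_apply, stdVec_apply] at this
    refine ⟨(if (j : ℕ) = i + 1 then 1 else 0) - if (j : ℕ) = i then 1 else 0, ?_⟩
    beta_reduce
    rw [this]
    push_cast
    rfl
  | zero => exact ⟨0, by simp⟩
  | add x y _ _ hx hy =>
    obtain ⟨a, ha⟩ := hx
    obtain ⟨b, hb⟩ := hy
    exact ⟨a + b, by rw [PiLp.add_apply, ha, hb, Int.cast_add]⟩
  | neg x _ hx =>
    obtain ⟨a, ha⟩ := hx
    exact ⟨-a, by rw [PiLp.neg_apply, ha, Int.cast_neg]⟩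

/-- The coordinates of a vector of the short lattice with respect to the short momenta. -/
def shortCoord (l : shortLattice n) (j : Fin n) : ℤ :=
  -(exists_int_of_mem_shortLattice l.2 j).choose

theorem coe_apply_eq_shortCoord (l : shortLattice n) (j : Fin n) :
    (l : Euc n) j = -(shortCoord l j : ℝ) := by
  rw [shortCoord, Int.cast_neg, neg_neg]
  exact (exists_int_of_mem_shortLattice l.2 j).choose_spec

theorem sum_zsmul_shortMomentum_apply (x : Fin n → ℤ) (j : Fin n) :
    (∑ i, x i • (shortMomentum n i : Euc n)) j = -(x j : ℝ) := by
  have : (∑ i, x i • (shortMomentum n i : Euc n)) j =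
      ∑ i, (x i : ℝ) * (shortMomentum n i : Euc n) j := by
    rw [WithLp.ofLp_sum, Finset.sum_apply]
    refine Finset.sum_congr rfl fun i _ => ?_
    rw [← Int.cast_smul_eq_zsmul ℝ]
    rfl
  rw [this]
  simp [shortMomentum_apply]

theorem eq_sum_shortMomentum (l : shortLattice n) :
    l = ∑ i, shortCoord l i • shortMomentum n i := by
  refine Subtype.ext ?_
  rw [AddSubgroup.val_finsetSum]
  refine PiLp.ext fun j => ?_
  rw [coe_apply_eq_shortCoord]
  exact (sum_zsmul_shortMomentum_apply _ j).symm

theorem shortLattice_inner (x y : shortLattice n) :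
    ⟪(x : Euc n), (y : Euc n)⟫_ℝ = ((∑ i, shortCoord x i * shortCoord y i : ℤ) : ℝ) := by
  rw [inner_eq_sum]
  push_cast
  refine Finset.sum_congr rfl fun i _ => ?_
  rw [coe_apply_eq_shortCoord, coe_apply_eq_shortCoord, neg_mul_neg]

theorem shortLattice_intInner (x y : shortLattice n) :
    intInner (x : Euc n) y = ∑ i, shortCoord x i * shortCoord y i := by
  rw [intInner, shortLattice_inner, Int.floor_intCast]

theorem shortLattice_isIntegral : IsIntegralLattice (shortLattice n) := fun x y => by
  rw [shortLattice_intInner, shortLattice_inner]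

theorem shortCoord_eq_of_coe_eq {l : shortLattice n} {x : Fin n → ℤ}
    (h : (l : Euc n) = ∑ i, x i • (shortMomentum n i : Euc n)) : shortCoord l = x := by
  funext j
  have := coe_apply_eq_shortCoord l j
  rw [h, sum_zsmul_shortMomentum_apply] at this
  exact Int.cast_injective (α := ℝ) (neg_injective this).symm

theorem sqrt_two_smul_simpleCoroot (i : Fin n) : √2 • simpleCoroot n i =
    if (i : ℕ) + 1 < n then stdVec n i - stdVec n (i + 1) else (2 : ℤ) • stdVec n i := by
  have h2 : √2 * √2 = 2 := Real.mul_self_sqrt (by norm_num)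
  have key : ⟪simpleRoot n i, simpleRoot n i⟫_ℝ = if (i : ℕ) + 1 < n then 4 else 2 := by
    rw [simpleRoot_eq, inner_smul_left, inner_smul_right, ← mul_assoc]
    have h1 : ⟪stdVec n i, stdVec n i⟫_ℝ = 1 := by
      rw [stdVec_coe]
      simp
    have h3 : (starRingEnd ℝ) √2 * √2 = 2 := h2
    rw [h3]
    split_ifs with h
    · have h4 : ⟪stdVec n (i + 1), stdVec n (i + 1)⟫_ℝ = 1 := by
        have := stdVec_coe (⟨i + 1, h⟩ : Fin n)
        rw [this]
        simp
      have h5 : ⟪stdVec n i, stdVec n (i + 1)⟫_ℝ = 0 := by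
        rw [inner_eq_sum]
        refine Finset.sum_eq_zero fun j _ => ?_
        rw [stdVec_apply, stdVec_apply]
        split_ifs <;> first | omega | simp
      rw [inner_sub_left, inner_sub_right, inner_sub_right, real_inner_comm, h1, h4, h5,
        real_inner_comm, h5]
      norm_num
    · have h4 : stdVec n (i + 1) = 0 := by rw [stdVec, dif_neg h]
      rw [h4, sub_zero, h1]
      norm_num
  rw [simpleCoroot, key, simpleRoot_eq, smul_smul, smul_smul]
  split_ifs with h
  · rw [show √2 * (2 / 4) * √2 = 1 by linear_combination (1 / 2) * h2, one_smul]
  · have h4 : stdVec n (i + 1) = 0 := by rw [stdVec, dif_neg h]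
    rw [h4, sub_zero, show √2 * (2 / 2) * √2 = (2 : ℤ) by push_cast; linear_combination h2,
      Int.cast_smul_eq_zsmul]

theorem stdVec_sub_mem_longLattice (k : ℕ) : ∀ i : ℕ, i + k < n →
    stdVec n i - stdVec n (i + k) ∈ longLattice n := by
  induction k with
  | zero => intro i _; rw [add_zero, sub_self]; exact zero_mem _
  | succ k ih =>
    intro i hi
    have h := sqrt_two_smul_simpleCoroot (⟨i, by omega⟩ : Fin n)
    rw [if_pos (by change i + 1 < n; omega)] at h
    have h2 : stdVec n i - stdVec n (i + 1) ∈ longLattice n := by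
      rw [← h]
      exact AddSubgroup.subset_closure ⟨_, rfl⟩
    have := add_mem h2 (ih (i + 1) (by omega))
    rwa [sub_add_sub_cancel, show i + 1 + k = i + (k + 1) by ring] at this

theorem two_zsmul_stdVec_mem_longLattice (hn : 1 ≤ n) :
    (2 : ℤ) • stdVec n (n - 1) ∈ longLattice n := by
  have h := sqrt_two_smul_simpleCoroot (⟨n - 1, by omega⟩ : Fin n)
  rw [if_neg (by change ¬ (n - 1 + 1 < n); omega)] at h
  rw [← h]
  exact AddSubgroup.subset_closure ⟨_, rfl⟩

theorem exists_of_mem_longLattice {v : Euc n} (hv : v ∈ longLattice n) :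
    ∃ x : Fin n → ℤ, Even (∑ i, x i) ∧ v = ∑ i, x i • (shortMomentum n i : Euc n) := by
  induction hv using AddSubgroup.closure_induction with
  | mem v hv =>
    obtain ⟨i, rfl⟩ := hv
    beta_reduce
    rw [sqrt_two_smul_simpleCoroot]
    split_ifs with h
    · have h1 : stdVec n i = -shortMomentum n i := by rw [shortMomentum_eq, neg_neg]
      have h2 : stdVec n (i + 1) = -shortMomentum n ⟨i + 1, h⟩ := by
        rw [shortMomentum_eq, neg_neg]
      refine ⟨Pi.single ⟨i + 1, h⟩ 1 - Pi.single i 1, ?_, ?_⟩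
      · simp
      · rw [h1, h2]
        simp only [Pi.sub_apply, sub_smul, Finset.sum_sub_distrib, Pi.single_apply, ite_smul,
          one_smul, zero_smul, Finset.sum_ite_eq', Finset.mem_univ, if_true]
        abel
    · refine ⟨Pi.single i (-2), ?_, ?_⟩
      · rw [Finset.sum_pi_single']
        simp
      · simp only [Pi.single_apply, ite_smul, zero_smul, Finset.sum_ite_eq', Finset.mem_univ,
          if_true]
        rw [shortMomentum_eq, neg_smul, smul_neg, neg_neg]
  | zero => exact ⟨0, by simp, by simp⟩
  | add v w _ _ hv hw =>
    obtain ⟨x, hx, rfl⟩ := hv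
    obtain ⟨y, hy, rfl⟩ := hw
    refine ⟨x + y, ?_, ?_⟩
    · simp only [Pi.add_apply, Finset.sum_add_distrib]
      exact hx.add hy
    · simp only [Pi.add_apply, add_smul, Finset.sum_add_distrib]
  | neg v _ hv =>
    obtain ⟨x, hx, rfl⟩ := hv
    refine ⟨-x, ?_, ?_⟩
    · simp only [Pi.neg_apply, Finset.sum_neg_distrib]
      exact hx.neg
    · simp only [Pi.neg_apply, neg_smul, Finset.sum_neg_distrib]

/-- All coordinates are moved to the last one: the differences e_i - e_{n-1} (indices from 0) are
sums of rescaled long coroots, and the remaining even multiple of e_{n-1} comes from the rescaled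
short coroot. -/
theorem sum_mem_longLattice (hn : 1 ≤ n) {x : Fin n → ℤ} (hx : Even (∑ i, x i)) :
    ∑ i, x i • (shortMomentum n i : Euc n) ∈ longLattice n := by
  have h1 : ∑ i, x i • (shortMomentum n i : Euc n) =
      -(∑ i, x i • (stdVec n i - stdVec n (n - 1)) + (∑ i, x i) • stdVec n (n - 1)) := by
    simp only [shortMomentum_eq, smul_sub, smul_neg, Finset.sum_neg_distrib,
      Finset.sum_sub_distrib, Finset.sum_smul]
    abel
  rw [h1]
  refine neg_mem (add_mem (sum_mem fun i _ => zsmul_mem ?_ _) ?_)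
  · have := stdVec_sub_mem_longLattice (n := n) (n - 1 - i) (i : ℕ) (by omega)
    rwa [show (i : ℕ) + (n - 1 - i) = n - 1 by omega] at this
  · obtain ⟨r, hr⟩ := hx
    rw [hr, ← mul_two, mul_smul]
    exact zsmul_mem (two_zsmul_stdVec_mem_longLattice hn) _

theorem longLattice_eq (hn : 1 ≤ n) : (longLattice n : Set (Euc n)) =
    {v | ∃ x : Fin n → ℤ, Even (∑ i, x i) ∧ v = ∑ i, x i • (shortMomentum n i : Euc n)} := by
  ext v
  refine ⟨exists_of_mem_longLattice, ?_⟩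
  rintro ⟨x, hx, rfl⟩
  exact sum_mem_longLattice hn hx

/-- Squares agree with their bases modulo 2. Hence even norm means even coordinate sum, and V_{Λ^⊕}
is the even part of the superalgebra. -/
theorem normPar_shortLattice (l : shortLattice n) :
    normPar l = ((∑ i, shortCoord l i : ℤ) : ZMod 2) := by
  rw [normPar, shortLattice_intInner]
  push_cast
  have : ∀ a : ZMod 2, a * a = a := by decide
  exact Finset.sum_congr rfl fun i _ => this _

theorem mem_longLattice_iff (hn : 1 ≤ n) (l : shortLattice n) :
    (l : Euc n) ∈ longLattice n ↔ normPar l = 0 := by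
  rw [normPar_shortLattice, ZMod.intCast_eq_zero_iff_even]
  constructor
  · intro h
    obtain ⟨x, hx, h⟩ := exists_of_mem_longLattice h
    rwa [shortCoord_eq_of_coe_eq h]
  · intro h
    have := sum_mem_longLattice hn h
    have h2 := congrArg (Subtype.val) (eq_sum_shortMomentum l)
    rw [AddSubgroup.val_finsetSum] at h2
    rw [h2]
    exact this

theorem longSpace_eq (hn : 1 ≤ n) : longSpace n = latticePar (shortLattice n) 0 := by
  rw [longSpace, latticePar]
  congr 1
  ext l
  exact mem_longLattice_iff hn l

theorem shortCoord_shortMomentum (i j : Fin n) :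
    shortCoord (shortMomentum n i) j = if j = i then 1 else 0 := by
  have := shortCoord_eq_of_coe_eq (l := shortMomentum n i) (x := Pi.single i 1)
    (by simp [Pi.single_apply])
  rw [this, Pi.single_apply]

theorem shortCoord_neg (l : shortLattice n) (j : Fin n) :
    shortCoord (-l) j = -shortCoord l j := by
  have h1 := coe_apply_eq_shortCoord (-l) j
  have h2 := coe_apply_eq_shortCoord l j
  rw [AddSubgroup.coe_neg, PiLp.neg_apply, h2] at h1
  rw [← Int.cast_neg] at h1
  exact Int.cast_injective (α := ℝ) (by rw [← neg_injective h1])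

theorem intInner_shortMomentum (i : Fin n) (l : shortLattice n) :
    intInner (shortMomentum n i : Euc n) l = shortCoord l i := by
  rw [shortLattice_intInner]
  simp [shortCoord_shortMomentum]

theorem intInner_neg_shortMomentum (i : Fin n) (l : shortLattice n) :
    intInner ((-shortMomentum n i : shortLattice n) : Euc n) l = -shortCoord l i := by
  rw [shortLattice_intInner]
  simp [shortCoord_shortMomentum, shortCoord_neg]

theorem normPar_shortMomentum (i : Fin n) : normPar (shortMomentum n i) = 1 := by
  rw [normPar, intInner_shortMomentum, shortCoord_shortMomentum, if_pos rfl]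
  rfl

theorem normPar_neg_shortMomentum (i : Fin n) : normPar (-shortMomentum n i) = 1 := by
  rw [normPar, intInner_neg_shortMomentum, shortCoord_neg, shortCoord_shortMomentum, if_pos rfl]
  rfl

end Lattices

/-! ## The fields of charged fermions -/

section ChargedFermions

open MvPolynomial

variable {n : ℕ} {Λ : AddSubgroup (Euc n)} {κ : Λ → Λ → ℂˣ}

/-- All coefficients of (1 - x)⁻¹ are 1, so this is the addition theorem for `α` and `-α`, and the
exponential series of 0 is 1. -/
theorem expProd_neg_one (α : Euc n) (q : ℤ) :
    expProd α (-α) (-1) (-1) q = if q = 0 then 1 else 0 := by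
  rcases lt_or_ge q 0 with hq | hq
  · rw [expProd, show (q + 1).toNat = 0 by omega, Finset.sum_range_zero, if_neg hq.ne]
  · obtain ⟨q, rfl⟩ := Int.eq_ofNat_of_zero_le hq
    have h : ((q : ℤ) + 1).toNat = q + 1 := by omega
    rw [expProd, h]
    have := sum_antidiagonal_expCoeff α (-α) q
    rw [Finset.Nat.sum_antidiagonal_eq_sum_range_succ_mk, add_neg_cancel, expCoeff_zero_left] at this
    simp only [Nat.cast_eq_zero, ← this]
    refine Finset.sum_congr rfl fun s hs => ?_
    rw [Finset.mem_range] at hs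
    have h1 : (-1 - -1 + s : ℤ) = s := by ring
    have h2 : (q - s : ℤ) = (q - s : ℕ) := by omega
    rw [binCoeff_neg_one, one_smul, h1, h2]
    rfl

/-- For a first-order pole the supercommutator depends on the mode indices only through their sum,
so it may be evaluated at a convenient first index. -/
theorem superComm_exp_shift {A B : FieldOn (LatticeSpace Λ)} {ε : ℂ} {v : LatticeSpace Λ}
    (h : (diffOp (LatticeSpace Λ) ((1, 0) : ℤ × ℤ) (0, 1) ^ 1) (superComm ε A B v) = 0)
    (m k m' : ℤ) : superComm ε A B v (m, k) = superComm ε A B v (m', m + k - m') := by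
  have step : ∀ m k, superComm ε A B v (m + 1, k) = superComm ε A B v (m, k + 1) := by
    intro m k
    have := congrFun h (m, k)
    rw [pow_one, diffOp_apply] at this
    simpa using sub_eq_zero.1 this
  induction m' using Int.inductionOn' (b := m) with
  | zero => rw [add_sub_cancel_left]
  | succ j _ ih => rw [ih, step]; congr 2; ring
  | pred j _ ih =>
    have := step (j - 1) (m + k - j)
    rw [sub_add_cancel] at this
    rw [ih, this]
    congr 2
    ring

/-- The exponentials of opposite vectors of norm one are charged fermions. -/
theorem expMode_expMode_neg (hΛ : IsIntegralLattice Λ) (hκ : IsLatticeCocycle κ) (α : Λ)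
    (h : intInner (α : Euc n) ((-α : Λ) : Euc n) = -1) (m k : ℤ) (v : LatticeSpace Λ) :
    expMode κ α m (expMode κ (-α) k v) -
      superSign (normPar α) (normPar (-α)) • expMode κ (-α) k (expMode κ α m v) =
      if m + k = -1 then ((κ (-α) α : ℂˣ) : ℂ) • v else 0 := by
  set ε := superSign (normPar α) (normPar (-α)) with hε
  let A : ℤ × ℤ → Module.End ℂ (LatticeSpace Λ) := fun p =>
    LinearMap.proj p ∘ₗ superCommL ε (expF κ α) (expF κ (-α)) -
      if p.1 + p.2 = -1 then ((κ (-α) α : ℂˣ) : ℂ) • 1 else 0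
  have hAv : ∀ p v, A p v = superComm ε (expF κ α) (expF κ (-α)) v p -
      if p.1 + p.2 = -1 then ((κ (-α) α : ℂˣ) : ℂ) • v else 0 := by
    intro p v
    simp only [A, LinearMap.sub_apply]
    split_ifs <;> rfl
  have hA : ∀ p, A p = 0 := by
    refine eq_zero_of_exp (fun p l => ?_) fun i k p v hv => ?_
    · obtain ⟨m, k⟩ := p
      have hl : intInner ((-α : Λ) : Euc n) l = -intInner (α : Euc n) l := by
        have := hΛ.add_left α (-α) l
        rw [add_neg_cancel, hΛ.zero_left] at this
        omega
      -- The first index is moved to `-(α, l)`. Then the exponent of z is -1 in both products: the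
      -- second becomes an empty sum and the first is given by `expProd_neg_one`.
      rw [hAv, superComm_exp_shift (diffOp_pow_superComm_expF hΛ hκ α (-α) 1 (by rw [h]; norm_num)
        _) m k (-intInner (α : Euc n) l), superComm_exp hΛ, h, hl]
      have e1 : -(-intInner (α : Euc n) l, m + k - -intInner (α : Euc n) l).1 - 1 -
          intInner (α : Euc n) l = -1 := by simp
      have e2 : -(-intInner (α : Euc n) l, m + k - -intInner (α : Euc n) l).2 - 1 -
          -intInner (α : Euc n) l = -(m + k) - 1 := by ring
      have e3 : expProd ((-α : Λ) : Euc n) α (-1) (-(m + k) - 1) (-1) = 0 := rfl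
      rw [e1, e2, e3, AddSubgroup.coe_neg, expProd_neg_one, hκ.cocycle, neg_add_cancel,
        hκ.zero_right, neg_add_cancel_right, smul_zero, sub_zero, mul_one]
      by_cases hmk : m + k = -1
      · rw [if_pos (by omega), if_pos hmk, Finsupp.smul_single, sub_self]
      · rw [if_neg (by omega), if_neg hmk, smul_zero, Finsupp.single_zero, sub_zero]
    · simp only [hAv, sub_eq_zero] at hv ⊢
      have e1 : p + (-1 - (k : ℤ), 0) = (p.1 + (-1 - k), p.2) := by ext <;> simp
      have e2 : p + (0, -1 - (k : ℤ)) = (p.1, p.2 + (-1 - k)) := by ext <;> simp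
      have e3 : p.1 + (-1 - (k : ℤ)) + p.2 = p.1 + (p.2 + (-1 - k)) := by ring
      -- The two shift terms carry opposite weights, those of `α` and `-α`, and cancel because the
      -- claimed value depends only on the sum of the indices.
      rw [superComm_bosonLM, Pi.sub_apply, Pi.sub_apply, Pi.smul_apply, Pi.smul_apply,
        shiftOp_apply, shiftOp_apply, e1, e2, hv, hv, hv, AddSubgroup.coe_neg, PiLp.neg_apply, e3,
        Complex.ofReal_neg, neg_smul, sub_neg_eq_add, sub_add_cancel]
      split_ifs
      · rw [map_smul]
      · rw [map_zero]
  have := LinearMap.congr_fun (hA (m, k)) v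
  rw [hAv, LinearMap.zero_apply, sub_eq_zero] at this
  exact this

end ChargedFermions

/-! ### The charged fermions b and c and their anticommutators -/

section BC

variable {n : ℕ} {κ : shortLattice n → shortLattice n → ℂˣ}

/-- The generating fields of `𝒱_{ℤⁿ}`. -/
abbrev shortGen (hκ : IsLatticeCocycle κ) :
    GeneratingFields (LatticeSpace (shortLattice n)) (Fin n ⊕ shortLattice n) :=
  latticeGen shortLattice_isIntegral hκ

/-- The field `Y(e^{φ_{α_i}})` of a short momentum. -/
def bField (κ : shortLattice n → shortLattice n → ℂˣ) (i : Fin n) :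
    FieldOn (LatticeSpace (shortLattice n)) :=
  expF κ (shortMomentum n i)

/-- The normalised field `Y(e^{-φ_{α_i}})` of an opposite short momentum. -/
def cField (κ : shortLattice n → shortLattice n → ℂˣ) (i : Fin n) :
    FieldOn (LatticeSpace (shortLattice n)) :=
  ((κ (-shortMomentum n i) (shortMomentum n i) : ℂˣ) : ℂ)⁻¹ • expF κ (-shortMomentum n i)

theorem bField_apply (i : Fin n) (m : ℤ) (v : LatticeSpace (shortLattice n)) :
    (bField κ i).1 m v = expMode κ (shortMomentum n i) m v := rfl

theorem cField_apply (i : Fin n) (m : ℤ) (v : LatticeSpace (shortLattice n)) :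
    (cField κ i).1 m v = ((κ (-shortMomentum n i) (shortMomentum n i) : ℂˣ) : ℂ)⁻¹ •
      expMode κ (-shortMomentum n i) m v := rfl

theorem superSign_one_one : superSign 1 1 = -1 := by
  rw [superSign, if_neg (by decide)]

theorem bField_bField (hκ : IsLatticeCocycle κ) (i j : Fin n) (m k : ℤ)
    (v : LatticeSpace (shortLattice n)) :
    (bField κ i).1 m ((bField κ j).1 k v) = -(bField κ j).1 k ((bField κ i).1 m v) := by
  simp only [bField_apply]
  have h : 0 ≤ intInner (shortMomentum n i : Euc n) (shortMomentum n j) := by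
    rw [intInner_shortMomentum, shortCoord_shortMomentum]
    split_ifs <;> norm_num
  rw [expMode_supercomm shortLattice_isIntegral hκ _ _ h, normPar_shortMomentum,
    normPar_shortMomentum, superSign_one_one, neg_one_smul]

theorem cField_cField (hκ : IsLatticeCocycle κ) (i j : Fin n) (m k : ℤ)
    (v : LatticeSpace (shortLattice n)) :
    (cField κ i).1 m ((cField κ j).1 k v) = -(cField κ j).1 k ((cField κ i).1 m v) := by
  simp only [cField_apply, map_smul]
  have h : 0 ≤ intInner ((-shortMomentum n i : shortLattice n) : Euc n)
      ((-shortMomentum n j : shortLattice n) : Euc n) := by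
    rw [intInner_neg_shortMomentum, shortCoord_neg, shortCoord_shortMomentum]
    split_ifs <;> norm_num
  rw [expMode_supercomm shortLattice_isIntegral hκ _ _ h, normPar_neg_shortMomentum,
    normPar_neg_shortMomentum, superSign_one_one]
  module

theorem bField_cField (hκ : IsLatticeCocycle κ) (i j : Fin n) (m k : ℤ)
    (v : LatticeSpace (shortLattice n)) :
    (bField κ i).1 m ((cField κ j).1 k v) = -(cField κ j).1 k ((bField κ i).1 m v) +
      if i = j ∧ m + k = -1 then v else 0 := by
  simp only [cField_apply, bField_apply, map_smul]
  by_cases hij : i = j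
  · subst hij
    have h : intInner (shortMomentum n i : Euc n) ((-shortMomentum n i : shortLattice n) : Euc n)
        = -1 := by
      rw [intInner_shortMomentum, shortCoord_neg, shortCoord_shortMomentum, if_pos rfl]
    have h2 := expMode_expMode_neg shortLattice_isIntegral hκ _ h m k v
    rw [normPar_neg_shortMomentum, normPar_shortMomentum, superSign_one_one, neg_one_smul,
      sub_neg_eq_add, ← eq_sub_iff_add_eq] at h2
    rw [h2]
    simp only [true_and]
    split_ifs with hmk
    · rw [smul_sub, smul_smul, inv_mul_cancel₀ (Units.ne_zero _), one_smul]
      abel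
    · rw [zero_sub, smul_neg, add_zero]
  · have h : 0 ≤ intInner (shortMomentum n i : Euc n)
        ((-shortMomentum n j : shortLattice n) : Euc n) := by
      rw [intInner_shortMomentum, shortCoord_neg, shortCoord_shortMomentum, if_neg hij, neg_zero]
    rw [expMode_supercomm shortLattice_isIntegral hκ _ _ h, normPar_neg_shortMomentum,
      normPar_shortMomentum, superSign_one_one, if_neg fun h => hij h.1]
    module

theorem bField_mem_full (hκ : IsLatticeCocycle κ) (i : Fin n) :
    bField κ i ∈ (shortGen hκ).full 1 := by
  rw [← normPar_shortMomentum i]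
  exact expF_mem_full _ hκ _

theorem cField_mem_full (hκ : IsLatticeCocycle κ) (i : Fin n) :
    cField κ i ∈ (shortGen hκ).full 1 := by
  rw [← normPar_neg_shortMomentum i]
  exact Submodule.smul_mem _ _ (expF_mem_full _ hκ _)

theorem bField_vac (hκ : IsLatticeCocycle κ) (i : Fin n) (m : ℤ) (hm : 0 ≤ m) :
    (bField κ i).1 m (latticeVac (shortLattice n)) = 0 :=
  (GeneratingFields.mem_full.1 (bField_mem_full hκ i)).1.2.1 m hm

theorem cField_vac (hκ : IsLatticeCocycle κ) (i : Fin n) (m : ℤ) (hm : 0 ≤ m) :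
    (cField κ i).1 m (latticeVac (shortLattice n)) = 0 :=
  (GeneratingFields.mem_full.1 (cField_mem_full hκ i)).1.2.1 m hm

end BC

/-! ## Generation by charged fermions -/

section Generation

open MvPolynomial

variable {n : ℕ} {κ : shortLattice n → shortLattice n → ℂˣ}

theorem dPhi_shortMomentum (i : Fin n) : dPhi (shortMomentum n i : Euc n) = -X (i, 0) := by
  rw [dPhi, Finset.sum_eq_single i]
  · rw [shortMomentum_apply, if_pos rfl]
    simp
  · intro j _ hj
    rw [shortMomentum_apply, if_neg hj]
    simp
  · simp

theorem cField_bField (hκ : IsLatticeCocycle κ) (i j : Fin n) (m k : ℤ)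
    (v : LatticeSpace (shortLattice n)) :
    (cField κ i).1 m ((bField κ j).1 k v) = -(bField κ j).1 k ((cField κ i).1 m v) +
      if i = j ∧ m + k = -1 then v else 0 := by
  have h : (i = j ∧ m + k = -1) ↔ (j = i ∧ k + m = -1) := by rw [eq_comm (a := i), add_comm m]
  rw [bField_cField hκ j i k m, if_congr h rfl rfl]
  abel

/-- The free boson as a normally ordered product of charged fermions. -/
theorem nop_bField_cField (hκ : IsLatticeCocycle κ) (i : Fin n) :
    nop (-1) (bField κ i) (cField κ i) = (-1 : ℂ) • bosonF (shortLattice n) i := by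
  have h1 := GeneratingFields.nop_mem_full (bField_mem_full hκ i) (cField_mem_full hκ i)
  rw [superSign_one_one, show (1 + 1 : ZMod 2) = 0 from rfl] at h1
  -- By uniqueness only the states matter: b_{-1} c_{-1} 𝟙 is P_1 for the momentum -e_i, which is
  -- the linear polynomial -∂φ_{e_i}.
  refine GeneratingFields.good_ext (GeneratingFields.mem_full.1 h1).1
    (Submodule.smul_mem _ _ (GeneratingFields.mem_full.1
      (bosonF_mem_full shortLattice_isIntegral hκ i)).1) ?_
  have h2 := GeneratingFields.nop_apply_vac (D := shortGen hκ) (-1) (bField κ i)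
    (GeneratingFields.mem_full.1 (bField_mem_full hκ i)).1.2.1
    (GeneratingFields.mem_full.1 (cField_mem_full hκ i)).1
  rw [h2]
  change expMode κ (shortMomentum n i) (-1)
    (((κ (-shortMomentum n i) (shortMomentum n i) : ℂˣ) : ℂ)⁻¹ •
      expMode κ (-shortMomentum n i) (-1) (latticeVac (shortLattice n))) =
      (-1 : ℂ) • bosonLM (shortLattice n) i (-1) (latticeVac (shortLattice n))
  rw [expMode_vac shortLattice_isIntegral hκ, map_smul]
  have h3 : expCoeffInt ((-shortMomentum n i : shortLattice n) : Euc n) (- -1 - 1) = 1 := rfl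
  have h4 := bosonLM_neg (Λ := shortLattice n) i 0 0 1
  rw [h3, expMode_exp, latticeVac, Finsupp.smul_single, smul_smul, inv_mul_cancel₀ (Units.ne_zero _),
    one_smul, neg_add_cancel, intInner_shortMomentum, shortCoord_neg, shortCoord_shortMomentum,
    if_pos rfl]
  simp only [Nat.cast_zero, sub_zero, Nat.factorial_zero, Nat.cast_one, inv_one, one_smul,
    mul_one] at h4
  rw [h4, neg_one_smul, ← Finsupp.single_neg, ← dPhi_shortMomentum]
  congr 1
  have h5 : expCoeffInt (shortMomentum n i : Euc n) (- -1 - 1 - -1) =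
      expCoeff (shortMomentum n i : Euc n) 1 := rfl
  rw [h5, expCoeff, expCoeff]
  simp

/-- Suitable modes of b_i and c_i translate the exponent by plus or minus the i-th short momentum,
up to a non-zero scalar, and these momenta generate the lattice. -/
theorem single_mem_of_closed
    {K : Submodule ℂ (LatticeSpace (shortLattice n))} (h0 : latticeVac (shortLattice n) ∈ K)
    (hb : ∀ i m, ∀ v ∈ K, (bField κ i).1 m v ∈ K) (hc : ∀ i m, ∀ v ∈ K, (cField κ i).1 m v ∈ K)
    (l : shortLattice n) : Finsupp.single l 1 ∈ K := by
  have hE : ∀ α : shortLattice n, (∀ m, ∀ v ∈ K, expMode κ α m v ∈ K) → ∀ l : shortLattice n,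
      Finsupp.single l 1 ∈ K → Finsupp.single (l + α) 1 ∈ K := by
    intro α hα l hl
    -- This mode picks the leading coefficient P_0 = 1 of the exponential series.
    have := hα (-1 - intInner (α : Euc n) l) _ hl
    rw [expMode_exp] at this
    have h1 : expCoeffInt (α : Euc n) (-(-1 - intInner (α : Euc n) l) - 1 -
        intInner (α : Euc n) l) = 1 := by
      rw [show -(-1 - intInner (α : Euc n) l) - 1 - intInner (α : Euc n) l = 0 by ring]
      rfl
    rw [h1, ← Finsupp.smul_single] at this
    exact (Submodule.smul_mem_iff _ (Units.ne_zero _)).1 this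
  let H : AddSubgroup (shortLattice n) :=
    { carrier := {α | ∀ l, (Finsupp.single l 1 : LatticeSpace (shortLattice n)) ∈ K ↔
        Finsupp.single (l + α) 1 ∈ K}
      zero_mem' := fun l => by rw [add_zero]
      add_mem' := fun {α β} hα hβ l => by rw [hα l, hβ, add_assoc]
      neg_mem' := fun {α} hα l => by rw [hα (l + -α), neg_add_cancel_right] }
  have hH : ∀ i, shortMomentum n i ∈ H := fun i l =>
    ⟨hE _ (hb i) l, fun h => by
      have := hE (-shortMomentum n i) (fun m v hv => by
        have := hc i m v hv
        rw [cField_apply] at this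
        exact (Submodule.smul_mem_iff _ (inv_ne_zero (Units.ne_zero _))).1 this) _ h
      rwa [add_neg_cancel_right] at this⟩
  have hl : l ∈ H := by
    rw [eq_sum_shortMomentum l]
    exact sum_mem fun i _ => zsmul_mem (hH i) _
  have := (hl 0).1 h0
  rwa [zero_add] at this

/-- Closure under b and c gives all exponentials, and also closure under the negative boson modes,
because each boson is a normally ordered product of b and c up to sign. -/
theorem eq_top_of_closed (hκ : IsLatticeCocycle κ)
    {K : Submodule ℂ (LatticeSpace (shortLattice n))} (h0 : latticeVac (shortLattice n) ∈ K)
    (hb : ∀ i m, ∀ v ∈ K, (bField κ i).1 m v ∈ K) (hc : ∀ i m, ∀ v ∈ K, (cField κ i).1 m v ∈ K) :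
    K = ⊤ := by
  refine boson_closed_eq_top (single_mem_of_closed h0 hb hc) fun i k v hv => ?_
  have h : bosonLM (shortLattice n) i (-1 - k) v =
      -(nop (-1) (bField κ i) (cField κ i)).1 (-1 - k) v := by
    rw [nop_bField_cField hκ]
    simp [bosonF]
  rw [h]
  obtain ⟨J, hJ⟩ := exists_nop_eq_sum (-1) (bField κ i) (cField κ i) (-1 - k) v
  rw [hJ J le_rfl]
  exact Submodule.neg_mem _ (Submodule.sum_mem _ fun j _ => Submodule.add_mem _
    (hb _ _ _ (hc _ _ _ hv)) (Submodule.smul_mem _ _ (hc _ _ _ (hb _ _ _ hv))))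

/-- The negative modes of the charged fermions generate from the vacuum. -/
theorem eq_top_of_neg_closed (hκ : IsLatticeCocycle κ)
    {K : Submodule ℂ (LatticeSpace (shortLattice n))} (h0 : latticeVac (shortLattice n) ∈ K)
    (hb : ∀ i m, m < 0 → ∀ v ∈ K, (bField κ i).1 m v ∈ K)
    (hc : ∀ i m, m < 0 → ∀ v ∈ K, (cField κ i).1 m v ∈ K) : K = ⊤ := by
  let C : Set (Submodule ℂ (LatticeSpace (shortLattice n))) :=
    {K | latticeVac (shortLattice n) ∈ K ∧
      (∀ i m, m < 0 → ∀ v ∈ K, (bField κ i).1 m v ∈ K) ∧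
      ∀ i m, m < 0 → ∀ v ∈ K, (cField κ i).1 m v ∈ K}
  have hC : sInf C ∈ C := ⟨Submodule.mem_sInf.2 fun K hK => hK.1,
    fun i m hm v hv => Submodule.mem_sInf.2 fun K hK =>
      hK.2.1 i m hm v (Submodule.mem_sInf.1 hv K hK),
    fun i m hm v hv => Submodule.mem_sInf.2 fun K hK =>
      hK.2.2 i m hm v (Submodule.mem_sInf.1 hv K hK)⟩
  -- The vectors of the smallest admissible subspace that every mode of b and c, of any index, keeps
  -- inside it. As the anticommutators are scalars, `M` is admissible too; minimality then upgrades
  -- closure under negative modes to closure under all modes.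
  let M : Submodule ℂ (LatticeSpace (shortLattice n)) := sInf C ⊓
    ⨅ i, ⨅ m, ((sInf C).comap ((bField κ i).1 m) ⊓ (sInf C).comap ((cField κ i).1 m))
  have hM : ∀ v, v ∈ M ↔ v ∈ sInf C ∧ ∀ i m, (bField κ i).1 m v ∈ sInf C ∧
      (cField κ i).1 m v ∈ sInf C := by
    intro v
    simp only [M, Submodule.mem_inf, Submodule.mem_iInf, Submodule.mem_comap]
  have hMC : M ∈ C := by
    refine ⟨(hM _).2 ⟨hC.1, fun i m => ?_⟩, fun i m hm v hv => ?_, fun i m hm v hv => ?_⟩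
    · rcases lt_or_ge m 0 with hm | hm
      · exact ⟨hC.2.1 i m hm _ hC.1, hC.2.2 i m hm _ hC.1⟩
      · rw [bField_vac hκ i m hm, cField_vac hκ i m hm]
        exact ⟨zero_mem _, zero_mem _⟩
    · obtain ⟨hv, h⟩ := (hM v).1 hv
      refine (hM _).2 ⟨hC.2.1 i m hm v hv, fun j k => ⟨?_, ?_⟩⟩
      · rw [bField_bField hκ]
        exact neg_mem (hC.2.1 i m hm _ (h j k).1)
      · rw [cField_bField hκ]
        refine add_mem (neg_mem (hC.2.1 i m hm _ (h j k).2)) ?_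
        split_ifs
        exacts [hv, zero_mem _]
    · obtain ⟨hv, h⟩ := (hM v).1 hv
      refine (hM _).2 ⟨hC.2.2 i m hm v hv, fun j k => ⟨?_, ?_⟩⟩
      · rw [bField_cField hκ]
        refine add_mem (neg_mem (hC.2.2 i m hm _ (h j k).1)) ?_
        split_ifs
        exacts [hv, zero_mem _]
      · rw [cField_cField hκ]
        exact neg_mem (hC.2.2 i m hm _ (h j k).2)
  have hle : sInf C ≤ M := sInf_le hMC
  have htop : sInf C = ⊤ := eq_top_of_closed hκ hC.1
    (fun i m v hv => (((hM v).1 (hle hv)).2 i m).1) fun i m v hv => (((hM v).1 (hle hv)).2 i m).2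
  rw [eq_top_iff, ← htop]
  exact sInf_le ⟨h0, hb, hc⟩

end Generation

/-! ## Symplectic fermions inside the lattice vertex superalgebra -/

section Symplectic

variable {n : ℕ} {κ : shortLattice n → shortLattice n → ℂˣ}

/-- The symplectic fermion fields `ψⁱ` and `ψ*ⁱ`. -/
def psiField (κ : shortLattice n → shortLattice n → ℂˣ) (i : Fin n) :
    Bool → FieldOn (LatticeSpace (shortLattice n))
  | false => bField κ i
  | true => derF (cField κ i)

theorem psiField_mem_full (hκ : IsLatticeCocycle κ) (i : Fin n) (s : Bool) :
    psiField κ i s ∈ (shortGen hκ).full 1 := by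
  cases s with
  | false => exact bField_mem_full hκ i
  | true =>
    have := GeneratingFields.divDer_mem_full (cField_mem_full hκ i) 1
    have h : divDer 1 (cField κ i) = psiField κ i true := by
      change ((0 : ℕ) + 1 : ℂ)⁻¹ • derF (cField κ i) = derF (cField κ i)
      simp
    rwa [h] at this

/-- The anticommutation relations of symplectic fermions. -/
theorem psiField_psiField (hκ : IsLatticeCocycle κ) (i j : Fin n) (s t : Bool) (m k : ℤ)
    (v : LatticeSpace (shortLattice n)) :
    (psiField κ i s).1 m ((psiField κ j t).1 k v) = -(psiField κ j t).1 k ((psiField κ i s).1 m v) +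
      if i = j ∧ t = !s ∧ m + k = 0 then ((if s then -1 else 1) * (m : ℂ)) • v else 0 := by
  cases s <;> cases t
  · rw [if_neg (by simp), add_zero]
    exact bField_bField hκ i j m k v
  · change (bField κ i).1 m ((-(k : ℂ)) • (cField κ j).1 (k - 1) v) =
      -((-(k : ℂ)) • (cField κ j).1 (k - 1) ((bField κ i).1 m v)) + _
    -- The mode `k` of ∂c is `-k` times the mode `k - 1` of c; where `m + k = 0`, the factor `-k`
    -- equals `m`.
    rw [map_smul, bField_cField hκ]
    have h : (i = j ∧ m + (k - 1) = -1) ↔ (i = j ∧ true = !false ∧ m + k = 0) := by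
      simp only [Bool.not_false, true_and]
      refine and_congr Iff.rfl ⟨fun h => by omega, fun h => by omega⟩
    rw [if_congr h rfl rfl, smul_add, smul_neg]
    by_cases h1 : i = j ∧ true = !false ∧ m + k = 0
    · rw [if_pos h1, if_pos h1, show m = -k by omega]
      simp
    · rw [if_neg h1, if_neg h1, smul_zero]
  · change (-(m : ℂ)) • (cField κ i).1 (m - 1) ((bField κ j).1 k v) =
      -(bField κ j).1 k ((-(m : ℂ)) • (cField κ i).1 (m - 1) v) + _
    rw [map_smul, cField_bField hκ]
    have h : (i = j ∧ m - 1 + k = -1) ↔ (i = j ∧ false = !true ∧ m + k = 0) := by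
      simp only [Bool.not_true, true_and]
      refine and_congr Iff.rfl ⟨fun h => by omega, fun h => by omega⟩
    rw [if_congr h rfl rfl, smul_add, smul_neg]
    by_cases h1 : i = j ∧ false = !true ∧ m + k = 0
    · rw [if_pos h1, if_pos h1]
      simp
    · rw [if_neg h1, if_neg h1, smul_zero]
  · rw [if_neg (by simp), add_zero]
    change (-(m : ℂ)) • (cField κ i).1 (m - 1) ((-(k : ℂ)) • (cField κ j).1 (k - 1) v) =
      -((-(k : ℂ)) • (cField κ j).1 (k - 1) ((-(m : ℂ)) • (cField κ i).1 (m - 1) v))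
    rw [map_smul, map_smul, cField_cField hκ]
    module

theorem psiField_vac (hκ : IsLatticeCocycle κ) (i : Fin n) (s : Bool) (m : ℤ) (hm : 0 ≤ m) :
    (psiField κ i s).1 m (latticeVac (shortLattice n)) = 0 :=
  (GeneratingFields.mem_full.1 (psiField_mem_full hκ i s)).1.2.1 m hm

/-- The creation mode with a given label. -/
def creation (κ : shortLattice n → shortLattice n → ℂˣ) :
    (FermionIndex n →₀ ℂ) →ₗ[ℂ] Module.End ℂ (LatticeSpace (shortLattice n)) :=
  Finsupp.linearCombination ℂ fun x : FermionIndex n =>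
    (psiField κ (ofLex x).1 (ofLex (ofLex x).2).1).1 (-1 - ((ofLex (ofLex x).2).2 : ℤ))

theorem creation_single (x : FermionIndex n) (c : ℂ) : creation κ (Finsupp.single x c) =
    c • (psiField κ (ofLex x).1 (ofLex (ofLex x).2).1).1 (-1 - ((ofLex (ofLex x).2).2 : ℤ)) := by
  rw [creation, Finsupp.linearCombination_single]

theorem creation_anticomm (hκ : IsLatticeCocycle κ) (x y : FermionIndex n →₀ ℂ)
    (v : LatticeSpace (shortLattice n)) :
    creation κ x (creation κ y v) = -creation κ y (creation κ x v) := by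
  induction x using Finsupp.induction_linear with
  | zero => simp
  | add x x' hx hx' =>
    rw [map_add, LinearMap.add_apply, LinearMap.add_apply, map_add, hx, hx', neg_add]
  | single s c =>
    induction y using Finsupp.induction_linear with
    | zero => simp
    | add y y' hy hy' =>
      rw [map_add, LinearMap.add_apply, LinearMap.add_apply, map_add, hy, hy', neg_add]
    | single t d =>
      simp only [creation_single, LinearMap.smul_apply, map_smul]
      rw [psiField_psiField hκ, if_neg fun h => by omega, add_zero]
      module

theorem creation_mul_self (hκ : IsLatticeCocycle κ) (x : FermionIndex n →₀ ℂ) :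
    creation κ x * creation κ x = 0 :=
  LinearMap.ext fun v => self_eq_neg.1 (creation_anticomm hκ x x v)

/-- The embedding of the symplectic fermions. -/
def fermionEmb (hκ : IsLatticeCocycle κ) : FermionSpace n →ₗ[ℂ] LatticeSpace (shortLattice n) :=
  LinearMap.applyₗ (latticeVac (shortLattice n)) ∘ₗ
    (ExteriorAlgebra.lift ℂ ⟨creation κ, creation_mul_self hκ⟩).toLinearMap

theorem fermionEmb_one (hκ : IsLatticeCocycle κ) :
    fermionEmb hκ 1 = latticeVac (shortLattice n) := by
  simp [fermionEmb]

theorem fermionEmb_algebraMap (hκ : IsLatticeCocycle κ) (c : ℂ) :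
    fermionEmb hκ (algebraMap ℂ _ c) = c • latticeVac (shortLattice n) := by
  rw [Algebra.algebraMap_eq_smul_one, map_smul, fermionEmb_one]

theorem fermionEmb_ι_mul (hκ : IsLatticeCocycle κ) (x : FermionIndex n →₀ ℂ) (v : FermionSpace n) :
    fermionEmb hκ (ExteriorAlgebra.ι ℂ x * v) = creation κ x (fermionEmb hκ v) := by
  simp [fermionEmb]

/-- The functional by which the mode `m` of `ψⁱ` or `ψ*ⁱ` contracts. -/
def annihilation (i : Fin n) (s : Bool) (m : ℕ) : Module.Dual ℂ (FermionIndex n →₀ ℂ) :=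
  -- At `m = 0` the truncated `m - 1` is harmless, since the scalar vanishes.
  ((if s then -1 else 1) * (m : ℂ)) • Finsupp.lapply (fermionIndex i (!s) (m - 1))

theorem fermionMode_natCast (i : Fin n) (s : Bool) (m : ℕ) (v : FermionSpace n) :
    fermionMode i s m v = CliffordAlgebra.contractLeft (annihilation i s m) v := by
  cases m with
  | zero =>
    have : annihilation i s 0 = 0 := by simp [annihilation]
    rw [this, map_zero]
    rfl
  | succ m =>
    have h : ((m + 1 : ℕ) : ℂ) = m + 1 := Nat.cast_succ m
    rw [annihilation, Nat.add_sub_cancel, h]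
    rfl

theorem fermionMode_neg (i : Fin n) (s : Bool) (k : ℕ) (v : FermionSpace n) :
    fermionMode i s (-1 - k) v =
      ExteriorAlgebra.ι ℂ (Finsupp.single (fermionIndex i s k) 1) * v := by
  rw [show (-1 - k : ℤ) = Int.negSucc k by rw [Int.negSucc_eq]; ring]
  rfl

theorem psiField_creation (hκ : IsLatticeCocycle κ) (i : Fin n) (s : Bool) (m : ℕ)
    (x : FermionIndex n →₀ ℂ) (v : LatticeSpace (shortLattice n)) :
    (psiField κ i s).1 m (creation κ x v) =
      annihilation i s m x • v - creation κ x ((psiField κ i s).1 m v) := by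
  induction x using Finsupp.induction_linear with
  | zero => simp
  | add x y hx hy =>
    rw [map_add, LinearMap.add_apply, map_add, hx, hy, map_add, LinearMap.add_apply]
    module
  | single x c =>
    rw [creation_single, LinearMap.smul_apply, map_smul, psiField_psiField hκ,
      LinearMap.smul_apply, annihilation, LinearMap.smul_apply, Finsupp.lapply_apply,
      Finsupp.single_apply]
    have h : x = fermionIndex i (!s) (m - 1) ↔ (ofLex x).1 = i ∧ (ofLex (ofLex x).2).1 = (!s) ∧
        (ofLex (ofLex x).2).2 = m - 1 := by
      constructor
      · rintro rfl
        exact ⟨rfl, rfl, rfl⟩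
      · rintro ⟨h1, h2, h3⟩
        rw [← h1, ← h2, ← h3]
        rfl
    rcases Nat.eq_zero_or_pos m with rfl | hm
    · simp
    · by_cases hx : x = fermionIndex i (!s) (m - 1)
      · have h' := h.1 hx
        rw [if_pos hx, if_pos ⟨h'.1.symm, h'.2.1, by rw [h'.2.2]; omega⟩]
        push_cast
        module
      · rw [if_neg hx, if_neg fun h' => hx (h.2 ⟨h'.1.symm, h'.2.1, by omega⟩)]
        module

/-- The embedding intertwines the modes of the symplectic fermions. -/
theorem fermionEmb_fermionMode (hκ : IsLatticeCocycle κ) (i : Fin n) (s : Bool) (m : ℤ)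
    (v : FermionSpace n) :
    fermionEmb hκ (fermionMode i s m v) = (psiField κ i s).1 m (fermionEmb hκ v) := by
  rcases lt_or_ge m 0 with hm | hm
  · obtain ⟨k, rfl⟩ : ∃ k : ℕ, m = -1 - k := ⟨(-1 - m).toNat, by omega⟩
    rw [fermionMode_neg, fermionEmb_ι_mul, creation_single, one_smul]
    rfl
  · obtain ⟨m, rfl⟩ := Int.eq_ofNat_of_zero_le hm
    rw [fermionMode_natCast]
    -- Non-negative modes on both sides kill the vacuum and obey the same antiderivation rule
    -- against a creation mode: `contractLeft_ι_mul` on one side, `psiField_creation` on the other.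
    induction v using CliffordAlgebra.left_induction with
    | algebraMap c =>
      rw [CliffordAlgebra.contractLeft_algebraMap, map_zero]
      have := fermionEmb_algebraMap hκ c
      rw [this, map_smul, psiField_vac hκ i s _ hm, smul_zero]
    | add v w hv hw => rw [map_add, map_add, map_add, map_add, hv, hw]
    | ι_mul v x hv =>
      have h := fermionEmb_ι_mul hκ x
      rw [CliffordAlgebra.contractLeft_ι_mul, map_sub, map_smul]
      erw [h, h]
      rw [hv, psiField_creation hκ]

end Symplectic

/-! ## Contractions on an exterior algebra -/

section Contraction

variable {I : Type*}

/-- The span of the monomials with factors in a set of basis vectors. -/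
def exteriorSpan (F : Set I) : Submodule ℂ (ExteriorAlgebra ℂ (I →₀ ℂ)) :=
  sInf {K | 1 ∈ K ∧ ∀ s ∈ F, ∀ x ∈ K, ExteriorAlgebra.ι ℂ (Finsupp.single s 1) * x ∈ K}

theorem exteriorSpan_le {F : Set I} {K : Submodule ℂ (ExteriorAlgebra ℂ (I →₀ ℂ))} (h0 : 1 ∈ K)
    (h : ∀ s ∈ F, ∀ x ∈ K, ExteriorAlgebra.ι ℂ (Finsupp.single s 1) * x ∈ K) :
    exteriorSpan F ≤ K := sInf_le ⟨h0, h⟩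

theorem one_mem_exteriorSpan (F : Set I) : 1 ∈ exteriorSpan F :=
  Submodule.mem_sInf.2 fun _ hK => hK.1

theorem ι_mul_mem_exteriorSpan {F : Set I} {s : I} (hs : s ∈ F)
    {x : ExteriorAlgebra ℂ (I →₀ ℂ)} (hx : x ∈ exteriorSpan F) :
    ExteriorAlgebra.ι ℂ (Finsupp.single s 1) * x ∈ exteriorSpan F :=
  Submodule.mem_sInf.2 fun K hK => hK.2 s hs x (Submodule.mem_sInf.1 hx K hK)

theorem exteriorSpan_mono {F G : Set I} (h : F ⊆ G) : exteriorSpan F ≤ exteriorSpan G :=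
  exteriorSpan_le (one_mem_exteriorSpan G) fun _ hs _ hx => ι_mul_mem_exteriorSpan (h hs) hx

theorem exists_mem_exteriorSpan [DecidableEq I] (x : ExteriorAlgebra ℂ (I →₀ ℂ)) :
    ∃ F : Finset I, x ∈ exteriorSpan (F : Set I) := by
  induction x using CliffordAlgebra.left_induction with
  | algebraMap c =>
    refine ⟨∅, ?_⟩
    rw [Algebra.algebraMap_eq_smul_one]
    exact Submodule.smul_mem _ _ (one_mem_exteriorSpan _)
  | add x y hx hy =>
    obtain ⟨F, hF⟩ := hx
    obtain ⟨G, hG⟩ := hy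
    refine ⟨F ∪ G, add_mem (exteriorSpan_mono ?_ hF) (exteriorSpan_mono ?_ hG)⟩
    · simp
    · simp
  | ι_mul x m hx =>
    obtain ⟨F, hF⟩ := hx
    refine ⟨F ∪ m.support, ?_⟩
    have hm : ExteriorAlgebra.ι ℂ m =
        ∑ s ∈ m.support, m s • ExteriorAlgebra.ι ℂ (Finsupp.single s 1) := by
      conv_lhs => rw [← Finsupp.sum_single m, Finsupp.sum, map_sum]
      refine Finset.sum_congr rfl fun s _ => ?_
      rw [← map_smul, Finsupp.smul_single, smul_eq_mul, mul_one]
    change ExteriorAlgebra.ι ℂ m * x ∈ _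
    rw [hm, Finset.sum_mul]
    refine sum_mem fun s hs => ?_
    rw [smul_mul_assoc]
    exact Submodule.smul_mem _ _ (ι_mul_mem_exteriorSpan (Finset.mem_union_right _ hs)
      (exteriorSpan_mono (by simp) hF))

theorem contractLeft_eq_zero_of_mem_exteriorSpan {F : Set I} {s : I} (hs : s ∉ F)
    {x : ExteriorAlgebra ℂ (I →₀ ℂ)} (hx : x ∈ exteriorSpan F) :
    CliffordAlgebra.contractLeft (Finsupp.lapply s) x = 0 := by
  have : exteriorSpan F ≤ LinearMap.ker (CliffordAlgebra.contractLeft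
      (Q := (0 : QuadraticForm ℂ (I →₀ ℂ))) (Finsupp.lapply s)) := by
    refine exteriorSpan_le ?_ fun t ht y hy => ?_
    · exact LinearMap.mem_ker.2 (CliffordAlgebra.contractLeft_one _ _)
    · rw [LinearMap.mem_ker] at hy ⊢
      have hst : t ≠ s := fun h => hs (h ▸ ht)
      refine (CliffordAlgebra.contractLeft_ι_mul _ _ _).trans ?_
      rw [hy, mul_zero, sub_zero, Finsupp.lapply_apply, Finsupp.single_eq_of_ne hst.symm, zero_smul]
  exact this hx

/-- The new basis vector can be anticommuted to the front, and its square vanishes there. -/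
theorem exteriorSpan_insert_le (F : Set I) (s : I) : exteriorSpan (insert s F) ≤
    exteriorSpan F ⊔ (exteriorSpan F).map
      (LinearMap.mulLeft ℂ (ExteriorAlgebra.ι ℂ (Finsupp.single s (1 : ℂ)))) := by
  refine exteriorSpan_le (Submodule.mem_sup_left (one_mem_exteriorSpan F)) fun t ht x hx => ?_
  obtain ⟨y, hy, _, ⟨z, hz, rfl⟩, rfl⟩ := Submodule.mem_sup.1 hx
  rw [mul_add, LinearMap.mulLeft_apply]
  rcases Set.mem_insert_iff.1 ht with rfl | ht
  · rw [← mul_assoc, ExteriorAlgebra.ι_sq_zero, zero_mul, add_zero]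
    exact Submodule.mem_sup_right ⟨y, hy, rfl⟩
  · rw [← mul_assoc, eq_neg_of_add_eq_zero_left (ExteriorAlgebra.ι_add_mul_swap _ _), neg_mul,
      mul_assoc]
    exact add_mem (Submodule.mem_sup_left (ι_mul_mem_exteriorSpan ht hy))
      (neg_mem (Submodule.mem_sup_right ⟨_, ι_mul_mem_exteriorSpan ht hz, rfl⟩))

/-- A subspace that is stable under contractions and does not contain `1` is zero. -/
theorem eq_bot_of_contractLeft_mem {N : Submodule ℂ (ExteriorAlgebra ℂ (I →₀ ℂ))}
    (h1 : 1 ∉ N) (hN : ∀ s, ∀ x ∈ N, CliffordAlgebra.contractLeft (Finsupp.lapply s) x ∈ N) :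
    N = ⊥ := by
  classical
  have key : ∀ F : Finset I, ∀ x ∈ N, x ∈ exteriorSpan (F : Set I) → x = 0 := by
    intro F
    induction F using Finset.induction_on with
    | empty =>
      intro x hx hF
      have : exteriorSpan ((∅ : Finset I) : Set I) ≤ Submodule.span ℂ {1} :=
        exteriorSpan_le (Submodule.mem_span_singleton_self 1) (by simp)
      obtain ⟨c, rfl⟩ := Submodule.mem_span_singleton.1 (this hF)
      by_cases hc : c = 0
      · rw [hc, zero_smul]
      · exact absurd ((Submodule.smul_mem_iff _ hc).1 hx) h1
    | insert s F hs ih =>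
      intro x hx hF
      rw [Finset.coe_insert] at hF
      -- The element is split as y + e_s z with y and z free of s. Contraction by s returns z, which
      -- therefore lies in `N` and is zero by induction.
      obtain ⟨y, hy, _, ⟨z, hz, rfl⟩, rfl⟩ := Submodule.mem_sup.1 (exteriorSpan_insert_le _ _ hF)
      have hs' : s ∉ (F : Set I) := by simpa using hs
      have e1 : CliffordAlgebra.contractLeft (Finsupp.lapply s)
          (ExteriorAlgebra.ι ℂ (Finsupp.single s 1) * z) = z := by
        refine (CliffordAlgebra.contractLeft_ι_mul _ _ _).trans ?_
        rw [contractLeft_eq_zero_of_mem_exteriorSpan hs' hz, mul_zero, sub_zero,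
          Finsupp.lapply_apply, Finsupp.single_eq_same, one_smul]
      have hz0 : z = 0 := by
        refine ih z ?_ hz
        have := hN s _ hx
        rwa [map_add, contractLeft_eq_zero_of_mem_exteriorSpan hs' hy, zero_add,
          LinearMap.mulLeft_apply, e1] at this
      rw [hz0, map_zero, add_zero] at hx ⊢
      exact ih y hx hy
  rw [eq_bot_iff]
  intro x hx
  obtain ⟨F, hF⟩ := exists_mem_exteriorSpan x
  exact key F x hx hF

end Contraction

/-! ### Injectivity and image of the embedding of the symplectic fermions -/

section Embedding

variable {n : ℕ} {κ : shortLattice n → shortLattice n → ℂˣ}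

theorem latticeVac_ne_zero : latticeVac (shortLattice n) ≠ 0 := by
  rw [latticeVac, Ne, Finsupp.single_eq_zero]
  exact one_ne_zero

/-- Positive modes act on the exterior algebra as non-zero multiples of the contractions, so the
kernel is stable under contraction; it does not contain 1, whose image is the vacuum. -/
theorem fermionEmb_injective (hκ : IsLatticeCocycle κ) : Function.Injective (fermionEmb hκ) := by
  rw [← LinearMap.ker_eq_bot]
  refine eq_bot_of_contractLeft_mem ?_ fun x v hv => ?_
  · rw [LinearMap.mem_ker, fermionEmb_one]
    exact latticeVac_ne_zero
  · have h := fermionEmb_fermionMode hκ (ofLex x).1 (!(ofLex (ofLex x).2).1)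
      (((ofLex (ofLex x).2).2 + 1 : ℕ) : ℤ) v
    have hx : fermionIndex (ofLex x).1 (ofLex (ofLex x).2).1 (ofLex (ofLex x).2).2 = x := rfl
    rw [LinearMap.mem_ker.1 hv, map_zero, fermionMode_natCast, annihilation, Nat.add_sub_cancel,
      Bool.not_not, hx, map_smul, LinearMap.smul_apply, map_smul] at h
    refine (smul_eq_zero.1 h).resolve_left (mul_ne_zero ?_ (Nat.cast_ne_zero.2 (Nat.succ_ne_zero _)))
    split_ifs <;> norm_num

/-! ### The image of the embedding -/

theorem psiField_mem_range (hκ : IsLatticeCocycle κ) (i : Fin n) (s : Bool) (m : ℤ)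
    {v : LatticeSpace (shortLattice n)} (hv : v ∈ LinearMap.range (fermionEmb hκ)) :
    (psiField κ i s).1 m v ∈ LinearMap.range (fermionEmb hκ) := by
  obtain ⟨x, rfl⟩ := hv
  rw [← fermionEmb_fermionMode]
  exact ⟨_, rfl⟩

theorem bField_zero_of_mem_range (hκ : IsLatticeCocycle κ) (i : Fin n)
    {v : LatticeSpace (shortLattice n)} (hv : v ∈ LinearMap.range (fermionEmb hκ)) :
    (bField κ i).1 0 v = 0 := by
  obtain ⟨x, rfl⟩ := hv
  exact (fermionEmb_fermionMode hκ i false 0 x).symm.trans (map_zero _)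

/-- The mode `m + 1` of ∂c is `-(m + 1)` times the mode `m` of c, so only c_{-1} is lost on passing
to the derivative. -/
theorem cField_mem_range (hκ : IsLatticeCocycle κ) (i : Fin n) (m : ℤ) (hm : m ≠ -1)
    {v : LatticeSpace (shortLattice n)} (hv : v ∈ LinearMap.range (fermionEmb hκ)) :
    (cField κ i).1 m v ∈ LinearMap.range (fermionEmb hκ) := by
  have h := psiField_mem_range hκ i true (m + 1) hv
  change (-((m + 1 : ℤ) : ℂ)) • (cField κ i).1 (m + 1 - 1) v ∈ _ at h
  rw [add_sub_cancel_right] at h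
  refine (Submodule.smul_mem_iff _ ?_).1 h
  rw [neg_ne_zero, Int.cast_ne_zero]
  omega

/-- The projection `b_0 c_{-1}` along the image of `c_{-1} b_0`. -/
def zeroModeProj (κ : shortLattice n → shortLattice n → ℂˣ) (i : Fin n) :
    Module.End ℂ (LatticeSpace (shortLattice n)) :=
  (bField κ i).1 0 * (cField κ i).1 (-1)

theorem zeroModeProj_apply (i : Fin n) (v : LatticeSpace (shortLattice n)) :
    zeroModeProj κ i v = (bField κ i).1 0 ((cField κ i).1 (-1) v) := rfl

theorem zeroModeProj_of_ker (hκ : IsLatticeCocycle κ) (i : Fin n)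
    {v : LatticeSpace (shortLattice n)} (hv : (bField κ i).1 0 v = 0) :
    zeroModeProj κ i v = v := by
  rw [zeroModeProj_apply, bField_cField hκ, hv, map_zero, neg_zero, zero_add,
    if_pos ⟨rfl, by norm_num⟩]

theorem zeroModeProj_bField (hκ : IsLatticeCocycle κ) (i j : Fin n) (m : ℤ) (hm : m < 0)
    (v : LatticeSpace (shortLattice n)) :
    zeroModeProj κ i ((bField κ j).1 m v) = (bField κ j).1 m (zeroModeProj κ i v) := by
  rw [zeroModeProj_apply, zeroModeProj_apply, cField_bField hκ, if_neg fun h => by omega,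
    add_zero, map_neg, bField_bField hκ, neg_neg]

theorem zeroModeProj_cField (hκ : IsLatticeCocycle κ) (i j : Fin n) (m : ℤ)
    (h : i ≠ j ∨ m ≠ -1) (v : LatticeSpace (shortLattice n)) :
    zeroModeProj κ i ((cField κ j).1 m v) = (cField κ j).1 m (zeroModeProj κ i v) := by
  rw [zeroModeProj_apply, zeroModeProj_apply, cField_cField hκ, map_neg, bField_cField hκ,
    if_neg fun h' => h.elim (fun h => h h'.1) fun h => h (by omega), add_zero, neg_neg]

theorem zeroModeProj_cField_self (hκ : IsLatticeCocycle κ) (i : Fin n)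
    (v : LatticeSpace (shortLattice n)) : zeroModeProj κ i ((cField κ i).1 (-1) v) = 0 := by
  have h := self_eq_neg.1 (cField_cField hκ i i (-1) (-1) v)
  rw [zeroModeProj_apply, h, map_zero]

/-- The product of the projections over a list. -/
def zeroModeProjList (κ : shortLattice n → shortLattice n → ℂˣ) (l : List (Fin n)) :
    Module.End ℂ (LatticeSpace (shortLattice n)) :=
  (l.map (zeroModeProj κ)).prod

theorem zeroModeProjList_cons (i : Fin n) (l : List (Fin n)) (v : LatticeSpace (shortLattice n)) :
    zeroModeProjList κ (i :: l) v = zeroModeProj κ i (zeroModeProjList κ l v) := by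
  rw [zeroModeProjList, List.map_cons, List.prod_cons, Module.End.mul_apply]
  rfl

theorem zeroModeProjList_of_ker (hκ : IsLatticeCocycle κ) {v : LatticeSpace (shortLattice n)}
    (hv : ∀ i, (bField κ i).1 0 v = 0) (l : List (Fin n)) : zeroModeProjList κ l v = v := by
  induction l with
  | nil => rfl
  | cons i l ih => rw [zeroModeProjList_cons, ih, zeroModeProj_of_ker hκ i (hv i)]

theorem zeroModeProjList_bField (hκ : IsLatticeCocycle κ) (l : List (Fin n)) (j : Fin n) (m : ℤ)
    (hm : m < 0) (v : LatticeSpace (shortLattice n)) :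
    zeroModeProjList κ l ((bField κ j).1 m v) = (bField κ j).1 m (zeroModeProjList κ l v) := by
  induction l with
  | nil => rfl
  | cons i l ih =>
    rw [zeroModeProjList_cons, zeroModeProjList_cons, ih, zeroModeProj_bField hκ i j m hm]

theorem zeroModeProjList_cField (hκ : IsLatticeCocycle κ) (l : List (Fin n)) (j : Fin n) (m : ℤ)
    (hm : m ≠ -1) (v : LatticeSpace (shortLattice n)) :
    zeroModeProjList κ l ((cField κ j).1 m v) = (cField κ j).1 m (zeroModeProjList κ l v) := by
  induction l with
  | nil => rfl
  | cons i l ih =>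
    rw [zeroModeProjList_cons, zeroModeProjList_cons, ih, zeroModeProj_cField hκ i j m (Or.inr hm)]

theorem zeroModeProjList_cField_neg_one (hκ : IsLatticeCocycle κ) (l : List (Fin n)) (j : Fin n)
    (v : LatticeSpace (shortLattice n)) : zeroModeProjList κ l ((cField κ j).1 (-1) v) =
      if j ∈ l then 0 else (cField κ j).1 (-1) (zeroModeProjList κ l v) := by
  induction l with
  | nil => rfl
  | cons i l ih =>
    rw [zeroModeProjList_cons, zeroModeProjList_cons, ih]
    by_cases hj : j ∈ l
    · rw [if_pos hj, if_pos (List.mem_cons_of_mem _ hj), map_zero]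
    · rw [if_neg hj]
      by_cases hij : i = j
      · subst hij
        rw [if_pos List.mem_cons_self, zeroModeProj_cField_self hκ]
      · rw [zeroModeProj_cField hκ i j _ (Or.inl hij), if_neg]
        rw [List.mem_cons]
        exact fun h => h.elim (fun h => hij h.symm) hj

/-- The image of the symplectic fermions is the joint kernel of the zero modes of `b`. -/
theorem mem_range_fermionEmb_iff (hκ : IsLatticeCocycle κ) (v : LatticeSpace (shortLattice n)) :
    v ∈ LinearMap.range (fermionEmb hκ) ↔ ∀ i, (bField κ i).1 0 v = 0 := by
  refine ⟨fun hv i => bField_zero_of_mem_range hκ i hv, fun hv => ?_⟩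
  -- The product of the projections maps the whole space into the image. By generation this is
  -- checked on negative modes: each c_{-1} is killed, and the others commute with the product and
  -- preserve the image. On the joint kernel the product is the identity.
  have htop : (LinearMap.range (fermionEmb hκ)).comap
      (zeroModeProjList κ (List.finRange n)) = ⊤ := by
    refine eq_top_of_neg_closed hκ ?_ (fun i m hm v hv => ?_) fun i m hm v hv => ?_
    · rw [Submodule.mem_comap, zeroModeProjList_of_ker hκ fun i => bField_vac hκ i 0 le_rfl]
      exact ⟨1, fermionEmb_one hκ⟩
    · rw [Submodule.mem_comap] at hv ⊢
      rw [zeroModeProjList_bField hκ _ _ _ hm]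
      exact psiField_mem_range hκ i false m hv
    · rw [Submodule.mem_comap] at hv ⊢
      by_cases hm1 : m = -1
      · rw [hm1, zeroModeProjList_cField_neg_one hκ, if_pos (List.mem_finRange i)]
        exact zero_mem _
      · rw [zeroModeProjList_cField hκ _ _ _ hm1]
        exact cField_mem_range hκ i m hm1 hv
  have : v ∈ (LinearMap.range (fermionEmb hκ)).comap (zeroModeProjList κ (List.finRange n)) :=
    htop ▸ Submodule.mem_top
  rwa [Submodule.mem_comap, zeroModeProjList_of_ker hκ hv] at this

end Embedding

/-! ## The state-field correspondence on symplectic fermions -/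

section FermionFields

variable {n : ℕ} {κ : shortLattice n → shortLattice n → ℂˣ}

/-- The field of a monomial in the creation modes. -/
def psiMonomial (κ : shortLattice n → shortLattice n → ℂˣ) :
    List (FermionIndex n) → FieldOn (LatticeSpace (shortLattice n))
  | [] => idF _
  | s :: l => nop ((-1) ^ l.length)
      (divDer (ofLex (ofLex s).2).2 (psiField κ (ofLex s).1 (ofLex (ofLex s).2).1))
      (psiMonomial κ l)

theorem fermionEmb_fermionMonomialMode (hκ : IsLatticeCocycle κ) (l : List (FermionIndex n))
    (m : ℤ) (v : FermionSpace n) : fermionEmb hκ (fermionMonomialMode l m v) =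
      (psiMonomial κ l).1 m (fermionEmb hκ v) := by
  induction l generalizing m v with
  | nil =>
    rw [psiMonomial, idF_apply, fermionMonomialMode]
    split_ifs
    · rfl
    · exact map_zero _
  | cons s l ih =>
    rw [psiMonomial, ← normalOrder_eq_nop, fermionMonomialMode, normalOrder, normalOrder]
    -- Injectivity lets the embedding pass through `finsum` without a proof that the sum on the
    -- fermion side is finite.
    refine ((fermionEmb hκ).toAddMonoidHom.map_finsum_of_injective
      (fermionEmb_injective hκ) _).trans ?_
    refine finsum_congr fun j => ?_
    change fermionEmb hκ _ = _
    rw [map_smul, map_add, map_smul, fermionEmb_fermionMode, ih, ih, fermionEmb_fermionMode]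

theorem superSign_one_natCast (r : ℕ) : superSign 1 r = (-1) ^ r := by
  induction r with
  | zero => simp
  | succ r ih =>
    rw [superSign_comm, Nat.cast_succ, superSign_add, superSign_comm, ih, superSign_one_one,
      pow_succ]

theorem psiMonomial_mem_full (hκ : IsLatticeCocycle κ) (l : List (FermionIndex n)) :
    psiMonomial κ l ∈ (shortGen hκ).full (l.length : ZMod 2) := by
  induction l with
  | nil => exact GeneratingFields.idF_mem_full
  | cons s l ih =>
    have := GeneratingFields.nop_mem_full (GeneratingFields.divDer_mem_full
      (psiField_mem_full hκ (ofLex s).1 (ofLex (ofLex s).2).1) (ofLex (ofLex s).2).2) ih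
    rw [superSign_one_natCast] at this
    rw [List.length_cons, Nat.cast_succ, add_comm]
    exact this

/-- The monomial in the creation modes with a given list of labels. -/
def fermionMonomial (l : List (FermionIndex n)) : FermionSpace n :=
  (l.map fun s => ExteriorAlgebra.ι ℂ (Finsupp.single s (1 : ℂ))).prod

theorem psiMonomial_vac (hκ : IsLatticeCocycle κ) (l : List (FermionIndex n)) :
    (psiMonomial κ l).1 (-1) (latticeVac (shortLattice n)) = fermionEmb hκ (fermionMonomial l) := by
  induction l with
  | nil =>
    rw [psiMonomial, idF_apply, if_pos rfl]
    exact (fermionEmb_one hκ).symm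
  | cons s l ih =>
    have h := GeneratingFields.nop_apply_vac (D := shortGen hκ) ((-1) ^ l.length)
      (divDer (ofLex (ofLex s).2).2 (psiField κ (ofLex s).1 (ofLex (ofLex s).2).1))
      (GeneratingFields.mem_full.1 (GeneratingFields.divDer_mem_full
        (psiField_mem_full hκ (ofLex s).1 (ofLex (ofLex s).2).1) (ofLex (ofLex s).2).2)).1.2.1
      (GeneratingFields.mem_full.1 (psiMonomial_mem_full hκ l)).1
    have h0 := divDer_apply_neg (ofLex (ofLex s).2).2 0
      (psiField κ (ofLex s).1 (ofLex (ofLex s).2).1) (fermionEmb hκ (fermionMonomial l))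
    simp only [Nat.cast_zero, sub_zero, add_zero, Nat.choose_zero_right, Nat.cast_one,
      one_smul] at h0
    rw [psiMonomial]
    refine h.trans ?_
    change (divDer _ _).1 (-1) ((psiMonomial κ l).1 (-1) (latticeVac (shortLattice n))) = _
    have h1 : fermionMonomial (s :: l) =
        ExteriorAlgebra.ι ℂ (Finsupp.single s (1 : ℂ)) * fermionMonomial l := by
      rw [fermionMonomial, List.map_cons, List.prod_cons, fermionMonomial]
    rw [ih, h0, h1, fermionEmb_ι_mul, creation_single, one_smul,
      show (-1 - ((ofLex (ofLex s).2).2 : ℤ)) = -((ofLex (ofLex s).2).2 : ℤ) - 1 by ring]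

/-- Both are good fields of the same parity creating the same state. Uniqueness thus replaces any
comparison of the fermionic and the bosonic normally ordered formulas. -/
theorem psiMonomial_eq (hκ : IsLatticeCocycle κ) (l : List (FermionIndex n)) :
    psiMonomial κ l = latticeYField κ (fermionEmb hκ (fermionMonomial l)) := by
  have hg := (GeneratingFields.mem_full.1 (psiMonomial_mem_full hκ l)).1
  have := eq_latticeYField shortLattice_isIntegral hκ hg (by
    have := hg.2.2.1 (-1) 0 _ (shortGen hκ).vac_mem
    rwa [add_zero] at this)
  rwa [psiMonomial_vac hκ] at this

theorem exteriorBasis_eq (S : Finset (FermionIndex n)) :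
    (Finsupp.basisSingleOne (R := ℂ) (ι := FermionIndex n)).ExteriorAlgebra S =
      fermionMonomial (S.sort (· ≤ ·)) := by
  refine ((ExteriorAlgebra.basis_apply_ofCard _ rfl).trans
    (ExteriorAlgebra.ιMulti_apply _)).trans ?_
  rw [fermionMonomial]
  congr 1
  refine List.ext_getElem (by simp) fun i h1 h2 => ?_
  rw [List.getElem_ofFn, List.getElem_map, Function.comp_apply]
  exact congrArg _ (congrFun Finsupp.coe_basisSingleOne _)

/-- The embedding preserves all products. -/
theorem fermionEmb_fermionY (hκ : IsLatticeCocycle κ) (a b : FermionSpace n) (m : ℤ) :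
    fermionEmb hκ (fermionY a m b) =
      (latticeYField κ (fermionEmb hκ a)).1 m (fermionEmb hκ b) := by
  set B := (Finsupp.basisSingleOne (R := ℂ) (ι := FermionIndex n)).ExteriorAlgebra
  let E : FieldOn (LatticeSpace (shortLattice n)) →ₗ[ℂ] LatticeSpace (shortLattice n) :=
    LinearMap.applyₗ (fermionEmb hκ b) ∘ₗ LinearMap.proj m ∘ₗ
      (fieldModule (LatticeSpace (shortLattice n))).subtype
  have hE : ∀ A, E A = A.1 m (fermionEmb hκ b) := fun A => rfl
  have ha : a = (B.repr a).sum fun S c => c • B S := (B.linearCombination_repr a).symm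
  rw [← hE]
  conv_rhs => rw [ha]
  rw [fermionY, Finsupp.sum, Finsupp.sum, map_sum, map_sum, map_sum, map_sum]
  refine Finset.sum_congr rfl fun S _ => ?_
  rw [map_smul, map_smul, map_smul, map_smul, hE, exteriorBasis_eq, ← psiMonomial_eq,
    fermionEmb_fermionMonomialMode]

/-! ### Parity -/

theorem creation_mem_latticePar (hκ : IsLatticeCocycle κ) (x : FermionIndex n →₀ ℂ) {q : ZMod 2}
    {v : LatticeSpace (shortLattice n)} (hv : v ∈ latticePar (shortLattice n) q) :
    creation κ x v ∈ latticePar (shortLattice n) (1 + q) := by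
  induction x using Finsupp.induction_linear with
  | zero => rw [map_zero]; exact zero_mem _
  | add x y hx hy => rw [map_add]; exact add_mem hx hy
  | single s c =>
    rw [creation_single]
    exact Submodule.smul_mem _ _
      ((GeneratingFields.mem_full.1 (psiField_mem_full hκ _ _)).1.2.2.1 _ q v hv)

theorem fermionEmb_mem_latticePar (hκ : IsLatticeCocycle κ) {p : ZMod 2} {x : FermionSpace n}
    (hx : x ∈ CliffordAlgebra.evenOdd (0 : QuadraticForm ℂ (FermionIndex n →₀ ℂ)) p) :
    fermionEmb hκ x ∈ latticePar (shortLattice n) p := by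
  have hpow : ∀ r : ℕ, LinearMap.range (ExteriorAlgebra.ι ℂ (M := FermionIndex n →₀ ℂ)) ^ r ≤
      (latticePar (shortLattice n) (r : ZMod 2)).comap (fermionEmb hκ) := by
    intro r
    induction r with
    | zero =>
      rw [pow_zero, Submodule.one_le, Submodule.mem_comap, fermionEmb_one]
      exact (shortGen hκ).vac_mem
    | succ r ih =>
      rw [pow_succ', Submodule.mul_le]
      rintro _ ⟨y, rfl⟩ z hz
      rw [Submodule.mem_comap, fermionEmb_ι_mul, Nat.cast_succ, add_comm]
      exact creation_mem_latticePar hκ y (ih hz)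
  have : CliffordAlgebra.evenOdd (0 : QuadraticForm ℂ (FermionIndex n →₀ ℂ)) p ≤
      (latticePar (shortLattice n) p).comap (fermionEmb hκ) :=
    iSup_le fun ⟨r, hr⟩ => hr ▸ hpow r
  exact this hx

/-- The embedding respects parity. For the converse, the odd component has an image that is both
even and odd, hence zero, and injectivity removes it. -/
theorem mem_fermionEven_iff (hκ : IsLatticeCocycle κ) (x : FermionSpace n) :
    x ∈ fermionEven n ↔ fermionEmb hκ x ∈ latticePar (shortLattice n) 0 := by
  refine ⟨fermionEmb_mem_latticePar hκ, fun hx => ?_⟩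
  have hc := (CliffordAlgebra.evenOdd_isCompl
    (0 : QuadraticForm ℂ (FermionIndex n →₀ ℂ))).codisjoint.eq_top
  have hx' : x ∈ CliffordAlgebra.evenOdd (0 : QuadraticForm ℂ (FermionIndex n →₀ ℂ)) 0 ⊔
      CliffordAlgebra.evenOdd 0 1 := hc ▸ Submodule.mem_top
  obtain ⟨y, hy, z, hz, rfl⟩ := Submodule.mem_sup.1 hx'
  have h0 : fermionEmb hκ z ∈ latticePar (shortLattice n) 0 := by
    have h := Submodule.sub_mem _ hx (fermionEmb_mem_latticePar hκ hy)
    have e : fermionEmb hκ (y + z) = fermionEmb hκ y + fermionEmb hκ z := map_add _ _ _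
    rwa [e, add_sub_cancel_left] at h
  have h1 := fermionEmb_mem_latticePar hκ hz
  have hd : Disjoint (latticePar (shortLattice n) 0) (latticePar (shortLattice n) 1) := by
    refine Finsupp.disjoint_supported_supported (Set.disjoint_left.2 fun l h h' => ?_)
    have h2 : (0 : ZMod 2) = 1 := h.symm.trans h'
    exact absurd h2 (by decide)
  have hz0 : z = 0 := fermionEmb_injective hκ
    ((Submodule.disjoint_def.1 hd _ h0 h1).trans (map_zero _).symm)
  rw [hz0]
  exact add_mem hy (zero_mem _)

theorem screeningKernel_eq_map (hn : 1 ≤ n) (hκ : IsLatticeCocycle κ) :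
    (fermionEven n).map (fermionEmb hκ) = screeningKernel n κ := by
  ext v
  rw [screeningKernel, longSpace_eq hn, Submodule.mem_inf, Submodule.mem_iInf]
  have h : (∀ i, v ∈ LinearMap.ker (screening κ (shortMomentum n i))) ↔
      v ∈ LinearMap.range (fermionEmb hκ) := (mem_range_fermionEmb_iff hκ v).symm
  rw [h]
  constructor
  · rintro ⟨x, hx, rfl⟩
    exact ⟨(mem_fermionEven_iff hκ x).1 hx, x, rfl⟩
  · rintro ⟨hv, x, rfl⟩
    exact ⟨x, (mem_fermionEven_iff hκ x).2 hv, rfl⟩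

theorem screeningKernel_le (hn : 1 ≤ n) :
    screeningKernel n κ ≤ latticePar (shortLattice n) 0 := by
  rw [screeningKernel, longSpace_eq hn]
  exact inf_le_left

/-- Closure is read off on the fermionic side: the image of the embedding is closed because the
embedding carries `fermionY` to the lattice products, and even parts are closed by parity. -/
theorem latticeYField_mem_screeningKernel (hn : 1 ≤ n) (hκ : IsLatticeCocycle κ) :
    ∀ a ∈ screeningKernel n κ, ∀ b ∈ screeningKernel n κ, ∀ m : ℤ,
      (latticeYField κ a).1 m b ∈ screeningKernel n κ := by
  rw [← screeningKernel_eq_map hn hκ]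
  rintro _ ⟨a, ha, rfl⟩ _ ⟨b, hb, rfl⟩ m
  rw [← fermionEmb_fermionY]
  refine ⟨_, (mem_fermionEven_iff hκ _).2 ?_, rfl⟩
  rw [fermionEmb_fermionY]
  have := latticeYField_mem_latticePar shortLattice_isIntegral hκ
    ((mem_fermionEven_iff hκ a).1 ha) ((mem_fermionEven_iff hκ b).1 hb) m
  rwa [add_zero] at this

/-- The even symplectic fermions as the joint kernel of the screenings. -/
def fermionEquiv (hn : 1 ≤ n) (hκ : IsLatticeCocycle κ) : fermionEven n ≃ₗ[ℂ] screeningKernel n κ :=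
  (Submodule.equivMapOfInjective _ (fermionEmb_injective hκ) _).trans
    (LinearEquiv.ofEq _ _ (screeningKernel_eq_map hn hκ))

end FermionFields

/-! ## Transport of vertex algebras -/

section Transport

variable {V W : Type*} [AddCommGroup V] [Module ℂ V] [AddCommGroup W] [Module ℂ W]

/-- The vertex algebra structure pulled back along a linear equivalence. -/
def VertexAlgebra.comap (B : VertexAlgebra W) (e : V ≃ₗ[ℂ] W) : VertexAlgebra V where
  vac := e.symm B.vac
  mode m := ((B.mode m).compl₁₂ e.toLinearMap e.toLinearMap).compr₂ e.symm.toLinearMap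
  truncation a b := by
    obtain ⟨N, hN⟩ := B.truncation (e a) (e b)
    exact ⟨N, fun m hm => by simp [hN m hm]⟩
  vac_mode m b := by
    simp only [LinearMap.compr₂_apply, LinearMap.compl₁₂_apply, LinearEquiv.coe_coe,
      LinearEquiv.apply_symm_apply, B.vac_mode]
    split_ifs <;> simp
  mode_vac a := by simp [B.mode_vac]
  mode_vac_of_nonneg m a hm := by simp [B.mode_vac_of_nonneg m _ hm]
  translation m a b := by
    simp only [LinearMap.compr₂_apply, LinearMap.compl₁₂_apply, LinearEquiv.coe_coe,
      LinearEquiv.apply_symm_apply]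
    rw [← map_sub, B.translation, map_smul]
  locality a b := by
    obtain ⟨N, hN⟩ := B.locality (e a) (e b)
    refine ⟨N, fun m k c => ?_⟩
    have := congrArg e.symm (hN m k (e c))
    rw [map_zero, map_sum] at this
    rw [← this]
    refine Finset.sum_congr rfl fun j _ => ?_
    simp only [LinearMap.compr₂_apply, LinearMap.compl₁₂_apply, LinearEquiv.coe_coe,
      LinearEquiv.apply_symm_apply]
    rw [← map_sub, ← map_smul]

/-- The equivalence along which a vertex algebra structure is pulled back is an isomorphism. -/
def VertexAlgebra.comapIso (B : VertexAlgebra W) (e : V ≃ₗ[ℂ] W) : (B.comap e).Iso B where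
  toEquiv := e
  map_vac := e.apply_symm_apply _
  map_mode _ _ _ := e.apply_symm_apply _

end Transport

end

/-! ### Assembly of the theorem -/

theorem mainTheorem1 (n : ℕ) (hn : 1 ≤ n)
    (κ : shortLattice n → shortLattice n → ℂˣ) (hκ : IsLatticeCocycle κ) :
    Orthonormal ℝ (fun i => (shortMomentum n i : Euc n)) ∧
    (longLattice n : Set (Euc n)) =
      {v | ∃ x : Fin n → ℤ, Even (∑ i, x i) ∧ v = ∑ i, x i • (shortMomentum n i : Euc n)} ∧
    (∀ (i j : Fin n) (v : LatticeSpace (shortLattice n)),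
      screening κ (shortMomentum n i) (screening κ (shortMomentum n j) v) =
        -screening κ (shortMomentum n j) (screening κ (shortMomentum n i) v)) ∧
    ∃ (VL : VertexAlgebra (longSpace n)) (W : VertexAlgebra (screeningKernel n κ))
      (SF : VertexAlgebra (fermionEven n)),
      VL.IsRestrictionOf (latticeVac (shortLattice n)) (latticeY κ) ∧
      W.IsRestrictionOf (latticeVac (shortLattice n)) (latticeY κ) ∧
      SF.IsRestrictionOf 1 fermionY ∧
      Nonempty (SF.Iso W) := by
  have hL : ∀ a ∈ longSpace n, ∀ b ∈ longSpace n, ∀ m : ℤ,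
      (latticeYField κ a).1 m b ∈ longSpace n := by
    rw [longSpace_eq hn]
    intro a ha b hb m
    have := latticeYField_mem_latticePar shortLattice_isIntegral hκ ha hb m
    rwa [add_zero] at this
  have hvacL : latticeVac (shortLattice n) ∈ longSpace n := by
    rw [longSpace_eq hn]
    exact (shortGen hκ).vac_mem
  have hW := latticeYField_mem_screeningKernel hn hκ
  have hone : (1 : FermionSpace n) ∈ fermionEven n := by
    rw [mem_fermionEven_iff hκ, fermionEmb_one]
    exact (shortGen hκ).vac_mem
  have hvacW : latticeVac (shortLattice n) ∈ screeningKernel n κ := by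
    rw [← screeningKernel_eq_map hn hκ]
    exact ⟨1, hone, fermionEmb_one hκ⟩
  let W := restrictedVA hW shortLattice_isIntegral hκ (screeningKernel_le hn) hvacW
  let e := fermionEquiv hn hκ
  -- The structure on the even symplectic fermions is the pullback of `W` along `e`, so the
  -- isomorphism is immediate. What remains is that its vacuum and products are those of `fermionY`,
  -- which follows by applying the injective embedding.
  refine ⟨shortMomentum_orthonormal, longLattice_eq hn, fun i j v => bField_bField hκ i j 0 0 v,
    restrictedVA hL shortLattice_isIntegral hκ (longSpace_eq hn).le hvacL, W, W.comap e,
    restrictedVA_isRestrictionOf _ _ _ _ _, restrictedVA_isRestrictionOf _ _ _ _ _, ⟨?_, ?_⟩,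
    ⟨W.comapIso e⟩⟩
  · have h : e.symm W.vac = ⟨1, hone⟩ := by
      rw [LinearEquiv.symm_apply_eq]
      exact Subtype.ext (fermionEmb_one hκ).symm
    exact congrArg Subtype.val h
  · intro m a b
    refine fermionEmb_injective hκ ?_
    rw [fermionEmb_fermionY]
    exact congrArg Subtype.val (e.apply_symm_apply (W.mode m (e a) (e b)))
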